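/- Let $(X,\omega)$ be a connected (Hausdorff, second countable) smooth symplectic 4-manifold with an effective Hamiltonian action of $\mathbb T^2=\mathbb R^2/2\pi\mathbb Z^2$ whose moment map $\mu:X\to\mathbb R^2$ is proper onto its image $P=\mu(X)$, which is convex. Assume that $X$ is unbounded, that is, $P$ is an unbounded moment polygon with finitely many vertices: a region $P=\{x:\langle x,\nu_j\rangle+c_j\ge 0,\ j=1,\dots,d\}$ with $d\ge 1$ edges $E_1,\dots,E_d$, where $\nu_j\in\mathbb Z^2$ is the primitive interior normal of $E_j$, the normals of intersecting edges form a $\mathbb Z$-basis of $\mathbb Z^2$, and the edges are ordered so that $E_1$ and $E_d$ are unbounded, $E_{j-1}\cap E_j\neq\emptyset$ and $\det(\nu_{j-1},\nu_j)=-1$ for $j=2,\dots,d$. Suppose that the first Chern class $c_1(X)\in H^2(X;\mathbb Z)$, i.e. the first Chern class of $TX$ with an $\omega$-compatible almost complex structure, is zero. Then: 1. there is $A\in SL(2,\mathbb Z)$ with $A\nu_j=(j-1,\,-(j-2))$ for all $j=1,\dots,d$; that is, the normals are $SL(2,\mathbb Z)$-equivalent to $(0,1),(1,0),(2,-1),\dots,(d-1,-(d-2))$;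 2. there are $\alpha,\beta\in\mathbb R$ such that $\eta=(-\beta,\alpha)$ is non-zero and satisfies $\eta\cdot\nu_j=1$ for all $j=1,\dots,d$, and such that $\nu=(\alpha,\beta)$ satisfies $\det(\nu,\nu_1)>0$ and $\det(\nu,\nu_d)>0$. -/

import Mathlib

open scoped Manifold ContDiff RealInnerProductSpace
open Bundle

universe u

attribute [instance 2000] chartedSpaceSelf

namespace Toric

/-- The Euclidean plane, used both as the Lie algebra of the two-torus (with lattice `2πℤ²`) and,
through the standard inner product, as its dual. -/
abbrev Plane : Type := EuclideanSpace ℝ (Fin 2)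

/-- The model space of real 4-manifolds. -/
abbrev Model4 : Type := EuclideanSpace ℝ (Fin 4)

/-- The determinant of the 2 by 2 matrix with columns `a`, `b`. -/
def planeDet {R : Type*} [CommRing R] (a b : Fin 2 → R) : R := a 0 * b 1 - a 1 * b 0

section Geometry

variable (X : Type u) [TopologicalSpace X] [ChartedSpace Model4 X] [IsManifold (𝓡 4) ∞ X]

/-- A smooth field of bilinear forms on the tangent spaces of `X`, written in the preferred chart
at `x₀`: the coefficient of the constant vectors `v`, `w` at the point `y` of the chart. -/
noncomputable def chartCoeff {X : Type u} [TopologicalSpace X] [ChartedSpace Model4 X]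
    (Ω : ∀ x : X, TangentSpace (𝓡 4) x →L[ℝ] TangentSpace (𝓡 4) x →L[ℝ] ℝ)
    (x₀ : X) (v w : Model4) (y : Model4) : ℝ :=
  Ω ((chartAt Model4 x₀).symm y)
    (mfderiv (𝓡 4) (𝓡 4) (chartAt Model4 x₀).symm y v)
    (mfderiv (𝓡 4) (𝓡 4) (chartAt Model4 x₀).symm y w)

/-- A symplectic form on a smooth 4-manifold: a smooth, alternating, nondegenerate, closed 2-form.
Closedness is `dΩ = 0` in the charts, where for constant vector fields
`dΩ(v₁, v₂, v₃) = ∂_{v₁} Ω(v₂, v₃) + ∂_{v₂} Ω(v₃, v₁) + ∂_{v₃} Ω(v₁, v₂)`. -/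
structure SymplecticForm where
  form : ∀ x : X, TangentSpace (𝓡 4) x →L[ℝ] TangentSpace (𝓡 4) x →L[ℝ] ℝ
  smooth : ContMDiff (𝓡 4) ((𝓡 4).prod 𝓘(ℝ, Model4 →L[ℝ] Model4 →L[ℝ] ℝ)) ∞
    (fun x => TotalSpace.mk' (Model4 →L[ℝ] Model4 →L[ℝ] ℝ)
      (E := fun x : X => TangentSpace (𝓡 4) x →L[ℝ] TangentSpace (𝓡 4) x →L[ℝ] ℝ) x (form x))
  alternating : ∀ (x : X) (v : TangentSpace (𝓡 4) x), form x v v = 0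
  nondegenerate : ∀ (x : X) (v : TangentSpace (𝓡 4) x), (∀ w, form x v w = 0) → v = 0
  closed : ∀ (x₀ : X), ∀ y ∈ (chartAt Model4 x₀).target, ∀ v₁ v₂ v₃ : Model4,
    fderiv ℝ (chartCoeff form x₀ v₂ v₃) y v₁ + fderiv ℝ (chartCoeff form x₀ v₃ v₁) y v₂
      + fderiv ℝ (chartCoeff form x₀ v₁ v₂) y v₃ = 0

/-- An effective smooth action of the two-torus `ℝ²/2πℤ²` on `X`, given through the projection
`ℝ² → ℝ²/2πℤ²`: a smooth action of `ℝ²` in which exactly the elements of `2πℤ²` act trivially. -/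
structure EffectiveTorusAction where
  act : Plane → X → X
  smooth : ContMDiff ((𝓡 2).prod (𝓡 4)) (𝓡 4) ∞ (fun p : Plane × X => act p.1 p.2)
  act_zero : ∀ x, act 0 x = x
  act_add : ∀ s t x, act (s + t) x = act s (act t x)
  effective : ∀ t : Plane, (∀ x, act t x = x) ↔ ∃ m : Fin 2 → ℤ, ∀ k, t k = 2 * Real.pi * m k

variable {X}

/-- The vector field on `X` generated by `ξ`: its value at `x` is the velocity at time `0` of
`t ↦ (t ξ) · x`. (The derivative lives over `act 0 x`, which is the point `x`.) -/
noncomputable def EffectiveTorusAction.generator (τ : EffectiveTorusAction X) (ξ : Plane) (x : X) :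
    TangentSpace (𝓡 4) x :=
  (mfderiv (𝓡 2) (𝓡 4) (fun t : Plane => τ.act t x) 0 ξ : Model4)

/-- `μ` makes `τ` and `Ω` into a symplectic toric 4-manifold: the action preserves `Ω`, the smooth
map `μ : X → ℝ²` is a moment map for it, and `μ` is proper onto its image, which is convex.
The sign is the one of `Ω = dx₁ ∧ dθ₁ + dx₂ ∧ dθ₂` and `μ = (x₁, x₂)`. -/
structure IsToricMomentMap (Ω : SymplecticForm X) (τ : EffectiveTorusAction X) (μ : X → Plane) :
    Prop where
  symplectic : ∀ (t : Plane) (x : X) (v w : TangentSpace (𝓡 4) x),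
    Ω.form (τ.act t x) (mfderiv (𝓡 4) (𝓡 4) (τ.act t) x v) (mfderiv (𝓡 4) (𝓡 4) (τ.act t) x w)
      = Ω.form x v w
  smooth : ContMDiff (𝓡 4) (𝓡 2) ∞ μ
  invariant : ∀ (t : Plane) (x : X), μ (τ.act t x) = μ x
  hamiltonian : ∀ (x : X) (v : TangentSpace (𝓡 4) x) (ξ : Plane),
    ⟪(mfderiv (𝓡 4) (𝓡 2) μ x v : Plane), ξ⟫ = Ω.form x v (τ.generator ξ x)
  convex_range : Convex ℝ (Set.range μ)
  proper : IsProperMap (Set.rangeFactorization μ)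

/-- A smooth almost complex structure `J` on `X` compatible with `Ω`: `J² = -1` and
`Ω(·, J·)` is a Riemannian metric. -/
structure CompatibleJ (Ω : SymplecticForm X) where
  J : ∀ x : X, TangentSpace (𝓡 4) x →L[ℝ] TangentSpace (𝓡 4) x
  smooth : ContMDiff (𝓡 4) ((𝓡 4).prod 𝓘(ℝ, Model4 →L[ℝ] Model4)) ∞
    (fun x => TotalSpace.mk' (Model4 →L[ℝ] Model4)
      (E := fun x : X => TangentSpace (𝓡 4) x →L[ℝ] TangentSpace (𝓡 4) x) x (J x))
  sq : ∀ (x : X) (v : TangentSpace (𝓡 4) x), J x (J x v) = -v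
  compatible : ∀ (x : X) (v w : TangentSpace (𝓡 4) x),
    Ω.form x (J x v) (J x w) = Ω.form x v w
  positive : ∀ (x : X) (v : TangentSpace (𝓡 4) x), v ≠ 0 → 0 < Ω.form x v (J x v)

/-- Multiplication of a tangent vector by a complex number in the complex vector space `(T_x X, J)`:
`(a + ib) v = a v + b J v`. -/
noncomputable def CompatibleJ.cmul {Ω : SymplecticForm X} (j : CompatibleJ Ω) {x : X} (c : ℂ)
    (v : TangentSpace (𝓡 4) x) : TangentSpace (𝓡 4) x :=
  c.re • v + c.im • j.J x v

/-- Data for computing the first Chern class of the rank 2 complex vector bundle `(TX, J)`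
in Čech cohomology: an open cover `U`, continuous complex frames over its members, the transition
matrices `g i j` (frame `j` equals frame `i` times `g i j`), and continuous logarithms
of their determinants, `exp (2πi · log i j) = det (g i j)`, over the double intersections. -/
structure ChernData {Ω : SymplecticForm X} (j : CompatibleJ Ω) (ι : Type u) where
  U : ι → Set X
  isOpen_U : ∀ i, IsOpen (U i)
  cover : ∀ x, ∃ i, x ∈ U i
  frame : ι → Fin 2 → ∀ x : X, TangentSpace (𝓡 4) x
  frame_continuous : ∀ i k,
    ContinuousOn (fun x => (⟨x, frame i k x⟩ : TangentBundle (𝓡 4) X)) (U i)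
  frame_independent : ∀ i, ∀ x ∈ U i, ∀ c : Fin 2 → ℂ,
    ∑ k, j.cmul (c k) (frame i k x) = 0 → c = 0
  g : ι → ι → X → Matrix (Fin 2) (Fin 2) ℂ
  transition : ∀ i i', ∀ x ∈ U i ∩ U i', ∀ l,
    frame i' l x = ∑ k, j.cmul (g i i' x k l) (frame i k x)
  log : ι → ι → X → ℂ
  log_continuous : ∀ i i', ContinuousOn (log i i') (U i ∩ U i')
  exp_log : ∀ i i', ∀ x ∈ U i ∩ U i',
    Complex.exp (2 * Real.pi * Complex.I * log i i' x) = (g i i' x).det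

/-- The Čech 2-cocycle of locally constant integers that represents `c₁(TX, J)`: the Čech
coboundary of the logarithms, which is the image of the class of `det g` under the connecting map
of the exponential sequence `0 → ℤ → ℂ → ℂˣ → 0` of sheaves of continuous functions. -/
def ChernData.cocycle {Ω : SymplecticForm X} {j : CompatibleJ Ω} {ι : Type u} (D : ChernData j ι)
    (i₁ i₂ i₃ : ι) (x : X) : ℂ :=
  D.log i₂ i₃ x - D.log i₁ i₃ x + D.log i₁ i₂ x

/-- `c₁(TX, J) = 0` in `H²(X; ℤ)`: on a fine enough open cover, the cocycle representing it is the
coboundary of a Čech 1-cochain `m` of locally constant integers. -/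
def CompatibleJ.ChernClassEqZero {Ω : SymplecticForm X} (j : CompatibleJ Ω) : Prop :=
  ∃ (ι : Type u) (D : ChernData j ι) (m : ι → ι → X → ℤ),
    (∀ i i', ContinuousOn (m i i') (D.U i ∩ D.U i')) ∧
    ∀ i₁ i₂ i₃, ∀ x ∈ D.U i₁ ∩ D.U i₂ ∩ D.U i₃,
      D.cocycle i₁ i₂ i₃ x = ((m i₂ i₃ x - m i₁ i₃ x + m i₁ i₂ x : ℤ) : ℂ)

/-- The first Chern class of the symplectic manifold `(X, Ω)` vanishes. It is the first Chern class
of `(TX, J)` for a compatible almost complex structure `J`; these exist, and the class does not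
depend on the choice among them. -/
def SymplecticForm.FirstChernClassEqZero (Ω : SymplecticForm X) : Prop :=
  ∃ j : CompatibleJ Ω, j.ChernClassEqZero

end Geometry

/-- The affine function `x ↦ ⟨x, ν⟩ + c`. -/
def affineForm (ν : Fin 2 → ℤ) (c : ℝ) (x : Plane) : ℝ := x 0 * ν 0 + x 1 * ν 1 + c

/-- The edge of `P` cut out by `⟨x, ν⟩ + c = 0`. -/
def edge (P : Set Plane) (ν : Fin 2 → ℤ) (c : ℝ) : Set Plane := {x ∈ P | affineForm ν c x = 0}

/-- `P` is an unbounded moment polygon with finitely many vertices, and `ν 0, …, ν n` are the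
primitive interior normals of its `d = n + 1` edges, ordered along the boundary of `P` as usual:
the first and the last edge are unbounded, consecutive edges meet, and the normals of consecutive
edges form a `ℤ`-basis of `ℤ²`, ordered so that `det (ν (i-1), ν i) = -1`. -/
structure IsOrderedMomentPolygon {n : ℕ} (P : Set Plane) (ν : Fin (n + 1) → Fin 2 → ℤ)
    (c : Fin (n + 1) → ℝ) : Prop where
  eq_halfPlanes : P = {x | ∀ i, 0 ≤ affineForm (ν i) (c i) x}
  edge_nontrivial : ∀ i, (edge P (ν i) (c i)).Nontrivial
  primitive : ∀ i, IsCoprime (ν i 0) (ν i 1)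
  injective : Function.Injective ν
  unbounded_first : ¬ Bornology.IsBounded (edge P (ν 0) (c 0))
  unbounded_last : ¬ Bornology.IsBounded (edge P (ν (Fin.last n)) (c (Fin.last n)))
  consecutive : ∀ i : Fin n,
    (edge P (ν i.castSucc) (c i.castSucc) ∩ edge P (ν i.succ) (c i.succ)).Nonempty
  det_consecutive : ∀ i : Fin n, planeDet (ν i.castSucc) (ν i.succ) = -1

end Toric

/-!
The vanishing of the first Chern class gives a continuous nowhere vanishing complex area form on
`(TX, J)` (`CompatibleJ.ChernClassEqZero.exists_areaForm`). Evaluate it on the vector fields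
generated by the standard basis of the Lie algebra of the torus. The orbits of the torus are
isotropic, hence totally real where the action is locally free, so this is a continuous function
`AreaForm.orbitArea` on `X` which vanishes exactly outside the set of regular points.

Along the loop that a lattice vector `m` traces out in the orbit of a regular point the function has
a winding number `w m`, which is additive in `m`. It is locally constant in the point, and the
points that are not regular form a closed set of codimension two: near a point on a one-dimensional
orbit it is a submanifold of dimension two (`IsToricMomentMap.exists_chart_regularSet`), and fixed
points are isolated (`IsToricMomentMap.eventually_exists_modelGen_ne_zero`). As `X` is connected,
`w : ℤ² → ℤ` does not depend on the point (`AreaForm.exists_winding_uniform`).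

If `m` is the normal of an edge, the Hamiltonian of `m` attains its minimum over the edge, so the
circle generated by `m` fixes the points there. It rotates the normal plane of the fixed point set
once, in the positive sense: effectiveness makes the weight `±1` (`IsCircleRep.cube_eq_neg`), and
the Hessian of the Hamiltonian at its minimum is nonnegative. So `w m = 1`
(`IsToricMomentMap.winding_eq_one`). The homomorphism `w` is then a linear function with value `1`
at every normal: this is the second claim, and the first follows by a computation with two by two
matrices (`exists_specialLinearGroup_mulVec_eq`).
-/

set_option linter.unusedSectionVars false

namespace Toric

/-! ### Periodic one-parameter groups of symplectic maps in dimension four -/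

section LinearAlgebra

variable {V : Type*} [NormedAddCommGroup V] [NormedSpace ℝ V]

/-- `ρ` is a linear representation of the circle `ℝ/2πℤ` on `V` with infinitesimal generator `A`. -/
structure IsCircleRep (ρ : ℝ → V →L[ℝ] V) (A : V →L[ℝ] V) : Prop where
  map_zero : ρ 0 = 1
  hasDerivAt : ∀ s v, HasDerivAt (fun s => ρ s v) (ρ s (A v)) s
  map_two_pi : ρ (2 * Real.pi) = 1

namespace IsCircleRep

variable {ρ : ℝ → V →L[ℝ] V} {A : V →L[ℝ] V} (h : IsCircleRep ρ A)
include h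

theorem apply_of_ker {v : V} (hv : A v = 0) (s : ℝ) : ρ s v = v := by
  have hd : ∀ s, HasDerivAt (fun s => ρ s v) 0 s := fun s => by simpa [hv] using h.hasDerivAt s v
  have := is_const_of_deriv_eq_zero (fun s => (hd s).differentiableAt) (fun s => (hd s).deriv) s 0
  simpa [h.map_zero] using this

/-- Periodicity excludes nilpotent Jordan blocks of the generator. -/
theorem ker_sq {v : V} (hv : A (A v) = 0) : A v = 0 := by
  have hd : ∀ s, HasDerivAt (fun s : ℝ => ρ s v - s • A v) 0 s := fun s => by
    have h1 := (h.hasDerivAt s v).fun_sub ((hasDerivAt_id s).smul_const (A v))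
    simpa [h.apply_of_ker hv s] using h1
  have := is_const_of_deriv_eq_zero (fun s => (hd s).differentiableAt) (fun s => (hd s).deriv)
    (2 * Real.pi) 0
  simp only [h.map_zero, h.map_two_pi] at this
  simpa [Real.pi_ne_zero] using this

/-- Periodicity excludes non-zero real eigenvalues of the generator. -/
theorem eigenvalue_eq_zero {v : V} (hv : v ≠ 0) {c : ℝ} (hc : A v = c • v) : c = 0 := by
  have hd : ∀ s, HasDerivAt (fun s : ℝ => Real.exp (-(c * s)) • ρ s v) 0 s := fun s => by
    have h2 : HasDerivAt (fun s : ℝ => Real.exp (-(c * s))) (Real.exp (-(c * s)) * (-c)) s := by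
      simpa using ((hasDerivAt_id s).const_mul c).neg.exp
    have h1 := h2.fun_smul (h.hasDerivAt s v)
    convert h1 using 1
    rw [hc, map_smul, smul_smul, ← add_smul]
    simp
  have := is_const_of_deriv_eq_zero (fun s => (hd s).differentiableAt) (fun s => (hd s).deriv)
    (2 * Real.pi) 0
  simp only [h.map_zero, h.map_two_pi] at this
  have h3 : (Real.exp (-(c * (2 * Real.pi))) - 1) • v = 0 := by
    rw [sub_smul, sub_eq_zero]; simpa using this
  have h4 := (smul_eq_zero.1 h3).resolve_right hv
  have h5 : -(c * (2 * Real.pi)) = 0 := by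
    rw [← Real.exp_eq_one_iff]; linarith
  have : c * (2 * Real.pi) = 0 := by linarith
  simpa [Real.pi_ne_zero] using this

/-- On a plane where `A² = -k²`, the representation is rotation with speed `k`. -/
theorem rotation {u : V} {k : ℝ} (hk : k ≠ 0) (hu : A (A u) = -(k ^ 2) • u) (s : ℝ) :
    ρ s (Real.cos (k * s) • u - (Real.sin (k * s) / k) • A u) = u := by
  have hd : ∀ s, HasDerivAt
      (fun s : ℝ => Real.cos (k * s) • ρ s u - (Real.sin (k * s) / k) • ρ s (A u)) 0 s := by
    intro s
    have hks : HasDerivAt (fun s : ℝ => k * s) k s := by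
      simpa using (hasDerivAt_id s).const_mul k
    have h1 := (hks.cos.fun_smul (h.hasDerivAt s u)).fun_sub
      ((hks.sin.div_const k).fun_smul (h.hasDerivAt s (A u)))
    convert h1 using 1
    rw [hu, map_smul, mul_div_cancel_right₀ _ hk, smul_smul]
    have : Real.sin (k * s) / k * -k ^ 2 = -Real.sin (k * s) * k := by field_simp
    rw [this]; abel
  have := is_const_of_deriv_eq_zero (fun s => (hd s).differentiableAt) (fun s => (hd s).deriv) s 0
  simpa [h.map_zero] using this

/-- A symplectic circle representation on a four-dimensional space which is faithful and fixes a
non-zero vector is the sum of a trivial plane and a plane on which it rotates with speed `±1`. -/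
theorem cube_eq_neg [FiniteDimensional ℝ V] (hdim : Module.finrank ℝ V = 4)
    (Ω : V →L[ℝ] V →L[ℝ] ℝ) (halt : ∀ v, Ω v v = 0) (hnd : ∀ v, (∀ w, Ω v w = 0) → v = 0)
    (hinv : ∀ v w, Ω (A v) w + Ω v (A w) = 0) {ζ : V} (hζ : ζ ≠ 0) (hAζ : A ζ = 0)
    (hfree : ∀ k : ℕ, 2 ≤ k → ρ (2 * Real.pi / k) ≠ 1) :
    (∀ v, A (A (A v)) = -A v) ∧ Module.finrank ℝ (LinearMap.range A.toLinearMap) = 2 := by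
  set R := LinearMap.range A.toLinearMap with hR
  set K := LinearMap.ker A.toLinearMap with hK
  have hrk : Module.finrank ℝ R + Module.finrank ℝ K = 4 :=
    hdim ▸ A.toLinearMap.finrank_range_add_finrank_ker
  -- `V` is the sum of the range and the kernel, as `A` has no nilpotent Jordan block.
  have hdisj : Disjoint R K := by
    rw [Submodule.disjoint_def]
    rintro _ ⟨v, rfl⟩ hv
    exact h.ker_sq hv
  have htop : R ⊔ K = ⊤ := Submodule.eq_top_of_disjoint _ _ (by rw [hrk, hdim]) hdisj
  have hdec : ∀ w, ∃ v κ, A κ = 0 ∧ w = A v + κ := fun w => by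
    have hw : w ∈ R ⊔ K := htop ▸ Submodule.mem_top
    obtain ⟨_, ⟨v, rfl⟩, κ, hκ, rfl⟩ := Submodule.mem_sup.1 hw
    exact ⟨v, κ, hκ, rfl⟩
  have hA0 : A ≠ 0 := by
    rintro rfl
    refine hfree 2 le_rfl ?_
    ext v
    exact h.apply_of_ker (by simp) _
  have hne : ∀ u ∈ R, u ≠ 0 → ∀ c : ℝ, A u ≠ c • u := by
    rintro _ ⟨v, rfl⟩ hu c hc
    have := h.eigenvalue_eq_zero hu hc
    rw [this, zero_smul] at hc
    exact hu (h.ker_sq hc)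
  have hRpos : 0 < Module.finrank ℝ R := by
    rw [Module.finrank_pos_iff_exists_ne_zero]
    obtain ⟨v, hv⟩ : ∃ v, A v ≠ 0 := by
      by_contra! hcon; exact hA0 (ContinuousLinearMap.ext hcon)
    exact ⟨⟨A v, v, rfl⟩, fun hcon => hv (congrArg Subtype.val hcon)⟩
  have hKpos : 0 < Module.finrank ℝ K := by
    rw [Module.finrank_pos_iff_exists_ne_zero]
    exact ⟨⟨ζ, hAζ⟩, fun hcon => hζ (congrArg Subtype.val hcon)⟩
  obtain ⟨⟨u, huR⟩, hu0'⟩ := Module.finrank_pos_iff_exists_ne_zero.1 hRpos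
  have hu0 : u ≠ 0 := fun hcon => hu0' (Subtype.ext hcon)
  -- The range has dimension at least two, as `A` has no real eigenvector there.
  have hind : LinearIndependent ℝ ![u, A u] := by
    rw [LinearIndependent.pair_iff' hu0]
    exact fun c hc => hne u huR hu0 c hc.symm
  have hle : Submodule.span ℝ (Set.range ![u, A u]) ≤ R := by
    rw [Submodule.span_le]
    rintro _ ⟨i, rfl⟩
    fin_cases i
    · exact huR
    · exact ⟨u, rfl⟩
  have hspan2 := finrank_span_eq_card hind
  have hR2 : 2 ≤ Module.finrank ℝ R := by
    have := Submodule.finrank_mono hle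
    rw [hspan2] at this; simpa using this
  -- The kernel is symplectically orthogonal to the range; a line is orthogonal to itself as well.
  have hK2 : Module.finrank ℝ K ≠ 1 := by
    intro h1
    refine hζ (hnd ζ fun w => ?_)
    obtain ⟨v, κ, hκ, rfl⟩ := hdec w
    obtain ⟨c, hc⟩ := (finrank_eq_one_iff_of_nonzero' (⟨ζ, hAζ⟩ : K)
      (fun hcon => hζ (congrArg Subtype.val hcon))).1 h1 ⟨κ, hκ⟩
    have hc' : c • ζ = κ := congrArg Subtype.val hc
    have h2 := hinv ζ v
    have h3 : Ω (A ζ) v = 0 := by rw [hAζ]; simp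
    rw [h3, zero_add] at h2
    rw [map_add, h2, ← hc', map_smul, halt]; simp
  have hR2' : Module.finrank ℝ R = 2 := by omega
  refine ⟨?_, hR2'⟩
  have hRspan : Submodule.span ℝ (Set.range ![u, A u]) = R :=
    Submodule.eq_of_le_of_finrank_eq hle (by rw [hspan2, hR2']; simp)
  have hRuv : ∀ w ∈ R, ∃ a b : ℝ, w = a • u + b • A u := by
    intro w hw
    rw [← hRspan, Matrix.range_cons, Matrix.range_cons, Matrix.range_empty, Set.union_empty,
      Set.singleton_union] at hw
    obtain ⟨a, b, hab⟩ := Submodule.mem_span_pair.1 hw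
    exact ⟨a, b, hab.symm⟩
  have hΩu : Ω u (A u) ≠ 0 := by
    intro h0
    refine hu0 (hnd u fun w => ?_)
    obtain ⟨v, κ, hκ, rfl⟩ := hdec w
    obtain ⟨a, b, hab⟩ := hRuv (A v) ⟨v, rfl⟩
    obtain ⟨v', hv'⟩ := id huR
    have h2 := hinv v' κ
    have h3 : Ω u κ = 0 := by simpa [hκ, ← hv'] using h2
    rw [map_add, hab, map_add, map_smul, map_smul, halt, h0, h3]; simp
  obtain ⟨α, β, hαβ⟩ := hRuv (A (A u)) ⟨A u, rfl⟩
  -- Infinitesimally symplectic maps of a plane are traceless.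
  have hβ : β = 0 := by
    have h2 := hinv u (A u)
    rw [halt, hαβ, map_add, map_smul, map_smul, halt] at h2
    simpa [hΩu] using h2
  rw [hβ, zero_smul, add_zero] at hαβ
  have hα : α < 0 := by
    by_contra! hα
    have hk : Real.sqrt α * Real.sqrt α = α := Real.mul_self_sqrt hα
    set k := Real.sqrt α
    -- `A² = k²` on `u` would make `A u + k u` an eigenvector of `A` in its range.
    have hmem : A u + k • u ∈ R := R.add_mem ⟨u, rfl⟩ (R.smul_mem _ huR)
    refine hne _ hmem ?_ k ?_
    · intro h0
      refine hne u huR hu0 (-k) ?_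
      rw [neg_smul]; exact eq_neg_of_add_eq_zero_left h0
    · rw [map_add, map_smul, hαβ, smul_add, smul_smul, hk, add_comm]
  have hsq : ∀ w ∈ R, A (A w) = α • w := by
    intro w hw
    obtain ⟨a, b, rfl⟩ := hRuv w hw
    simp only [map_add, map_smul, hαβ, smul_add, smul_smul, mul_comm]
  set k := Real.sqrt (-α) with hkdef
  have hkpos : 0 < k := Real.sqrt_pos.2 (by linarith)
  have hk2 : -(k ^ 2) = α := by rw [hkdef, Real.sq_sqrt (by linarith)]; ring
  have hrot := fun w hw s => h.rotation (u := w) hkpos.ne' (by rw [hk2]; exact hsq w hw) s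
  have hcos : Real.cos (k * (2 * Real.pi)) = 1 := by
    have h1 := hrot u huR (2 * Real.pi)
    rw [h.map_two_pi, one_apply_eq_self, sub_eq_iff_eq_add] at h1
    have h2 : (Real.cos (k * (2 * Real.pi)) - 1) • u
        + (-(Real.sin (k * (2 * Real.pi)) / k)) • A u = 0 := by
      rw [sub_smul, h1, neg_smul, one_smul]; abel
    have h3 := (LinearIndependent.pair_iff.1 hind _ _ h2).1
    linarith
  obtain ⟨m, hm⟩ := (Real.cos_eq_one_iff _).1 hcos
  have hmk : (m : ℝ) = k := by
    have : (m : ℝ) * (2 * Real.pi) = k * (2 * Real.pi) := hm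
    exact mul_right_cancel₀ Real.two_pi_pos.ne' this
  -- The rotation speed `m` is an integer, and the circle element `2π/m` acts trivially.
  have hm1 : m = 1 := by
    by_contra hm1
    have hm0 : 0 < m := by exact_mod_cast (hmk ▸ hkpos : (0 : ℝ) < m)
    lift m to ℕ using hm0.le
    refine hfree m (by omega) ?_
    ext w
    obtain ⟨v, κ, hκ, rfl⟩ := hdec w
    rw [map_add, h.apply_of_ker hκ]
    have h1 := hrot (A v) ⟨v, rfl⟩ (2 * Real.pi / m)
    have h2 : k * (2 * Real.pi / m) = 2 * Real.pi := by
      have hm0' : (m : ℝ) ≠ 0 := by exact_mod_cast hm0.ne'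
      rw [← hmk]; push_cast; field_simp
    rw [h2] at h1
    simpa using h1
  have hα1 : α = -1 := by rw [← hk2, ← hmk, hm1]; norm_num
  intro v
  rw [hsq (A v) ⟨v, rfl⟩, hα1, neg_one_smul]

/-- On the range of a generator with `A³ = -A`, the representation is rotation with speed one. -/
theorem apply_of_cube {v : V} (hcube : A (A (A v)) = -A v) (s : ℝ) :
    ρ s (A v) = Real.cos s • A v + Real.sin s • A (A v) := by
  have h1 := h.rotation (u := A v) one_ne_zero (by simpa using hcube) s
  have h2 := h.rotation (u := A (A v)) one_ne_zero (by rw [hcube]; simp) s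
  simp only [one_mul, div_one, map_sub, map_add, map_smul, hcube, smul_neg, sub_neg_eq_add]
    at h1 h2
  have hcs := Real.cos_sq_add_sin_sq s
  calc ρ s (A v) = (Real.cos s ^ 2 + Real.sin s ^ 2) • ρ s (A v) := by rw [hcs, one_smul]
    _ = Real.cos s • (Real.cos s • ρ s (A v) - Real.sin s • ρ s (A (A v)))
        + Real.sin s • (Real.cos s • ρ s (A (A v)) + Real.sin s • ρ s (A v)) := by module
    _ = _ := by rw [h1, h2]

end IsCircleRep

/-- If `A` and `B` commute and each of `A`, `B`, `A + B`, `A - B` generates a circle with weights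
`0` and `±1`, then `A` and `B` rotate complementary planes; so they have no common fixed vector. -/
theorem eq_zero_of_commuting_generators [FiniteDimensional ℝ V] (hdim : Module.finrank ℝ V = 4)
    {A B : V →L[ℝ] V} (hAB : ∀ v, A (B v) = B (A v))
    (hA : ∀ v, A (A (A v)) = -A v) (hB : ∀ v, B (B (B v)) = -B v)
    (hp : ∀ v, (A + B) ((A + B) ((A + B) v)) = -(A + B) v)
    (hm : ∀ v, (A - B) ((A - B) ((A - B) v)) = -(A - B) v)
    (hrA : Module.finrank ℝ (LinearMap.range A.toLinearMap) = 2)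
    (hrB : Module.finrank ℝ (LinearMap.range B.toLinearMap) = 2)
    {v : V} (hAv : A v = 0) (hBv : B v = 0) : v = 0 := by
  have hzero : ∀ v, A (B v) = 0 := by
    intro v
    have h1 := hp v
    have h2 := hm v
    simp only [add_apply, sub_apply, map_add, map_sub,
      hA, hB, ← hAB] at h1 h2
    -- The sum and difference of the two cubes isolate `A² B`.
    have h3 : (6 : ℝ) • A (A (B v)) = 0 := by
      linear_combination (norm := module) h1 - h2
    have h4 : A (A (B v)) = 0 := (smul_eq_zero.1 h3).resolve_left (by norm_num)
    have h5 := hA (B v)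
    rw [h4, map_zero] at h5
    exact neg_eq_zero.1 h5.symm
  have hBA : ∀ v, B (A v) = 0 := fun v => by rw [← hAB, hzero]
  have hdisj : Disjoint (LinearMap.range A.toLinearMap) (LinearMap.range B.toLinearMap) := by
    rw [Submodule.disjoint_def]
    rintro _ ⟨a, rfl⟩ ⟨b, hb⟩
    have hb' : B b = A a := hb
    have h1 := hA a
    rw [← hb', hzero, map_zero] at h1
    rw [hb'] at h1
    exact neg_eq_zero.1 h1.symm
  have htop := Submodule.eq_top_of_disjoint _ _ (by rw [hrA, hrB, hdim]) hdisj
  have hv : v ∈ LinearMap.range A.toLinearMap ⊔ LinearMap.range B.toLinearMap :=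
    htop ▸ Submodule.mem_top
  obtain ⟨_, ⟨a, rfl⟩, _, ⟨b, rfl⟩, rfl⟩ := Submodule.mem_sup.1 hv
  simp only [ContinuousLinearMap.coe_coe, map_add, hzero, hBA, add_zero, zero_add] at hAv hBv ⊢
  have h1 := hA a
  have h2 := hB b
  rw [hAv, map_zero] at h1
  rw [hBv, map_zero] at h2
  rw [neg_eq_zero.1 h1.symm, neg_eq_zero.1 h2.symm, add_zero]

end LinearAlgebra

/-! ### Winding numbers -/

section Winding

open Set Complex

/-- The loop `c`, parametrised by `[0, 1]`, avoids the origin and has winding number `n` around it: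
a continuous logarithm of `c` increases by `2πin`. -/
def HasWinding (c : ℝ → ℂ) (n : ℤ) : Prop :=
  ∃ L : ℝ → ℂ, ContinuousOn L (Icc 0 1) ∧ (∀ s ∈ Icc (0 : ℝ) 1, exp (L s) = c s) ∧
    L 1 - L 0 = 2 * Real.pi * I * n

/-- A continuous function on a preconnected set all of whose values have exponential `1` is
constant. -/
theorem constOn_of_exp_eq_one {A : Type*} [TopologicalSpace A] {s : Set A} (hs : IsPreconnected s)
    {g : A → ℂ} (hg : ContinuousOn g s) (h : ∀ a ∈ s, exp (g a) = 1) {a b : A} (ha : a ∈ s)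
    (hb : b ∈ s) : g a = g b :=
  Complex.isCoveringMap_exp.constOn_of_comp hs hg
    (fun x hx y hy => Subtype.ext (by simp only [h x hx, h y hy])) ha hb

theorem HasWinding.unique {c : ℝ → ℂ} {m n : ℤ} (hm : HasWinding c m) (hn : HasWinding c n) :
    m = n := by
  obtain ⟨L, hL, hLc, hL1⟩ := hm
  obtain ⟨K, hK, hKc, hK1⟩ := hn
  have h := constOn_of_exp_eq_one isPreconnected_Icc (hL.sub hK) (fun s hs => by
    rw [Pi.sub_apply, exp_sub, hLc s hs, hKc s hs, div_self]
    rw [← hLc s hs]; exact exp_ne_zero _) (a := 0) (b := 1) (by simp) (by simp)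
  simp only [Pi.sub_apply] at h
  have h2 : 2 * Real.pi * I * (m : ℂ) = 2 * Real.pi * I * n := by
    rw [← hL1, ← hK1]; linear_combination -h
  exact_mod_cast mul_left_cancel₀ two_pi_I_ne_zero h2

theorem HasWinding.const_mul {c : ℝ → ℂ} {n : ℤ} (h : HasWinding c n) {a : ℂ} (ha : a ≠ 0) :
    HasWinding (fun s => a * c s) n := by
  obtain ⟨L, hL, hLc, hL1⟩ := h
  refine ⟨fun s => log a + L s, continuousOn_const.add hL, fun s hs => ?_, ?_⟩
  · rw [exp_add, exp_log ha, hLc s hs]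
  · rw [← hL1]; ring

theorem HasWinding.congr {c c' : ℝ → ℂ} {n : ℤ} (h : HasWinding c n)
    (hcc' : ∀ s ∈ Icc (0 : ℝ) 1, c s = c' s) : HasWinding c' n := by
  obtain ⟨L, hL, hLc, hL1⟩ := h
  exact ⟨L, hL, fun s hs => by rw [hLc s hs, hcc' s hs], hL1⟩

/-- The "dog on a leash" principle. -/
theorem HasWinding.of_close {c c' : ℝ → ℂ} {n : ℤ} (h : HasWinding c n) (hc : c 1 = c 0)
    (hc' : c' 1 = c' 0) (hcont : ContinuousOn c' (Icc 0 1))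
    (hclose : ∀ s ∈ Icc (0 : ℝ) 1, ‖c' s / c s - 1‖ < 1) : HasWinding c' n := by
  obtain ⟨L, hL, hLc, hL1⟩ := h
  have hc0 : ∀ s ∈ Icc (0 : ℝ) 1, c s ≠ 0 := fun s hs => hLc s hs ▸ exp_ne_zero _
  have hslit : ∀ s ∈ Icc (0 : ℝ) 1, c' s / c s ∈ slitPlane := fun s hs => by
    simpa using mem_slitPlane_of_norm_lt_one (hclose s hs)
  have hccont : ContinuousOn c (Icc 0 1) :=
    (continuous_exp.comp_continuousOn hL).congr fun s hs => (hLc s hs).symm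
  refine ⟨fun s => L s + log (c' s / c s),
    hL.add ((hcont.div hccont hc0).clog hslit), fun s hs => ?_, ?_⟩
  · rw [exp_add, hLc s hs, exp_log (slitPlane_ne_zero (hslit s hs)),
      mul_div_cancel₀ _ (hc0 s hs)]
  · simp only [hc, hc', ← hL1]; ring

/-- Winding numbers are locally constant in families. -/
theorem HasWinding.eventually {Y : Type*} [TopologicalSpace Y] {y₀ : Y} {Φ : Y → ℝ → ℂ} {n : ℤ}
    (h : HasWinding (Φ y₀) n)
    (hcont : ∀ s ∈ Icc (0 : ℝ) 1, ContinuousAt (Function.uncurry Φ) (y₀, s))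
    (hloop : Φ y₀ 1 = Φ y₀ 0) :
    ∀ᶠ y in nhds y₀, ContinuousOn (Φ y) (Icc 0 1) → Φ y 1 = Φ y 0 → HasWinding (Φ y) n := by
  have hne : ∀ s ∈ Icc (0 : ℝ) 1, Φ y₀ s ≠ 0 := by
    obtain ⟨L, -, hLc, -⟩ := h
    exact fun s hs => hLc s hs ▸ exp_ne_zero _
  have key : ∀ᶠ y in nhds y₀, ∀ s ∈ Icc (0 : ℝ) 1, ‖Φ y s / Φ y₀ s - 1‖ < 1 := by
    refine isCompact_Icc.eventually_forall_of_forall_eventually fun s hs => ?_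
    have h1 : ContinuousAt (fun p : Y × ℝ => Φ y₀ p.2) (y₀, s) :=
      ContinuousAt.comp (f := fun p : Y × ℝ => (y₀, p.2)) (g := Function.uncurry Φ)
        (hcont s hs) (by fun_prop)
    have h2 : ContinuousAt (fun p : Y × ℝ => ‖Φ p.1 p.2 / Φ y₀ p.2 - 1‖) (y₀, s) :=
      (((hcont s hs).div h1 (hne s hs)).sub continuousAt_const).norm
    have h3 : ‖Φ y₀ s / Φ y₀ s - 1‖ < 1 := by rw [div_self (hne s hs)]; simp
    exact h2.eventually (gt_mem_nhds h3)
  filter_upwards [key] with y hy hc hl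
  exact h.of_close hloop hl hc hy

/-- A positively oriented ellipse around the origin has winding number one. -/
theorem hasWinding_ellipse {a b : ℂ} (hab : 0 < (starRingEnd ℂ a * b).im) :
    HasWinding (fun s => Real.cos (2 * Real.pi * s) * a + Real.sin (2 * Real.pi * s) * b) 1 := by
  -- The ellipse is `p exp (is) + q exp (-is)` with `|q| < |p|`.
  set p : ℂ := (a - I * b) / 2 with hp
  set q : ℂ := (a + I * b) / 2 with hq
  have hsq : ‖q‖ ^ 2 < ‖p‖ ^ 2 := by
    rw [← normSq_eq_norm_sq, ← normSq_eq_norm_sq, normSq_apply, normSq_apply]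
    simp only [mul_im, conj_re, conj_im] at hab
    simp [hp, hq]
    nlinarith
  have hqp : ‖q‖ < ‖p‖ := lt_of_pow_lt_pow_left₀ 2 (norm_nonneg _) hsq
  have hp0 : p ≠ 0 := norm_pos_iff.1 ((norm_nonneg q).trans_lt hqp)
  have hcirc : HasWinding (fun s => p * exp (2 * Real.pi * I * s)) 1 := by
    refine HasWinding.const_mul ⟨fun s => 2 * Real.pi * I * s, by fun_prop, fun s _ => rfl, ?_⟩ hp0
    simp
  have hpq : ∀ s : ℝ, Real.cos (2 * Real.pi * s) * a + Real.sin (2 * Real.pi * s) * b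
      = p * exp (2 * Real.pi * I * s) + q * exp (-(2 * Real.pi * I * s)) := fun s => by
    have h1 : (2 * Real.pi * I * s : ℂ) = ((2 * Real.pi * s : ℝ) : ℂ) * I := by push_cast; ring
    have h2 : -(((2 * Real.pi * s : ℝ) : ℂ) * I) = ((-(2 * Real.pi * s) : ℝ) : ℂ) * I := by
      push_cast; ring
    rw [h1, h2, exp_mul_I, exp_mul_I, ← ofReal_cos, ← ofReal_sin, ← ofReal_cos, ← ofReal_sin,
      Real.cos_neg, Real.sin_neg, hp, hq]
    push_cast
    linear_combination (sin (2 * Real.pi * s) * b) * I_sq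
  refine hcirc.of_close ?_ (by simp) (by fun_prop) fun s _ => ?_
  · simp [exp_two_pi_mul_I]
  · rw [hpq, add_div, div_self (mul_ne_zero hp0 (exp_ne_zero _)), add_sub_cancel_left, norm_div,
      norm_mul, norm_mul]
    have hn : ∀ x : ℝ, ‖exp (x * I)‖ = 1 := norm_exp_ofReal_mul_I
    have h1 : (2 * Real.pi * I * s : ℂ) = ((2 * Real.pi * s : ℝ) : ℂ) * I := by push_cast; ring
    have h2 : -(((2 * Real.pi * s : ℝ) : ℂ) * I) = ((-(2 * Real.pi * s) : ℝ) : ℂ) * I := by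
      push_cast; ring
    rw [h1, h2, hn, hn, mul_one, mul_one, div_lt_one (norm_pos_iff.2 hp0)]
    exact hqp

/-- The winding numbers of a nowhere vanishing function on a torus along the loops given by lattice
vectors depend additively on the lattice vector. -/
theorem exists_winding_hom {E M : Type*} [NormedAddCommGroup E] [NormedSpace ℝ E] [AddCommGroup M]
    (T : M →+ E) {F : E → ℂ} (hF : Continuous F) (hF0 : ∀ t, F t ≠ 0)
    (hper : ∀ t m, F (t + T m) = F t) :
    ∃ w : M →+ ℤ, ∀ m, HasWinding (fun s => F (s • T m)) (w m) := by
  have hsc : IsSimplyConnected (univ : Set E) := by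
    have : ContractibleSpace (univ : Set E) := convex_univ.contractibleSpace univ_nonempty
    exact SimplyConnectedSpace.ofContractible _
  obtain ⟨L, hL, hLF⟩ := exists_continuousOn_eqOn_exp_comp hsc isOpen_univ hF.continuousOn
    (by simpa using hF0)
  have hL' : Continuous L := continuousOn_univ.1 hL
  have hLF' : ∀ t, exp (L t) = F t := fun t => hLF (mem_univ t)
  have hconst : ∀ m t, L (t + T m) - L t = L (T m) - L 0 := fun m t => by
    have := constOn_of_exp_eq_one (A := E) isPreconnected_univ
      (g := fun t => L (t + T m) - L t) (by fun_prop) (fun t _ => by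
        rw [exp_sub, hLF', hLF', hper, div_self (hF0 t)]) (mem_univ t) (mem_univ 0)
    simpa using this
  have hint : ∀ m, ∃ n : ℤ, L (T m) - L 0 = n * (2 * Real.pi * I) := fun m => by
    refine exp_eq_one_iff.1 ?_
    have := hper 0 m
    rw [zero_add] at this
    rw [exp_sub, hLF', hLF', this, div_self (hF0 0)]
  choose n hn using hint
  refine ⟨AddMonoidHom.mk' n fun a b => ?_, fun m => ⟨fun s => L (s • T m), by fun_prop,
    fun s _ => hLF' _, ?_⟩⟩
  · have h1 := hconst b (T a)
    rw [← map_add] at h1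
    have h2 : (n (a + b) : ℂ) * (2 * Real.pi * I) = ((n a + n b : ℤ) : ℂ) * (2 * Real.pi * I) := by
      push_cast
      rw [add_mul, ← hn, ← hn, ← hn]; linear_combination h1
    exact_mod_cast mul_right_cancel₀ two_pi_I_ne_zero h2
  · simp only [one_smul, zero_smul, AddMonoidHom.mk'_apply]
    rw [hn]; ring

end Winding

/-! ### Complex area forms and the first Chern class -/

section ComplexFrame

variable {V : Type*} [NormedAddCommGroup V] [NormedSpace ℝ V]

/-- The real linear map `ℂ² → V`, `c ↦ c₀ F₀ + c₁ F₁`, where `i` acts on `V` as `J`. -/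
noncomputable def frameMap (J : V →L[ℝ] V) (F : Fin 2 → V) : (Fin 2 → ℂ) →L[ℝ] V :=
  ∑ k, ((Complex.reCLM ∘L ContinuousLinearMap.proj (R := ℝ) (φ := fun _ : Fin 2 => ℂ) k).smulRight
      (F k) + (Complex.imCLM ∘L ContinuousLinearMap.proj (R := ℝ) (φ := fun _ : Fin 2 => ℂ)
        k).smulRight (J (F k)))

theorem frameMap_apply (J : V →L[ℝ] V) (F : Fin 2 → V) (c : Fin 2 → ℂ) :
    frameMap J F c = ∑ k, ((c k).re • F k + (c k).im • J (F k)) := by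
  simp [frameMap]

theorem frameMap_smul {J : V →L[ℝ] V} (hJ : ∀ v, J (J v) = -v) (F : Fin 2 → V) (a : ℂ)
    (c : Fin 2 → ℂ) :
    frameMap J F (a • c) = a.re • frameMap J F c + a.im • J (frameMap J F c) := by
  simp only [frameMap_apply, Fin.sum_univ_two, Pi.smul_apply, smul_eq_mul, Complex.mul_re,
    Complex.mul_im, map_add, map_smul, hJ]
  module

/-- The complex area form on `(V, J)` with value `1` on the complex basis `F`. -/
noncomputable def frameArea (J : V →L[ℝ] V) (F : Fin 2 → V) : V →L[ℝ] V →L[ℝ] ℂ :=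
  let c : Fin 2 → V →L[ℝ] ℂ := fun k =>
    ContinuousLinearMap.proj (R := ℝ) (φ := fun _ : Fin 2 => ℂ) k ∘L (frameMap J F).inverse
  (ContinuousLinearMap.mul ℝ ℂ).bilinearComp (c 0) (c 1)
    - (ContinuousLinearMap.mul ℝ ℂ).bilinearComp (c 1) (c 0)

theorem frameArea_apply (J : V →L[ℝ] V) (F : Fin 2 → V) (v w : V) :
    frameArea J F v w = (frameMap J F).inverse v 0 * (frameMap J F).inverse w 1
      - (frameMap J F).inverse v 1 * (frameMap J F).inverse w 0 := by
  simp [frameArea]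

theorem frameArea_frameMap {J : V →L[ℝ] V} {F : Fin 2 → V} (h : (frameMap J F).IsInvertible)
    (c d : Fin 2 → ℂ) :
    frameArea J F (frameMap J F c) (frameMap J F d) = c 0 * d 1 - c 1 * d 0 := by
  rw [frameArea_apply, h.inverse_apply_eq.2 rfl, h.inverse_apply_eq.2 rfl]

theorem frameMap_isInvertible [FiniteDimensional ℝ V] (hdim : Module.finrank ℝ V = 4)
    {J : V →L[ℝ] V} {F : Fin 2 → V} (h : ∀ c, frameMap J F c = 0 → c = 0) :
    (frameMap J F).IsInvertible := by
  have hinj : Function.Injective (frameMap J F).toLinearMap :=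
    (injective_iff_map_eq_zero (frameMap J F)).2 h
  have hd : Module.finrank ℝ (Fin 2 → ℂ) = Module.finrank ℝ V := by
    rw [hdim, Module.finrank_pi_fintype]; simp [Complex.finrank_real_complex]
  refine ⟨((frameMap J F).toLinearMap.linearEquivOfInjective hinj hd).toContinuousLinearEquiv, ?_⟩
  ext c
  simp

theorem frameMap_conj (T : V →L[ℝ] V) (S : V →L[ℝ] V) (hS : ∀ v, S (T v) = v) (J : V →L[ℝ] V)
    (F : Fin 2 → V) (c : Fin 2 → ℂ) :
    frameMap (T ∘L J ∘L S) (fun k => T (F k)) c = T (frameMap J F c) := by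
  simp [frameMap_apply, hS]

theorem frameMap_exists {J : V →L[ℝ] V} {F : Fin 2 → V} (h : (frameMap J F).IsInvertible) (v : V) :
    ∃ c, v = frameMap J F c := ⟨(frameMap J F).inverse v, (h.self_apply_inverse v).symm⟩

/-- Complex linear maps transport area forms of frames. -/
theorem frameArea_conj {T S : V →L[ℝ] V} (hS : ∀ v, S (T v) = v) (hT : ∀ v, T (S v) = v)
    {J : V →L[ℝ] V} {F : Fin 2 → V} (h : (frameMap J F).IsInvertible)
    (h' : (frameMap (T ∘L J ∘L S) (fun k => T (F k))).IsInvertible) (v w : V) :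
    frameArea J F (S v) (S w) = frameArea (T ∘L J ∘L S) (fun k => T (F k)) v w := by
  obtain ⟨c, hc⟩ := frameMap_exists h (S v)
  obtain ⟨d, hd⟩ := frameMap_exists h (S w)
  have hv : v = frameMap (T ∘L J ∘L S) (fun k => T (F k)) c := by
    rw [frameMap_conj T S hS, ← hc, hT]
  have hw : w = frameMap (T ∘L J ∘L S) (fun k => T (F k)) d := by
    rw [frameMap_conj T S hS, ← hd, hT]
  rw [hc, hd, frameArea_frameMap h, hv, hw, frameArea_frameMap h']

/-- Change of frame multiplies the area form by the determinant of the transition matrix. -/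
theorem frameArea_transition {J : V →L[ℝ] V} (hJ : ∀ v, J (J v) = -v) {F F' : Fin 2 → V}
    (h : (frameMap J F).IsInvertible) (h' : (frameMap J F').IsInvertible)
    (g : Matrix (Fin 2) (Fin 2) ℂ)
    (hg : ∀ l, F' l = ∑ k, ((g k l).re • F k + (g k l).im • J (F k))) (v w : V) :
    frameArea J F v w = g.det * frameArea J F' v w := by
  have key : ∀ c, frameMap J F' c = frameMap J F (g.mulVec c) := fun c => by
    rw [frameMap_apply J F', frameMap_apply J F]
    simp only [Fin.sum_univ_two, hg, Matrix.mulVec, dotProduct, Complex.add_re, Complex.add_im,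
      Complex.mul_re, Complex.mul_im, map_add, map_smul, hJ]
    module
  obtain ⟨c, rfl⟩ := frameMap_exists h' v
  obtain ⟨d, rfl⟩ := frameMap_exists h' w
  rw [frameArea_frameMap h', key, key, frameArea_frameMap h, Matrix.det_fin_two]
  simp only [Matrix.mulVec, dotProduct, Fin.sum_univ_two]
  ring

theorem frameArea_continuousAt [CompleteSpace V] {Y : Type*} [TopologicalSpace Y] {y₀ : Y}
    {J : Y → V →L[ℝ] V} {F : Fin 2 → Y → V} (hJ : ContinuousAt J y₀)
    (hF : ∀ k, ContinuousAt (F k) y₀)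
    (h : (frameMap (J y₀) (fun k => F k y₀)).IsInvertible) :
    ContinuousAt (fun y => frameArea (J y) (fun k => F k y)) y₀ := by
  have hJF : ∀ k, ContinuousAt (fun y => J y (F k y)) y₀ := fun k => hJ.clm_apply (hF k)
  have hM : ContinuousAt (fun y => frameMap (J y) (fun k => F k y)) y₀ := by
    unfold frameMap
    refine tendsto_finsetSum _ fun k _ => ?_
    have hs : ∀ f : (Fin 2 → ℂ) →L[ℝ] ℝ, Continuous (fun v : V => f.smulRight v) := fun f =>
      (ContinuousLinearMap.smulRightL ℝ (Fin 2 → ℂ) V f).continuous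
    exact ((hs _).continuousAt.comp (hF k)).add ((hs _).continuousAt.comp (hJF k))
  have hinv : ContinuousAt (fun y => (frameMap (J y) (fun k => F k y)).inverse) y₀ := by
    obtain ⟨e, he⟩ := h
    have h1 : ContinuousAt (ContinuousLinearMap.inverse : ((Fin 2 → ℂ) →L[ℝ] V) → _)
        (frameMap (J y₀) (fun k => F k y₀)) := by
      rw [← he]; exact (contDiffAt_map_inverse (n := 0) e).continuousAt
    exact ContinuousAt.comp (g := ContinuousLinearMap.inverse) h1 hM
  have hc : ∀ k, ContinuousAt (fun y => ContinuousLinearMap.proj (R := ℝ)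
      (φ := fun _ : Fin 2 => ℂ) k ∘L (frameMap (J y) (fun k => F k y)).inverse) y₀ :=
    fun k => continuousAt_const.clm_comp hinv
  have hb : ∀ {f g : Y → V →L[ℝ] ℂ}, ContinuousAt f y₀ → ContinuousAt g y₀ →
      ContinuousAt (fun y => (ContinuousLinearMap.mul ℝ ℂ).bilinearComp (f y) (g y)) y₀ := by
    intro f g hf hg
    have h1 : ContinuousAt (fun y => (ContinuousLinearMap.mul ℝ ℂ) ∘L f y) y₀ :=
      continuousAt_const.clm_comp hf
    have h2 := ((ContinuousLinearMap.flipₗᵢ ℝ V ℂ ℂ).continuous.continuousAt.comp h1)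
    have h3 := h2.clm_comp hg
    exact (ContinuousLinearMap.flipₗᵢ ℝ V V ℂ).continuous.continuousAt.comp h3
  exact (hb (hc 0) (hc 1)).sub (hb (hc 1) (hc 0))

end ComplexFrame

section Model

variable {X : Type u} [TopologicalSpace X] [ChartedSpace Model4 X] [IsManifold (𝓡 4) ∞ X]

/-- The symplectic form at `x`, on the model space: the tangent space at `x` is the model space,
through the preferred chart at `x`. -/
def SymplecticForm.modelForm (Ω : SymplecticForm X) (x : X) : Model4 →L[ℝ] Model4 →L[ℝ] ℝ :=
  Ω.form x

/-- The almost complex structure at `x`, on the model space. -/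
def CompatibleJ.modelJ {Ω : SymplecticForm X} (j : CompatibleJ Ω) (x : X) : Model4 →L[ℝ] Model4 :=
  j.J x

/-- The trivialization at `x₀` of the tangent bundle, as a map from the tangent space at `x` to
the model space. -/
noncomputable def toModel (x₀ x : X) : Model4 →L[ℝ] Model4 :=
  (trivializationAt Model4 (TangentSpace (𝓡 4)) x₀).continuousLinearMapAt ℝ x

/-- The inverse of `toModel x₀ x`. -/
noncomputable def ofModel (x₀ x : X) : Model4 →L[ℝ] Model4 :=
  (trivializationAt Model4 (TangentSpace (𝓡 4)) x₀).symmL ℝ x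

theorem ofModel_toModel {x₀ x : X} (hx : x ∈ (chartAt Model4 x₀).source) (v : Model4) :
    ofModel x₀ x (toModel x₀ x v) = v :=
  (trivializationAt Model4 (TangentSpace (𝓡 4)) x₀).symmL_continuousLinearMapAt (R := ℝ)
    (b := x) hx v

theorem toModel_ofModel {x₀ x : X} (hx : x ∈ (chartAt Model4 x₀).source) (v : Model4) :
    toModel x₀ x (ofModel x₀ x v) = v :=
  (trivializationAt Model4 (TangentSpace (𝓡 4)) x₀).continuousLinearMapAt_symmL (R := ℝ)
    (b := x) hx v

theorem continuousAt_toModel_of_section {s : ∀ x : X, TangentSpace (𝓡 4) x} {x₀ : X}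
    (h : ContinuousAt (fun x => (⟨x, s x⟩ : TangentBundle (𝓡 4) X)) x₀) :
    ContinuousAt (fun x => toModel x₀ x (s x)) x₀ := by
  refine ((FiberBundle.continuousAt_totalSpace Model4 _).1 h).2.congr ?_
  filter_upwards [(chartAt Model4 x₀).open_source.mem_nhds (mem_chart_source _ x₀)] with x hx
  exact ((trivializationAt Model4 (TangentSpace (𝓡 4)) x₀).continuousLinearMapAt_apply_of_mem ℝ
    (b := x) hx (s x)).symm

theorem CompatibleJ.continuousAt_conj {Ω : SymplecticForm X} (j : CompatibleJ Ω) (x₀ : X) :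
    ContinuousAt (fun x => toModel x₀ x ∘L j.modelJ x ∘L ofModel x₀ x) x₀ :=
  ((continuousAt_hom_bundle (RingHom.id ℝ) _).1 j.smooth.continuous.continuousAt).2

/-- A nowhere vanishing complex area form on `(TX, J)`: a continuous trivialization of the complex
determinant line bundle. `exists_of_eq_zero` says that complex area detects complex linear
dependence, and continuity at `x₀` is tested in the trivialization of the tangent bundle at `x₀`. -/
structure AreaForm {Ω : SymplecticForm X} (j : CompatibleJ Ω) where
  form : X → Model4 →L[ℝ] Model4 →L[ℝ] ℂ
  alternating : ∀ x v, form x v v = 0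
  map_J : ∀ x v w, form x (j.modelJ x v) w = Complex.I * form x v w
  exists_of_eq_zero : ∀ x v w, w ≠ 0 → form x v w = 0 → ∃ a b : ℝ, v = a • w + b • j.modelJ x w
  continuousAt : ∀ x₀ v w, ContinuousAt (fun p : X × Model4 × Model4 =>
    form p.1 (ofModel x₀ p.1 p.2.1) (ofModel x₀ p.1 p.2.2)) (x₀, v, w)

theorem ChernData.isInvertible {Ω : SymplecticForm X} {j : CompatibleJ Ω} {ι : Type u}
    (D : ChernData j ι) {i : ι} {x : X} (hx : x ∈ D.U i) :
    (frameMap (V := Model4) (j.modelJ x) (fun k => D.frame i k x)).IsInvertible := by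
  refine frameMap_isInvertible (by simp) fun c hc => D.frame_independent i x hx c ?_
  exact (frameMap_apply (V := Model4) (j.modelJ x) (fun k => D.frame i k x) c).symm.trans hc

/-- Vanishing of the first Chern class: the determinants of the transition matrices form a
multiplicative coboundary. A partition of unity turns the additive cocycle of continuous functions
`log - m` into a coboundary. -/
theorem ChernData.exists_potential [T2Space X] [SecondCountableTopology X]
    {Ω : SymplecticForm X} {j : CompatibleJ Ω} {ι : Type u} (D : ChernData j ι)
    (m : ι → ι → X → ℤ) (hm : ∀ i i', ContinuousOn (m i i') (D.U i ∩ D.U i'))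
    (hcoc : ∀ i₁ i₂ i₃, ∀ x ∈ D.U i₁ ∩ D.U i₂ ∩ D.U i₃,
      D.cocycle i₁ i₂ i₃ x = ((m i₂ i₃ x - m i₁ i₃ x + m i₁ i₂ x : ℤ) : ℂ)) :
    ∃ K : ι → X → ℂ, (∀ i, ContinuousOn (K i) (D.U i)) ∧ (∀ i x, K i x ≠ 0) ∧
      ∀ i i', ∀ x ∈ D.U i ∩ D.U i', K i' x = K i x * (D.g i i' x).det := by
  have : LocallyCompactSpace X := ChartedSpace.locallyCompactSpace Model4 X
  obtain ⟨ρ, hρ⟩ := PartitionOfUnity.exists_isSubordinate isClosed_univ D.U D.isOpen_U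
    (fun x _ => Set.mem_iUnion.2 (D.cover x))
  set L : ι → ι → X → ℂ := fun i i' x => D.log i i' x - m i i' x with hL
  have hLcont : ∀ i i', ContinuousOn (L i i') (D.U i ∩ D.U i') := fun i i' =>
    (D.log_continuous i i').sub ((continuous_of_discreteTopology (f := fun n : ℤ => (n : ℂ))
      ).comp_continuousOn (hm i i'))
  have hLcoc : ∀ i₁ i₂ i₃, ∀ x ∈ D.U i₁ ∩ D.U i₂ ∩ D.U i₃,
      L i₁ i₃ x - L i₁ i₂ x = L i₂ i₃ x := fun i₁ i₂ i₃ x hx => by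
    have := hcoc i₁ i₂ i₃ x hx
    simp only [ChernData.cocycle] at this
    push_cast at this
    simp only [hL]
    linear_combination -this
  set h : ι → X → ℂ := fun i x => ∑ᶠ k, ρ k x • L k i x with hh
  have hsupp : ∀ k x, ρ k x ≠ 0 → x ∈ D.U k := fun k x hk =>
    hρ k (subset_closure hk)
  refine ⟨fun i x => Complex.exp (2 * Real.pi * Complex.I * h i x), fun i => ?_,
    fun i x => Complex.exp_ne_zero _, fun i i' x hx => ?_⟩
  · refine Complex.continuous_exp.comp_continuousOn (continuousOn_const.mul ?_)
    rw [continuousOn_iff_continuous_domRestrict]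
    refine continuous_finsum (f := fun k (x : D.U i) => ρ k x • L k i x) (fun k => ?_) ?_
    · rw [continuous_iff_continuousAt]
      rintro ⟨x, hx⟩
      by_cases hxk : x ∈ tsupport (ρ k)
      · have h1 : ContinuousAt (fun y => ρ k y • L k i y) x :=
          (ρ k).continuous.continuousAt.smul ((hLcont k i).continuousAt
            (((D.isOpen_U k).inter (D.isOpen_U i)).mem_nhds ⟨hρ k hxk, hx⟩))
        exact ContinuousAt.comp (f := Subtype.val) (x := (⟨x, hx⟩ : D.U i)) h1
          continuousAt_subtype_val
      · have h1 : ∀ᶠ y : D.U i in nhds ⟨x, hx⟩, (y : X) ∈ (tsupport (ρ k))ᶜ :=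
          continuousAt_subtype_val.eventually ((isClosed_tsupport _).isOpen_compl.mem_nhds hxk)
        refine (continuousAt_const (y := (0 : ℂ))).congr ?_
        filter_upwards [h1] with y hy
        rw [image_eq_zero_of_notMem_tsupport hy, zero_smul]
    · have h1 := ρ.locallyFinite.preimage_continuous (continuous_subtype_val (p := (· ∈ D.U i)))
      refine h1.subset fun k x hx => ?_
      simp only [Function.mem_support] at hx
      exact fun h0 => hx (by rw [h0, zero_smul])
  · have hfin : ∀ f : ι → ℂ, (Function.support fun k => ρ k x • f k).Finite := fun f =>
      (ρ.locallyFinite.point_finite x).subset fun k hk => by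
        intro h0
        simp only [Function.mem_support] at hk
        exact hk (by rw [h0, zero_smul])
    have hdiff : h i' x - h i x = L i i' x := by
      have h1 : h i' x - h i x = ∑ᶠ k, ρ k x • (L k i' x - L k i x) := by
        simp only [hh, smul_sub]
        rw [finsum_sub_distrib (hfin _) (hfin _)]
      have h2 : ∀ k, ρ k x • (L k i' x - L k i x) = ρ k x • L i i' x := fun k => by
        by_cases hk : ρ k x = 0
        · rw [hk, zero_smul, zero_smul]
        · rw [hLcoc k i i' x ⟨⟨hsupp k x hk, hx.1⟩, hx.2⟩]
      have h3 : (∑ᶠ k, ρ k x • L i i' x) = (∑ᶠ k, ρ k x) • L i i' x :=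
        (finsum_smul' (ρ.locallyFinite.point_finite x) _).symm
      rw [h1, finsum_congr h2, h3, ρ.sum_eq_one (Set.mem_univ x), one_smul]
    rw [← D.exp_log i i' x hx, ← Complex.exp_add]
    rw [Complex.exp_eq_exp_iff_exists_int]
    refine ⟨-m i i' x, ?_⟩
    simp only [hL] at hdiff
    push_cast
    linear_combination (2 * Real.pi * Complex.I) * hdiff

/-- The area forms of the local frames, rescaled by the potential, agree on overlaps. -/
theorem CompatibleJ.ChernClassEqZero.exists_areaForm [T2Space X] [SecondCountableTopology X]
    {Ω : SymplecticForm X} {j : CompatibleJ Ω} (hj : j.ChernClassEqZero) :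
    Nonempty (AreaForm j) := by
  obtain ⟨ι, D, m, hm, hcoc⟩ := hj
  obtain ⟨K, hKc, hK0, hKg⟩ := D.exists_potential m hm hcoc
  choose i hi using D.cover
  have hsq : ∀ x v, j.modelJ x (j.modelJ x v) = -v := fun x v => j.sq x v
  set F : ι → X → Fin 2 → Model4 := fun i x k => D.frame i k x with hF
  have hinv : ∀ {i x}, x ∈ D.U i → (frameMap (j.modelJ x) (F i x)).IsInvertible :=
    fun hx => D.isInvertible hx
  have key : ∀ k x, x ∈ D.U k → ∀ v w, K (i x) x * frameArea (j.modelJ x) (F (i x) x) v w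
      = K k x * frameArea (j.modelJ x) (F k x) v w := by
    intro k x hx v w
    rw [frameArea_transition (hsq x) (hinv (hi x)) (hinv hx) (D.g (i x) k x)
      (fun l => D.transition (i x) k x ⟨hi x, hx⟩ l), hKg (i x) k x ⟨hi x, hx⟩, mul_assoc]
  refine ⟨⟨fun x => K (i x) x • frameArea (j.modelJ x) (F (i x) x), fun x v => ?_,
    fun x v w => ?_, fun x v w hw h0 => ?_, fun x₀ v w => ?_⟩⟩
  · simp [frameArea_apply]; right; ring
  · obtain ⟨c, rfl⟩ := frameMap_exists (hinv (hi x)) v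
    obtain ⟨d, rfl⟩ := frameMap_exists (hinv (hi x)) w
    have h1 : j.modelJ x (frameMap (j.modelJ x) (F (i x) x) c)
        = frameMap (j.modelJ x) (F (i x) x) (Complex.I • c) := by
      rw [frameMap_smul (hsq x)]; simp
    simp only [smul_apply, smul_eq_mul]
    rw [h1, frameArea_frameMap (hinv (hi x)), frameArea_frameMap (hinv (hi x))]
    simp only [Pi.smul_apply, smul_eq_mul]; ring
  · obtain ⟨c, rfl⟩ := frameMap_exists (hinv (hi x)) v
    obtain ⟨d, rfl⟩ := frameMap_exists (hinv (hi x)) w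
    simp only [smul_apply, smul_eq_mul] at h0
    rw [frameArea_frameMap (hinv (hi x))] at h0
    have h1 := (mul_eq_zero.1 h0).resolve_left (hK0 _ _)
    have hd : ∃ a : ℂ, c = a • d := by
      by_cases hd0 : d 0 = 0
      · have hd1 : d 1 ≠ 0 := fun hd1 => hw (by
          have : d = 0 := by ext k; fin_cases k <;> simp [hd0, hd1]
          rw [this, map_zero])
        refine ⟨c 1 / d 1, ?_⟩
        rw [hd0, mul_zero, sub_zero, mul_eq_zero, or_iff_left hd1] at h1
        ext k; fin_cases k <;> simp [hd0, h1, hd1]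
      · refine ⟨c 0 / d 0, ?_⟩
        ext k; fin_cases k
        · simp [hd0]
        · simp only [Fin.mk_one, Pi.smul_apply, smul_eq_mul]
          field_simp; linear_combination -h1
    obtain ⟨a, rfl⟩ := hd
    exact ⟨a.re, a.im, frameMap_smul (hsq x) _ _ _⟩
  · set k := i x₀
    have hk := hi x₀
    have hFc : ∀ l, ContinuousAt (fun x => toModel x₀ x (F k x l)) x₀ := fun l =>
      continuousAt_toModel_of_section
        ((D.frame_continuous k l).continuousAt ((D.isOpen_U k).mem_nhds hk))
    have hU : ∀ᶠ x in nhds x₀, x ∈ D.U k ∧ x ∈ (chartAt Model4 x₀).source :=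
      Filter.Eventually.and ((D.isOpen_U k).mem_nhds hk)
        ((chartAt Model4 x₀).open_source.mem_nhds (mem_chart_source _ x₀))
    have hinv' : ∀ {x}, x ∈ D.U k → x ∈ (chartAt Model4 x₀).source →
        (frameMap (toModel x₀ x ∘L j.modelJ x ∘L ofModel x₀ x)
          (fun l => toModel x₀ x (F k x l))).IsInvertible := fun {x} hx hx' => by
      refine frameMap_isInvertible (by simp) fun c hc => ?_
      rw [frameMap_conj _ _ (ofModel_toModel hx')] at hc
      have h2 : frameMap (j.modelJ x) (F k x) c = 0 := by
        rw [← ofModel_toModel hx' (frameMap (j.modelJ x) (F k x) c), hc, map_zero]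
      exact ((hinv hx).injective.eq_iff' (map_zero _)).1 h2
    have hA := frameArea_continuousAt (F := fun l x => toModel x₀ x (F k x l))
      (j.continuousAt_conj x₀) hFc (hinv' hk (mem_chart_source _ x₀))
    have hKx : ContinuousAt (K k) x₀ := (hKc k).continuousAt ((D.isOpen_U k).mem_nhds hk)
    have hfst : ContinuousAt (fun p : X × Model4 × Model4 => p.1) (x₀, v, w) := continuousAt_fst
    have hmain : ContinuousAt (fun p : X × Model4 × Model4 => K k p.1 *
        frameArea (toModel x₀ p.1 ∘L j.modelJ p.1 ∘L ofModel x₀ p.1)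
          (fun l => toModel x₀ p.1 (F k p.1 l)) p.2.1 p.2.2) (x₀, v, w) := by
      refine (ContinuousAt.comp (f := fun p : X × Model4 × Model4 => p.1) hKx hfst).mul ?_
      have h1 := ContinuousAt.comp (f := fun p : X × Model4 × Model4 => p.1) (x := (x₀, v, w))
        hA hfst
      exact (h1.clm_apply (by fun_prop)).clm_apply (by fun_prop)
    refine hmain.congr ?_
    filter_upwards [hfst.eventually hU] with p hp
    simp only [smul_apply, smul_eq_mul]
    rw [key k p.1 hp.1, frameArea_conj (ofModel_toModel hp.2) (toModel_ofModel hp.2)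
      (hinv hp.1) (hinv' hp.1 hp.2)]

end Model

/-! ### Isotropic planes and complex area forms -/

section Isotropic

variable {X : Type u} [TopologicalSpace X] [ChartedSpace Model4 X] [IsManifold (𝓡 4) ∞ X]
variable {Ω : SymplecticForm X} {j : CompatibleJ Ω}

theorem SymplecticForm.modelForm_self (Ω : SymplecticForm X) (x : X) (v : Model4) :
    Ω.modelForm x v v = 0 := Ω.alternating x v

theorem SymplecticForm.modelForm_swap (Ω : SymplecticForm X) (x : X) (v w : Model4) :
    Ω.modelForm x v w = -Ω.modelForm x w v := by
  have h := Ω.modelForm_self x (v + w)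
  simp only [map_add, add_apply, Ω.modelForm_self] at h
  linarith

theorem SymplecticForm.modelForm_nondegenerate (Ω : SymplecticForm X) (x : X) (v : Model4)
    (h : ∀ w, Ω.modelForm x v w = 0) : v = 0 := Ω.nondegenerate x v h

theorem CompatibleJ.modelForm_J_J (j : CompatibleJ Ω) (x : X) (v w : Model4) :
    Ω.modelForm x (j.modelJ x v) (j.modelJ x w) = Ω.modelForm x v w := j.compatible x v w

theorem CompatibleJ.modelJ_sq (j : CompatibleJ Ω) (x : X) (v : Model4) :
    j.modelJ x (j.modelJ x v) = -v := j.sq x v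

theorem CompatibleJ.modelForm_pos (j : CompatibleJ Ω) (x : X) {v : Model4} (hv : v ≠ 0) :
    0 < Ω.modelForm x v (j.modelJ x v) := j.positive x v hv

theorem CompatibleJ.modelForm_J_symm (j : CompatibleJ Ω) (x : X) (v w : Model4) :
    Ω.modelForm x v (j.modelJ x w) = Ω.modelForm x w (j.modelJ x v) := by
  rw [← j.modelForm_J_J x v (j.modelJ x w), j.modelJ_sq, map_neg, Ω.modelForm_swap, neg_neg]

/-- An isotropic plane is totally real, hence has non-zero complex area. -/
theorem AreaForm.ne_zero_of_isotropic (a : AreaForm j) {x : X} {v w : Model4} (hw : w ≠ 0)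
    (hv : ∀ c : ℝ, v ≠ c • w) (hΩ : Ω.modelForm x v w = 0) : a.form x v w ≠ 0 := by
  intro h0
  obtain ⟨α, β, rfl⟩ := a.exists_of_eq_zero x v w hw h0
  simp only [map_add, map_smul, add_apply, smul_apply, Ω.modelForm_self, smul_eq_mul,
    mul_zero, zero_add] at hΩ
  have hβ : β = 0 := by
    refine (mul_eq_zero.1 hΩ).resolve_right ?_
    rw [Ω.modelForm_swap]
    exact neg_ne_zero.2 (j.modelForm_pos x hw).ne'
  exact hv α (by rw [hβ, zero_smul, add_zero])

/-- The map `v ↦ a(v, ζ)` from the symplectic orthogonal of `ζ` to `ℂ` is compatible with the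
orientations given by `Ω` and by the complex structure of `ℂ`. -/
theorem AreaForm.orientation (a : AreaForm j) {x : X} {v w ζ : Model4} (hζ : ζ ≠ 0)
    (hvζ : Ω.modelForm x v ζ = 0) (hwζ : Ω.modelForm x w ζ = 0) (hvw : 0 < Ω.modelForm x v w) :
    0 < (starRingEnd ℂ (a.form x v ζ) * a.form x w ζ).im := by
  have hv : ∀ c : ℝ, v ≠ c • ζ := by
    rintro c rfl
    rw [Ω.modelForm_swap, map_smul, hwζ] at hvw
    simp at hvw
  have hp := a.ne_zero_of_isotropic hζ hv hvζ
  set p := a.form x v ζ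
  -- Subtracting a complex multiple of `v` from `w` leaves a complex multiple of `ζ`.
  obtain ⟨c, hc⟩ : ∃ c : ℂ, a.form x w ζ = c * p := ⟨a.form x w ζ / p, by field_simp⟩
  obtain ⟨γ, δ, hγδ⟩ := a.exists_of_eq_zero x (w - (c.re • v + c.im • j.modelJ x v)) ζ hζ (by
    simp only [map_sub, map_add, map_smul, sub_apply, add_apply, smul_apply, a.map_J, hc]
    apply Complex.ext <;> simp <;> ring)
  have hw : w = c.re • v + c.im • j.modelJ x v + (γ • ζ + δ • j.modelJ x ζ) := by
    rw [← hγδ]; abel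
  have hgζ := j.modelForm_pos x hζ
  have h1 : Ω.modelForm x ζ w = 0 := by rw [Ω.modelForm_swap, hwζ, neg_zero]
  have hζv : Ω.modelForm x ζ v = 0 := by rw [Ω.modelForm_swap, hvζ, neg_zero]
  rw [hw] at h1 hvw
  simp only [map_add, map_smul, smul_eq_mul, Ω.modelForm_self, hvζ, hζv, mul_zero, zero_add]
    at h1 hvw
  rw [j.modelForm_J_symm x ζ v] at h1
  set q := Ω.modelForm x v (j.modelJ x ζ)
  -- Cauchy–Schwarz for the metric `Ω(·, J·)`.
  have hcs := j.modelForm_pos x (v := Ω.modelForm x ζ (j.modelJ x ζ) • v - q • ζ) (by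
    intro h0
    refine hv (q / Ω.modelForm x ζ (j.modelJ x ζ)) ?_
    rw [div_eq_inv_mul, mul_smul, ← sub_eq_zero.1 h0, smul_smul, inv_mul_cancel₀ hgζ.ne',
      one_smul])
  simp only [map_sub, map_smul, sub_apply, smul_apply, smul_eq_mul] at hcs
  rw [j.modelForm_J_symm x ζ v] at hcs
  rw [show Ω.modelForm x v (j.modelJ x ζ) = q from rfl] at hcs
  set G := Ω.modelForm x ζ (j.modelJ x ζ)
  set E := Ω.modelForm x v (j.modelJ x v)
  have hβ : 0 < c.im := by
    have h2 : G * (c.im * E + δ * q) = c.im * (G * E - q * q) := by linear_combination q * h1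
    have h3 : 0 < c.im * (G * E - q * q) := h2 ▸ mul_pos hgζ hvw
    have h4 : 0 < G * (G * E - q * q) := by linarith
    exact (pos_iff_pos_of_mul_pos h3).2 ((pos_iff_pos_of_mul_pos h4).1 hgζ)
  rw [hc]
  have h5 : (starRingEnd ℂ p * (c * p)).im = c.im * Complex.normSq p := by
    simp only [Complex.mul_im, Complex.mul_re, Complex.conj_re, Complex.conj_im,
      Complex.normSq_apply]
    ring
  rw [h5]
  exact mul_pos hβ (Complex.normSq_pos.2 hp)

theorem SymplecticForm.continuousAt_ofModel (Ω : SymplecticForm X) (x₀ : X) (v w : Model4) :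
    ContinuousAt (fun p : X × Model4 × Model4 =>
      Ω.modelForm p.1 (ofModel x₀ p.1 p.2.1) (ofModel x₀ p.1 p.2.2)) (x₀, v, w) := by
  have hsec : ∀ f : X × Model4 × Model4 → Model4, Continuous f →
      ContinuousAt (fun p : X × Model4 × Model4 =>
        (TotalSpace.mk' Model4 p.1 (ofModel x₀ p.1 (f p)) : TangentBundle (𝓡 4) X))
        (x₀, v, w) := by
    intro f hf
    refine (FiberBundle.continuousAt_totalSpace Model4 _).2 ⟨continuousAt_fst, ?_⟩
    refine (hf.continuousAt (x := (x₀, v, w))).congr ?_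
    filter_upwards [continuousAt_fst.eventually
      ((chartAt Model4 x₀).open_source.mem_nhds (mem_chart_source _ x₀))] with p hp
    refine (toModel_ofModel hp (f p)).symm.trans ?_
    exact (trivializationAt Model4 (TangentSpace (𝓡 4)) x₀).continuousLinearMapAt_apply_of_mem ℝ
      (b := p.1) hp _
  have hΩ : ContinuousAt (fun p : X × Model4 × Model4 =>
      TotalSpace.mk' (Model4 →L[ℝ] Model4 →L[ℝ] ℝ)
        (E := fun x : X => TangentSpace (𝓡 4) x →L[ℝ] TangentSpace (𝓡 4) x →L[ℝ] ℝ) p.1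
        (Ω.form p.1)) (x₀, v, w) :=
    ContinuousAt.comp (f := fun p : X × Model4 × Model4 => p.1) Ω.smooth.continuous.continuousAt
      continuousAt_fst
  have h := ContinuousAt.clm_bundle_apply₂ (E₃ := Bundle.Trivial X ℝ) (F₁ := Model4)
    (F₂ := Model4) (F₃ := ℝ) hΩ (hsec (fun p => p.2.1) (by fun_prop))
    (hsec (fun p => p.2.2) (by fun_prop))
  exact ((FiberBundle.continuousAt_totalSpace ℝ _).1 h).2

end Isotropic

/-! ### Torus actions in charts -/

/-- Symmetry of the mixed second derivatives of a function on a product. -/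
theorem hasDerivAt_fderiv_swap {E F G : Type*} [NormedAddCommGroup E] [NormedSpace ℝ E]
    [NormedAddCommGroup F] [NormedSpace ℝ F] [NormedAddCommGroup G] [NormedSpace ℝ G]
    {f : E × F → G} {z : F} (hf : ContDiffAt ℝ 2 f (0, z)) (e : E) (v : F) :
    HasDerivAt (fun r : ℝ => fderiv ℝ f (r • e, z) (0, v))
      (fderiv ℝ (fun z => fderiv ℝ f (0, z) (e, 0)) z v) 0 := by
  have hd2 : HasFDerivAt (fderiv ℝ f) (fderiv ℝ (fderiv ℝ f) (0, z)) (0, z) :=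
    ((hf.fderiv_right (m := 1) (by norm_num)).differentiableAt (by simp)).hasFDerivAt
  have hsymm : IsSymmSndFDerivAt ℝ f (0, z) := hf.isSymmSndFDerivAt (by simp)
  have h1 : HasDerivAt (fun r : ℝ => (r • e, z)) (e, (0 : F)) 0 := by
    have : HasDerivAt (fun r : ℝ => r • e) e 0 := by
      simpa using (hasDerivAt_id (0 : ℝ)).smul_const e
    exact this.prodMk (hasDerivAt_const _ _)
  have hd2' : HasFDerivAt (fderiv ℝ f) (fderiv ℝ (fderiv ℝ f) (0, z))
      ((fun r : ℝ => (r • e, z)) 0) := by simpa using hd2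
  have h2 : HasDerivAt (fun r : ℝ => fderiv ℝ f (r • e, z) (0, v))
      (fderiv ℝ (fderiv ℝ f) (0, z) (e, 0) (0, v)) 0 :=
    (ContinuousLinearMap.apply ℝ G ((0 : E), v)).hasFDerivAt.comp_hasDerivAt (0 : ℝ)
      (hd2'.comp_hasDerivAt (0 : ℝ) h1)
  have h3 : HasFDerivAt (fun z => fderiv ℝ f (0, z)) (fderiv ℝ (fderiv ℝ f) (0, z) ∘L
      ContinuousLinearMap.inr ℝ E F) z :=
    HasFDerivAt.comp (g := fderiv ℝ f) (f := fun z : F => ((0 : E), z)) z hd2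
      (hasFDerivAt_prodMk_right (0 : E) z)
  have h4 := (ContinuousLinearMap.apply ℝ G (e, (0 : F))).hasFDerivAt.comp z h3
  have h5 : fderiv ℝ (fun z => fderiv ℝ f (0, z) (e, 0)) z v
      = fderiv ℝ (fderiv ℝ f) (0, z) (0, v) (e, 0) := by
    have := congrArg (fun f => f v) h4.fderiv
    simpa [Function.comp_def] using this
  rw [h5, hsymm.eq (0, v) (e, 0)]
  exact h2

section Flow

open Filter Topology

variable {X : Type u} [TopologicalSpace X] [ChartedSpace Model4 X] [IsManifold (𝓡 4) ∞ X]

namespace EffectiveTorusAction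

variable (τ : EffectiveTorusAction X)

/-- The value at `x` of the vector field generated by `ξ`, in the model space. -/
noncomputable def modelGen (ξ : Plane) (x : X) : Model4 := τ.generator ξ x

/-- The action in the preferred chart at `x₀`. -/
noncomputable def chartAct (x₀ : X) (p : Plane × Model4) : Model4 :=
  extChartAt (𝓡 4) x₀ (τ.act p.1 ((extChartAt (𝓡 4) x₀).symm p.2))

/-- The set of pairs `(t, z)` for which `z` and `t · z` lie in the preferred chart at `x₀`. -/
def chartDomain (x₀ : X) : Set (Plane × Model4) :=
  {p | p.2 ∈ (extChartAt (𝓡 4) x₀).target ∧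
    τ.act p.1 ((extChartAt (𝓡 4) x₀).symm p.2) ∈ (chartAt Model4 x₀).source}

/-- The vector field generated by `ξ` in the preferred chart at `x₀`. -/
noncomputable def chartGen (x₀ : X) (ξ : Plane) (z : Model4) : Model4 :=
  fderiv ℝ (τ.chartAct x₀) (0, z) (ξ, 0)

/-- The derivative at `x₀` of the action of `t`, meaningful for `t` in the stabilizer of `x₀`:
the isotropy representation. -/
noncomputable def isoRep (x₀ : X) (t : Plane) : Model4 →L[ℝ] Model4 :=
  fderiv ℝ (τ.chartAct x₀) (t, extChartAt (𝓡 4) x₀ x₀) ∘L ContinuousLinearMap.inr ℝ Plane Model4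

/-- The linearization at `x₀` of the vector field generated by `ξ`. -/
noncomputable def isoGen (x₀ : X) (ξ : Plane) : Model4 →L[ℝ] Model4 :=
  fderiv ℝ (τ.chartGen x₀ ξ) (extChartAt (𝓡 4) x₀ x₀)

theorem continuous_act : Continuous (fun p : Plane × X => τ.act p.1 p.2) := τ.smooth.continuous

theorem continuous_act_left (x : X) : Continuous (fun t => τ.act t x) :=
  τ.continuous_act.comp (by fun_prop : Continuous fun t : Plane => (t, x))

theorem continuous_act_right (t : Plane) : Continuous (τ.act t) :=
  τ.continuous_act.comp (by fun_prop : Continuous fun x : X => (t, x))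

theorem chartAct_apply {x₀ x : X} (hx : x ∈ (chartAt Model4 x₀).source) (t : Plane) :
    τ.chartAct x₀ (t, extChartAt (𝓡 4) x₀ x) = extChartAt (𝓡 4) x₀ (τ.act t x) := by
  have hx' : x ∈ (extChartAt (𝓡 4) x₀).source := by rwa [extChartAt_source]
  simp only [chartAct, (extChartAt (𝓡 4) x₀).left_inv hx']

theorem mem_chartDomain {x₀ x : X} {t : Plane} (hx : x ∈ (chartAt Model4 x₀).source)
    (ht : τ.act t x ∈ (chartAt Model4 x₀).source) :
    (t, extChartAt (𝓡 4) x₀ x) ∈ τ.chartDomain x₀ := by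
  have hx' : x ∈ (extChartAt (𝓡 4) x₀).source := by rwa [extChartAt_source]
  refine ⟨(extChartAt (𝓡 4) x₀).map_source hx', ?_⟩
  rwa [(extChartAt (𝓡 4) x₀).left_inv hx']

theorem zero_mem_chartDomain {x₀ : X} {z : Model4} (hz : z ∈ (extChartAt (𝓡 4) x₀).target) :
    ((0 : Plane), z) ∈ τ.chartDomain x₀ := by
  refine ⟨hz, ?_⟩
  rw [τ.act_zero, ← extChartAt_source (𝓡 4)]
  exact (extChartAt (𝓡 4) x₀).map_target hz

theorem contMDiffAt_symm_act {x₀ : X} {p : Plane × Model4}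
    (hp : p.2 ∈ (extChartAt (𝓡 4) x₀).target) :
    ContMDiffAt 𝓘(ℝ, Plane × Model4) (𝓡 4) ∞
      (fun p : Plane × Model4 => τ.act p.1 ((extChartAt (𝓡 4) x₀).symm p.2)) p := by
  have h1 : ContMDiffAt 𝓘(ℝ, Plane × Model4) 𝓘(ℝ, Plane) ∞
      (fun p : Plane × Model4 => p.1) p := contDiff_fst.contDiffAt.contMDiffAt
  have h2 : ContMDiffAt 𝓘(ℝ, Plane × Model4) 𝓘(ℝ, Model4) ∞
      (fun p : Plane × Model4 => p.2) p := contDiff_snd.contDiffAt.contMDiffAt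
  have h3 : ContMDiffAt 𝓘(ℝ, Model4) (𝓡 4) ∞ (extChartAt (𝓡 4) x₀).symm p.2 :=
    (contMDiffOn_extChartAt_symm x₀).contMDiffAt ((isOpen_extChartAt_target x₀).mem_nhds hp)
  exact (τ.smooth.contMDiffAt (x := (p.1, (extChartAt (𝓡 4) x₀).symm p.2))).comp p
    (h1.prodMk (h3.comp p h2))

theorem isOpen_chartDomain (x₀ : X) : IsOpen (τ.chartDomain x₀) := by
  rw [isOpen_iff_mem_nhds]
  rintro p ⟨h1, h2⟩
  exact Filter.inter_mem
    (continuousAt_snd.preimage_mem_nhds ((isOpen_extChartAt_target x₀).mem_nhds h1))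
    ((τ.contMDiffAt_symm_act h1).continuousAt.preimage_mem_nhds
      ((chartAt Model4 x₀).open_source.mem_nhds h2))

theorem contDiffAt_chartAct {x₀ : X} {p : Plane × Model4} (hp : p ∈ τ.chartDomain x₀) :
    ContDiffAt ℝ ∞ (τ.chartAct x₀) p := by
  rw [← contMDiffAt_iff_contDiffAt]
  exact (contMDiffAt_extChartAt' hp.2).comp p (τ.contMDiffAt_symm_act hp.1)

theorem hasFDerivAt_chartAct {x₀ : X} {p : Plane × Model4} (hp : p ∈ τ.chartDomain x₀) :
    HasFDerivAt (τ.chartAct x₀) (fderiv ℝ (τ.chartAct x₀) p) p :=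
  ((τ.contDiffAt_chartAct hp).differentiableAt (by simp)).hasFDerivAt

theorem symm_chartAct {x₀ : X} {p : Plane × Model4} (hp : p ∈ τ.chartDomain x₀) :
    (extChartAt (𝓡 4) x₀).symm (τ.chartAct x₀ p)
      = τ.act p.1 ((extChartAt (𝓡 4) x₀).symm p.2) := by
  have h := hp.2
  rw [← extChartAt_source (𝓡 4)] at h
  exact (extChartAt (𝓡 4) x₀).left_inv h

theorem chartAct_mem_target {x₀ : X} {p : Plane × Model4} (hp : p ∈ τ.chartDomain x₀) :
    τ.chartAct x₀ p ∈ (extChartAt (𝓡 4) x₀).target := by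
  have h := hp.2
  rw [← extChartAt_source (𝓡 4)] at h
  exact (extChartAt (𝓡 4) x₀).map_source h

theorem chartAct_chartAct {x₀ : X} {t : Plane} {z : Model4} (h : (t, z) ∈ τ.chartDomain x₀)
    (s : Plane) : τ.chartAct x₀ (s, τ.chartAct x₀ (t, z)) = τ.chartAct x₀ (s + t, z) := by
  change extChartAt (𝓡 4) x₀ (τ.act s ((extChartAt (𝓡 4) x₀).symm (τ.chartAct x₀ (t, z)))) = _
  rw [τ.symm_chartAct h, ← τ.act_add]
  rfl

theorem chartAct_zero {x₀ : X} {z : Model4} (hz : z ∈ (extChartAt (𝓡 4) x₀).target) :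
    τ.chartAct x₀ (0, z) = z := by
  simp only [chartAct, τ.act_zero, (extChartAt (𝓡 4) x₀).right_inv hz]

theorem chartGen_add (x₀ : X) (ξ η : Plane) (z : Model4) :
    τ.chartGen x₀ (ξ + η) z = τ.chartGen x₀ ξ z + τ.chartGen x₀ η z := by
  rw [chartGen, chartGen, chartGen, ← map_add]; simp

theorem chartGen_smul (x₀ : X) (c : ℝ) (ξ : Plane) (z : Model4) :
    τ.chartGen x₀ (c • ξ) z = c • τ.chartGen x₀ ξ z := by
  rw [chartGen, chartGen, ← map_smul]; simp

theorem modelGen_add (ξ η : Plane) (x : X) :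
    τ.modelGen (ξ + η) x = τ.modelGen ξ x + τ.modelGen η x :=
  map_add (mfderiv (𝓡 2) (𝓡 4) (fun t : Plane => τ.act t x) 0) ξ η

theorem modelGen_smul (c : ℝ) (ξ : Plane) (x : X) :
    τ.modelGen (c • ξ) x = c • τ.modelGen ξ x :=
  map_smul (mfderiv (𝓡 2) (𝓡 4) (fun t : Plane => τ.act t x) 0) c ξ

theorem contDiffAt_chartGen {x₀ : X} (ξ : Plane) {z : Model4}
    (hz : z ∈ (extChartAt (𝓡 4) x₀).target) : ContDiffAt ℝ ∞ (τ.chartGen x₀ ξ) z := by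
  have h1 : ContDiffAt ℝ ∞ (fderiv ℝ (τ.chartAct x₀)) ((0 : Plane), z) :=
    (τ.contDiffAt_chartAct (τ.zero_mem_chartDomain hz)).fderiv_right (by simp)
  have h2 : ContDiffAt ℝ ∞ (fun z : Model4 => ((0 : Plane), z)) z := by fun_prop
  exact (ContDiffAt.comp (g := fderiv ℝ (τ.chartAct x₀)) z h1 h2).clm_apply contDiffAt_const

theorem hasMFDerivAt_act_left (x : X) :
    HasMFDerivAt (𝓡 2) (𝓡 4) (fun t : Plane => τ.act t x) 0
      (mfderiv (𝓡 2) (𝓡 4) (fun t : Plane => τ.act t x) 0) := by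
  refine MDifferentiableAt.hasMFDerivAt ?_
  refine ContMDiffAt.mdifferentiableAt (n := ∞) ?_ (by simp)
  exact (τ.smooth.contMDiffAt (x := ((0 : Plane), x))).comp (0 : Plane)
    (contMDiffAt_id.prodMk contMDiffAt_const)

/-- The generating vector fields in charts. -/
theorem toModel_modelGen {x₀ x : X} (hx : x ∈ (chartAt Model4 x₀).source) (ξ : Plane) :
    toModel x₀ x (τ.modelGen ξ x) = τ.chartGen x₀ ξ (extChartAt (𝓡 4) x₀ x) := by
  have hx0 : τ.act 0 x ∈ (chartAt Model4 x₀).source := by rwa [τ.act_zero]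
  have h1 : HasMFDerivAt (𝓡 4) 𝓘(ℝ, Model4) (extChartAt (𝓡 4) x₀) (τ.act 0 x)
      (mfderiv (𝓡 4) 𝓘(ℝ, Model4) (extChartAt (𝓡 4) x₀) (τ.act 0 x)) :=
    (mdifferentiableAt_extChartAt hx0).hasMFDerivAt
  have h2 := h1.comp (0 : Plane) (τ.hasMFDerivAt_act_left x)
  have h3 := hasMFDerivAt_iff_hasFDerivAt.1 h2
  have h4 : HasFDerivAt (fun t : Plane => τ.chartAct x₀ (t, extChartAt (𝓡 4) x₀ x))
      (fderiv ℝ (τ.chartAct x₀) (0, extChartAt (𝓡 4) x₀ x) ∘L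
        ContinuousLinearMap.inl ℝ Plane Model4) 0 :=
    HasFDerivAt.comp (g := τ.chartAct x₀)
      (f := fun t : Plane => (t, (extChartAt (𝓡 4) x₀ x : Model4))) (0 : Plane)
      (τ.hasFDerivAt_chartAct (τ.mem_chartDomain hx hx0))
      (hasFDerivAt_prodMk_left (0 : Plane) (extChartAt (𝓡 4) x₀ x))
  have h5 : (extChartAt (𝓡 4) x₀ ∘ fun t : Plane => τ.act t x)
      = fun t : Plane => τ.chartAct x₀ (t, extChartAt (𝓡 4) x₀ x) :=
    funext fun t => (τ.chartAct_apply hx t).symm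
  rw [h5] at h3
  have h6 := congrArg (fun f : Plane →L[ℝ] Model4 => f ξ) (HasFDerivAt.unique
    (f' := (mfderiv (𝓡 4) 𝓘(ℝ, Model4) (extChartAt (𝓡 4) x₀) (τ.act 0 x) ∘L
      mfderiv (𝓡 2) (𝓡 4) (fun t : Plane => τ.act t x) 0 : Plane →L[ℝ] Model4)) h3 h4)
  have h7 : toModel x₀ (τ.act 0 x) (τ.modelGen ξ x)
      = τ.chartGen x₀ ξ (extChartAt (𝓡 4) x₀ x) := by
    rw [toModel, TangentBundle.continuousLinearMapAt_trivializationAt hx0]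
    exact h6.trans (by simp [chartGen])
  rwa [τ.act_zero] at h7

theorem toModel_self (x₀ : X) (v : Model4) : toModel x₀ x₀ v = v := by
  rw [toModel, TangentBundle.continuousLinearMapAt_trivializationAt (mem_chart_source _ x₀)]
  exact congrArg (fun f => f v) (mfderiv_extChartAt_self (I := 𝓡 4) (x := x₀))

theorem modelGen_eq (x₀ : X) (ξ : Plane) :
    τ.modelGen ξ x₀ = τ.chartGen x₀ ξ (extChartAt (𝓡 4) x₀ x₀) := by
  rw [← τ.toModel_modelGen (mem_chart_source _ x₀), toModel_self]

theorem modelGen_eq_ofModel {x₀ x : X} (hx : x ∈ (chartAt Model4 x₀).source) (ξ : Plane) :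
    τ.modelGen ξ x = ofModel x₀ x (τ.chartGen x₀ ξ (extChartAt (𝓡 4) x₀ x)) := by
  rw [← τ.toModel_modelGen hx, ofModel_toModel hx]

/-- The generating vector fields are invariant under the (commutative) torus. -/
theorem chartGen_chartAct {x₀ : X} {t : Plane} {z : Model4} (h : (t, z) ∈ τ.chartDomain x₀)
    (ξ : Plane) : τ.chartGen x₀ ξ (τ.chartAct x₀ (t, z))
      = fderiv ℝ (τ.chartAct x₀) (t, z) (0, τ.chartGen x₀ ξ z) := by
  have hline : HasDerivAt (fun r : ℝ => r • ξ) ξ 0 := by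
    simpa using (hasDerivAt_id (0 : ℝ)).smul_const ξ
  have hcurve : ∀ w ∈ (extChartAt (𝓡 4) x₀).target,
      HasDerivAt (fun r : ℝ => τ.chartAct x₀ (r • ξ, w)) (τ.chartGen x₀ ξ w) 0 := by
    intro w hw
    have h1 : HasDerivAt (fun r : ℝ => (r • ξ, w)) (ξ, (0 : Model4)) 0 :=
      hline.prodMk (hasDerivAt_const _ _)
    have h2 : HasFDerivAt (τ.chartAct x₀) (fderiv ℝ (τ.chartAct x₀) (0, w))
        ((fun r : ℝ => (r • ξ, w)) 0) := by
      simpa using τ.hasFDerivAt_chartAct (τ.zero_mem_chartDomain hw)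
    exact h2.comp_hasDerivAt (0 : ℝ) h1
  have h1 := hcurve _ (τ.chartAct_mem_target h)
  have h2 : HasDerivAt (fun r : ℝ => τ.chartAct x₀ (t, τ.chartAct x₀ (r • ξ, z)))
      (fderiv ℝ (τ.chartAct x₀) (t, z) (0, τ.chartGen x₀ ξ z)) 0 := by
    have h3 : HasDerivAt (fun r : ℝ => (t, τ.chartAct x₀ (r • ξ, z)))
        ((0 : Plane), τ.chartGen x₀ ξ z) 0 := (hasDerivAt_const _ _).prodMk (hcurve z h.1)
    have h4 : HasFDerivAt (τ.chartAct x₀) (fderiv ℝ (τ.chartAct x₀) (t, z))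
        ((fun r : ℝ => (t, τ.chartAct x₀ (r • ξ, z))) 0) := by
      simpa [τ.chartAct_zero h.1] using τ.hasFDerivAt_chartAct h
    exact h4.comp_hasDerivAt (0 : ℝ) h3
  refine h1.unique (h2.congr_of_eventuallyEq ?_)
  have hc : ContinuousAt (fun r : ℝ => (r • ξ, z)) 0 := by fun_prop
  have hmem : ∀ᶠ r : ℝ in 𝓝 0, (r • ξ, z) ∈ τ.chartDomain x₀ :=
    hc.eventually ((τ.isOpen_chartDomain x₀).mem_nhds
      (by simpa using τ.zero_mem_chartDomain h.1))
  filter_upwards [hmem] with r hr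
  rw [τ.chartAct_chartAct h, τ.chartAct_chartAct hr, add_comm]

/-! ### Stabilizers and the isotropy representation -/

/-- At a zero of a generating vector field the one-parameter group is constant: near time zero by
uniqueness of antiderivatives in a chart, and hence for all times. -/
theorem act_smul_eq {x : X} {ξ : Plane} (h : τ.modelGen ξ x = 0) (s : ℝ) :
    τ.act (s • ξ) x = x := by
  set z₀ := extChartAt (𝓡 4) x x with hz₀
  have hmem : ∀ᶠ s : ℝ in 𝓝 0, (s • ξ, z₀) ∈ τ.chartDomain x := by
    have hc : ContinuousAt (fun s : ℝ => (s • ξ, z₀)) 0 := by fun_prop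
    refine hc.eventually ((τ.isOpen_chartDomain x).mem_nhds ?_)
    simp only [zero_smul]
    exact τ.zero_mem_chartDomain (mem_extChartAt_target x)
  obtain ⟨ε, hε, hball⟩ := Metric.eventually_nhds_iff_ball.1 hmem
  have hgen : τ.chartGen x ξ z₀ = 0 := by rw [← τ.modelGen_eq, h]
  have hd : ∀ s ∈ Metric.ball (0 : ℝ) ε,
      HasDerivAt (fun s : ℝ => τ.chartAct x (s • ξ, z₀)) 0 s := by
    intro s hs
    have hsd := hball s hs
    have h1 : HasDerivAt (fun r : ℝ => ((r - s) • ξ, τ.chartAct x (s • ξ, z₀)))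
        (ξ, (0 : Model4)) s := by
      have : HasDerivAt (fun r : ℝ => (r - s) • ξ) ξ s := by
        simpa using ((hasDerivAt_id s).sub_const s).smul_const ξ
      exact this.prodMk (hasDerivAt_const _ _)
    have h2 : HasFDerivAt (τ.chartAct x) (fderiv ℝ (τ.chartAct x)
        (0, τ.chartAct x (s • ξ, z₀)))
        ((fun r : ℝ => ((r - s) • ξ, τ.chartAct x (s • ξ, z₀))) s) := by
      simpa using τ.hasFDerivAt_chartAct (τ.zero_mem_chartDomain (τ.chartAct_mem_target hsd))
    have h3 := h2.comp_hasDerivAt s h1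
    have h4 : fderiv ℝ (τ.chartAct x) (0, τ.chartAct x (s • ξ, z₀)) (ξ, 0) = 0 := by
      change τ.chartGen x ξ (τ.chartAct x (s • ξ, z₀)) = 0
      rw [τ.chartGen_chartAct hsd, hgen]
      exact map_zero _
    rw [h4] at h3
    refine h3.congr_of_eventuallyEq (Eventually.of_forall fun r => ?_)
    simp only [Function.comp_apply]
    rw [τ.chartAct_chartAct hsd, ← add_smul, sub_add_cancel]
  have hsmall : ∀ s ∈ Metric.ball (0 : ℝ) ε, τ.act (s • ξ) x = x := by
    intro s hs
    have h1 := (convex_ball (0 : ℝ) ε).is_const_of_fderivWithin_eq_zero (𝕜 := ℝ)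
      (fun s hs => (hd s hs).differentiableAt.differentiableWithinAt)
      (fun s hs => by
        rw [fderivWithin_of_isOpen Metric.isOpen_ball hs, (hd s hs).hasFDerivAt.fderiv]
        ext; simp) hs (Metric.mem_ball_self hε)
    have h2 := congrArg (extChartAt (𝓡 4) x).symm h1
    rw [τ.symm_chartAct (hball s hs), τ.symm_chartAct (hball 0 (Metric.mem_ball_self hε)),
      extChartAt_to_inv] at h2
    simpa [τ.act_zero] using h2
  obtain ⟨n, hn⟩ := exists_nat_gt (|s| / ε)
  have hn0 : 0 < (n : ℝ) := lt_of_le_of_lt (by positivity) hn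
  have h1 : τ.act ((s / n) • ξ) x = x := by
    refine hsmall _ ?_
    rw [mem_ball_zero_iff, Real.norm_eq_abs, abs_div, Nat.abs_cast, div_lt_iff₀ hn0]
    rwa [div_lt_iff₀ hε, mul_comm] at hn
  have h2 : ∀ k : ℕ, τ.act ((k : ℝ) • (s / n) • ξ) x = x := by
    intro k
    induction k with
    | zero => simp [τ.act_zero]
    | succ k ih =>
      rw [Nat.cast_succ, add_smul, one_smul, τ.act_add, h1, ih]
  have h3 := h2 n
  rwa [smul_smul, mul_div_cancel₀ _ hn0.ne'] at h3

theorem modelGen_eq_zero {x : X} {ξ : Plane} (h : ∀ s : ℝ, τ.act (s • ξ) x = x) :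
    τ.modelGen ξ x = 0 := by
  rw [τ.modelGen_eq]
  set z₀ := extChartAt (𝓡 4) x x with hz₀
  have h1 : HasDerivAt (fun r : ℝ => (r • ξ, z₀)) (ξ, (0 : Model4)) 0 := by
    have : HasDerivAt (fun r : ℝ => r • ξ) ξ 0 := by
      simpa using (hasDerivAt_id (0 : ℝ)).smul_const ξ
    exact this.prodMk (hasDerivAt_const _ _)
  have h2 : HasFDerivAt (τ.chartAct x) (fderiv ℝ (τ.chartAct x) (0, z₀))
      ((fun r : ℝ => (r • ξ, z₀)) 0) := by
    simp only [zero_smul]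
    exact τ.hasFDerivAt_chartAct (τ.zero_mem_chartDomain (mem_extChartAt_target x))
  have h3 := h2.comp_hasDerivAt (0 : ℝ) h1
  refine h3.unique ((hasDerivAt_const (0 : ℝ) z₀).congr_of_eventuallyEq
    (Eventually.of_forall fun r => ?_))
  simp only [Function.comp_apply]
  rw [hz₀, τ.chartAct_apply (mem_chart_source _ x), h]

section Fixed

variable {τ} {x₀ : X} {s t : Plane}

theorem mem_chartDomain_of_fixed (ht : τ.act t x₀ = x₀) :
    (t, extChartAt (𝓡 4) x₀ x₀) ∈ τ.chartDomain x₀ :=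
  τ.mem_chartDomain (mem_chart_source _ x₀) (by rw [ht]; exact mem_chart_source _ x₀)

theorem chartAct_of_fixed (ht : τ.act t x₀ = x₀) :
    τ.chartAct x₀ (t, extChartAt (𝓡 4) x₀ x₀) = extChartAt (𝓡 4) x₀ x₀ := by
  rw [τ.chartAct_apply (mem_chart_source _ x₀), ht]

theorem hasFDerivAt_isoRep (ht : τ.act t x₀ = x₀) :
    HasFDerivAt (fun z => τ.chartAct x₀ (t, z)) (τ.isoRep x₀ t) (extChartAt (𝓡 4) x₀ x₀) :=
  HasFDerivAt.comp (g := τ.chartAct x₀) (f := fun z : Model4 => (t, z))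
    (extChartAt (𝓡 4) x₀ x₀) (τ.hasFDerivAt_chartAct (mem_chartDomain_of_fixed ht))
    (hasFDerivAt_prodMk_right t (extChartAt (𝓡 4) x₀ x₀))

theorem eventually_mem_chartDomain (ht : τ.act t x₀ = x₀) :
    ∀ᶠ z in 𝓝 (extChartAt (𝓡 4) x₀ x₀), (t, z) ∈ τ.chartDomain x₀ := by
  have hc : ContinuousAt (fun z : Model4 => (t, z)) (extChartAt (𝓡 4) x₀ x₀) := by fun_prop
  exact hc.eventually ((τ.isOpen_chartDomain x₀).mem_nhds (mem_chartDomain_of_fixed ht))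

theorem isoRep_add (hs : τ.act s x₀ = x₀) (ht : τ.act t x₀ = x₀) :
    τ.isoRep x₀ (s + t) = τ.isoRep x₀ s ∘L τ.isoRep x₀ t := by
  have hst : τ.act (s + t) x₀ = x₀ := by rw [τ.act_add, ht, hs]
  have h1 : HasFDerivAt (fun z => τ.chartAct x₀ (s, z)) (τ.isoRep x₀ s)
      (τ.chartAct x₀ (t, extChartAt (𝓡 4) x₀ x₀)) := by
    rw [chartAct_of_fixed ht]; exact hasFDerivAt_isoRep hs
  have h2 := HasFDerivAt.comp (g := fun z => τ.chartAct x₀ (s, z))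
    (f := fun z => τ.chartAct x₀ (t, z)) (extChartAt (𝓡 4) x₀ x₀) h1 (hasFDerivAt_isoRep ht)
  refine (hasFDerivAt_isoRep hst).unique (h2.congr_of_eventuallyEq ?_)
  filter_upwards [eventually_mem_chartDomain ht] with z hz
  exact (τ.chartAct_chartAct hz s).symm

theorem isoRep_of_trivial (ht : ∀ x, τ.act t x = x) : τ.isoRep x₀ t = 1 := by
  refine (hasFDerivAt_isoRep (ht x₀)).unique ((hasFDerivAt_id _).congr_of_eventuallyEq ?_)
  filter_upwards [(isOpen_extChartAt_target x₀).mem_nhds (mem_extChartAt_target x₀)] with z hz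
  simp only [chartAct, ht, (extChartAt (𝓡 4) x₀).right_inv hz, id]

/-- The infinitesimal isotropy representation is the linearization of the generating vector field:
symmetry of second derivatives. -/
theorem hasDerivAt_isoRep_zero (x₀ : X) (η : Plane) (v : Model4) :
    HasDerivAt (fun r : ℝ => τ.isoRep x₀ (r • η) v) (τ.isoGen x₀ η v) 0 := by
  have hdom := τ.zero_mem_chartDomain (mem_extChartAt_target (I := 𝓡 4) x₀)
  exact hasDerivAt_fderiv_swap ((τ.contDiffAt_chartAct hdom).of_le
    (WithTop.coe_le_coe.2 (le_top : (2 : ℕ∞) ≤ ⊤))) η v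

theorem hasDerivAt_isoRep {η : Plane} (hη : ∀ s : ℝ, τ.act (s • η) x₀ = x₀) (s : ℝ) (v : Model4) :
    HasDerivAt (fun r : ℝ => τ.isoRep x₀ (r • η) v)
      (τ.isoRep x₀ (s • η) (τ.isoGen x₀ η v)) s := by
  have h1 : HasDerivAt (fun r : ℝ => τ.isoRep x₀ ((r - s) • η) v) (τ.isoGen x₀ η v) s := by
    have h2 := hasDerivAt_isoRep_zero (τ := τ) x₀ η v
    rw [← sub_self s] at h2
    exact h2.comp_sub_const s s
  have h3 := (τ.isoRep x₀ (s • η)).hasFDerivAt.comp_hasDerivAt s h1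
  refine h3.congr_of_eventuallyEq (Eventually.of_forall fun r => ?_)
  have := isoRep_add (hη s) (hη (r - s))
  rw [← add_smul, add_sub_cancel] at this
  simp only [this]
  rfl

theorem isCircleRep {η : Plane} (hη : ∀ s : ℝ, τ.act (s • η) x₀ = x₀)
    (hper : ∀ x, τ.act ((2 * Real.pi) • η) x = x) :
    IsCircleRep (fun s : ℝ => τ.isoRep x₀ (s • η)) (τ.isoGen x₀ η) where
  map_zero := by
    rw [zero_smul]; exact isoRep_of_trivial τ.act_zero
  hasDerivAt := hasDerivAt_isoRep hη
  map_two_pi := isoRep_of_trivial hper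

theorem isoGen_add (ξ η : Plane) : τ.isoGen x₀ (ξ + η) = τ.isoGen x₀ ξ + τ.isoGen x₀ η := by
  have h := mem_extChartAt_target (I := 𝓡 4) x₀
  have hd := fun ξ => (τ.contDiffAt_chartGen ξ h).differentiableAt (by simp)
  rw [isoGen, isoGen, isoGen, ← fderiv_add (hd ξ) (hd η)]
  congr 1
  exact funext fun z => τ.chartGen_add x₀ ξ η z

theorem isoGen_smul (c : ℝ) (ξ : Plane) : τ.isoGen x₀ (c • ξ) = c • τ.isoGen x₀ ξ := by
  have h := mem_extChartAt_target (I := 𝓡 4) x₀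
  have hd := (τ.contDiffAt_chartGen ξ h).differentiableAt (by simp)
  rw [isoGen, isoGen, ← fderiv_const_smul hd]
  congr 1
  exact funext fun z => τ.chartGen_smul x₀ c ξ z

theorem isoGen_commute (hfix : ∀ t, τ.act t x₀ = x₀) (ξ η : Plane) (v : Model4) :
    τ.isoGen x₀ ξ (τ.isoGen x₀ η v) = τ.isoGen x₀ η (τ.isoGen x₀ ξ v) := by
  have hcomm : ∀ s t w, τ.isoRep x₀ s (τ.isoRep x₀ t w) = τ.isoRep x₀ t (τ.isoRep x₀ s w) := by
    intro s t w
    have h1 := isoRep_add (hfix s) (hfix t)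
    rw [add_comm, isoRep_add (hfix t) (hfix s)] at h1
    exact (congrArg (fun f => f w) h1).symm
  have h1 : ∀ t w, τ.isoGen x₀ ξ (τ.isoRep x₀ t w) = τ.isoRep x₀ t (τ.isoGen x₀ ξ w) := by
    intro t w
    have h2 := hasDerivAt_isoRep_zero (τ := τ) x₀ ξ (τ.isoRep x₀ t w)
    have h3 := (τ.isoRep x₀ t).hasFDerivAt.comp_hasDerivAt (0 : ℝ)
      (hasDerivAt_isoRep_zero (τ := τ) x₀ ξ w)
    exact h2.unique (h3.congr_of_eventuallyEq (Eventually.of_forall fun r => hcomm _ _ _))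
  have h2 := (τ.isoGen x₀ ξ).hasFDerivAt.comp_hasDerivAt (0 : ℝ)
    (hasDerivAt_isoRep_zero (τ := τ) x₀ η v)
  have h3 := hasDerivAt_isoRep_zero (τ := τ) x₀ η (τ.isoGen x₀ ξ v)
  exact h2.unique (h3.congr_of_eventuallyEq (Eventually.of_forall fun r => h1 _ _))

/-- A vector generated by the action at a point of the orbit of `x₀` on which `η` acts trivially
is fixed by the isotropy representation. -/
theorem isoGen_modelGen {η : Plane} (hη : ∀ s : ℝ, τ.act (s • η) x₀ = x₀) (ξ : Plane) :
    τ.isoGen x₀ η (τ.modelGen ξ x₀) = 0 := by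
  have h1 : ∀ s : ℝ, τ.isoRep x₀ (s • η) (τ.modelGen ξ x₀) = τ.modelGen ξ x₀ := by
    intro s
    have := τ.chartGen_chartAct (mem_chartDomain_of_fixed (hη s)) ξ
    rw [chartAct_of_fixed (hη s), ← τ.modelGen_eq] at this
    exact this.symm
  exact (hasDerivAt_isoRep_zero (τ := τ) x₀ η (τ.modelGen ξ x₀)).unique
    ((hasDerivAt_const (0 : ℝ) _).congr_of_eventuallyEq (Eventually.of_forall h1))

theorem mfderiv_act (ht : τ.act t x₀ = x₀) (v : Model4) :
    (mfderiv (𝓡 4) (𝓡 4) (τ.act t) x₀ v : Model4) = τ.isoRep x₀ t v := by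
  have hmd : MDifferentiableAt (𝓡 4) (𝓡 4) (τ.act t) x₀ := by
    refine ContMDiffAt.mdifferentiableAt (n := ∞) ?_ (by simp)
    exact (τ.smooth.contMDiffAt (x := (t, x₀))).comp x₀ (contMDiffAt_const.prodMk contMDiffAt_id)
  set M : Model4 →L[ℝ] Model4 := mfderiv (𝓡 4) (𝓡 4) (τ.act t) x₀
  have h1 : HasFDerivWithinAt (writtenInExtChartAt (𝓡 4) (𝓡 4) x₀ (τ.act t)) M
      (Set.range (𝓡 4)) (extChartAt (𝓡 4) x₀ x₀) := hmd.hasMFDerivAt.2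
  have h2 : writtenInExtChartAt (𝓡 4) (𝓡 4) x₀ (τ.act t)
      = fun z => τ.chartAct x₀ (t, z) := by
    funext z
    simp only [writtenInExtChartAt, Function.comp_apply, chartAct, ht]
  rw [h2, ModelWithCorners.range_eq_univ, hasFDerivWithinAt_univ] at h1
  exact congrArg (fun f : Model4 →L[ℝ] Model4 => f v) (h1.unique (hasFDerivAt_isoRep ht))

end Fixed

end EffectiveTorusAction

end Flow

/-! ### Effectiveness -/

section Rigidity

open Filter Topology

variable {X : Type u} [TopologicalSpace X] [ChartedSpace Model4 X] [IsManifold (𝓡 4) ∞ X]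

/-- The integral lattice in the Lie algebra of the torus; `2π • intVec m` acts trivially. -/
noncomputable def intVec : (Fin 2 → ℤ) →+ Plane where
  toFun m := WithLp.toLp 2 fun k => (m k : ℝ)
  map_zero' := by ext k; simp
  map_add' a b := by ext k; simp

@[simp] theorem intVec_apply (m : Fin 2 → ℤ) (k : Fin 2) : intVec m k = m k := rfl

namespace EffectiveTorusAction

variable {τ : EffectiveTorusAction X}

theorem act_two_pi_smul (τ : EffectiveTorusAction X) (m : Fin 2 → ℤ) (x : X) :
    τ.act ((2 * Real.pi) • intVec m) x = x :=
  (τ.effective _).2 ⟨m, fun k => by simp⟩ x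

/-- A diffeomorphism of finite order with a fixed point and identity derivative there is locally the
identity. -/
theorem eventually_act_eq {t : Plane} {x₀ : X} (ht : τ.act t x₀ = x₀) (h1 : τ.isoRep x₀ t = 1)
    {k : ℕ} (hk : 0 < k) (hper : ∀ x, τ.act ((k : ℝ) • t) x = x) :
    ∀ᶠ x in 𝓝 x₀, τ.act t x = x := by
  have hfix : ∀ i : ℕ, τ.act ((i : ℝ) • t) x₀ = x₀ ∧ τ.isoRep x₀ ((i : ℝ) • t) = 1 := by
    intro i
    induction i with
    | zero => simpa [τ.act_zero] using isoRep_of_trivial τ.act_zero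
    | succ i ih =>
      rw [Nat.cast_succ, add_smul, one_smul, τ.act_add, ht, ih.1, isoRep_add ih.1 ht, ih.2, h1]
      exact ⟨rfl, rfl⟩
  -- The average of the powers of the diffeomorphism is an invariant local coordinate system.
  set S : Model4 → Model4 := fun z => ∑ i ∈ Finset.range k, τ.chartAct x₀ ((i : ℝ) • t, z) with hS
  set z₀ : Model4 := extChartAt (𝓡 4) x₀ x₀ with hz₀
  have hstrict : ∀ i : ℕ, HasStrictFDerivAt (fun z => τ.chartAct x₀ ((i : ℝ) • t, z))
      (1 : Model4 →L[ℝ] Model4) z₀ := by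
    intro i
    have hc : ContDiffAt ℝ ∞ (fun z : Model4 => τ.chartAct x₀ ((i : ℝ) • t, z)) z₀ :=
      ContDiffAt.comp (g := τ.chartAct x₀) (f := fun z : Model4 => ((i : ℝ) • t, z)) z₀
        (τ.contDiffAt_chartAct (mem_chartDomain_of_fixed (hfix i).1)) (by fun_prop)
    have h := hc.hasStrictFDerivAt (by simp)
    rwa [(hasFDerivAt_isoRep (hfix i).1).fderiv, (hfix i).2] at h
  have hk0 : (k : ℝ) ≠ 0 := by exact_mod_cast hk.ne'
  have hSd : HasStrictFDerivAt S
      ((ContinuousLinearEquiv.smulLeft (Units.mk0 (k : ℝ) hk0) : Model4 ≃L[ℝ] Model4) :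
        Model4 →L[ℝ] Model4) z₀ := by
    have hL : ((ContinuousLinearEquiv.smulLeft (Units.mk0 (k : ℝ) hk0) : Model4 ≃L[ℝ] Model4) :
        Model4 →L[ℝ] Model4) = ∑ i ∈ Finset.range k, (1 : Model4 →L[ℝ] Model4) :=
      ContinuousLinearMap.ext fun v => by
        simp [Units.smul_def, Nat.cast_smul_eq_nsmul]
    rw [hL]
    exact HasStrictFDerivAt.fun_sum (u := Finset.range k) (fun i _ => hstrict i)
  have hinv : ∀ z, (t, z) ∈ τ.chartDomain x₀ → S (τ.chartAct x₀ (t, z)) = S z := by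
    intro z hz
    have h2 : ∀ i : ℕ, τ.chartAct x₀ ((i : ℝ) • t, τ.chartAct x₀ (t, z))
        = τ.chartAct x₀ (((i + 1 : ℕ) : ℝ) • t, z) := fun i => by
      rw [τ.chartAct_chartAct hz, Nat.cast_succ, add_smul, one_smul]
    simp only [hS, h2]
    have h3 := Finset.sum_range_succ (fun i : ℕ => τ.chartAct x₀ ((i : ℝ) • t, z)) k
    rw [Finset.sum_range_succ'] at h3
    have h4 : τ.chartAct x₀ ((k : ℝ) • t, z) = τ.chartAct x₀ (((0 : ℕ) : ℝ) • t, z) := by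
      simp only [chartAct, hper, Nat.cast_zero, zero_smul, τ.act_zero]
    rw [h4] at h3
    exact add_right_cancel h3
  have hleft := hSd.eventually_left_inverse
  have hcont : Tendsto (fun z => τ.chartAct x₀ (t, z)) (𝓝 z₀) (𝓝 z₀) := by
    have h := (hasFDerivAt_isoRep ht).continuousAt
    rwa [ContinuousAt, chartAct_of_fixed ht] at h
  have hfinal : ∀ᶠ z in 𝓝 z₀, τ.chartAct x₀ (t, z) = z := by
    filter_upwards [hleft, hcont.eventually hleft, eventually_mem_chartDomain ht] with z h2 h3 h4
    rw [← h3, hinv z h4, h2]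
  have hφ : Tendsto (extChartAt (𝓡 4) x₀) (𝓝 x₀) (𝓝 z₀) := continuousAt_extChartAt x₀
  filter_upwards [hφ.eventually hfinal, hφ.eventually (eventually_mem_chartDomain ht),
    (chartAt Model4 x₀).open_source.mem_nhds (mem_chart_source _ x₀)] with x h2 h3 h4
  have h5 := congrArg (extChartAt (𝓡 4) x₀).symm h2
  have h4' : x ∈ (extChartAt (𝓡 4) x₀).source := by rwa [extChartAt_source]
  rwa [τ.symm_chartAct h3, (extChartAt (𝓡 4) x₀).left_inv h4'] at h5

/-- A torus element of finite order that fixes a point and acts trivially on its tangent space acts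
trivially on the connected manifold `X`. -/
theorem act_eq_of_isoRep_eq_one [T2Space X] [ConnectedSpace X] {t : Plane} {x₀ : X}
    (ht : τ.act t x₀ = x₀) (h1 : τ.isoRep x₀ t = 1) {k : ℕ} (hk : 0 < k)
    (hper : ∀ x, τ.act ((k : ℝ) • t) x = x) (x : X) : τ.act t x = x := by
  set A : Set X := {x | ∀ᶠ y in 𝓝 x, τ.act t y = y} with hA
  have hopen : IsOpen A := isOpen_setOfPred_eventually_nhds
  have hclosed : IsClosed A := by
    refine closure_subset_iff_isClosed.1 fun x hx => ?_
    have hfix : τ.act t x = x := by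
      have hF : IsClosed {y | τ.act t y = y} :=
        isClosed_eq (τ.continuous_act_right t) continuous_id
      exact hF.closure_subset_iff.2 (fun y hy => Eventually.self_of_nhds hy) hx
    refine eventually_act_eq hfix ?_ hk hper
    -- The derivative of the action of `t` is continuous, and it is the identity on `A`.
    by_contra hne
    set D : Model4 → Model4 →L[ℝ] Model4 := fun z =>
      fderiv ℝ (τ.chartAct x) (t, z) ∘L ContinuousLinearMap.inr ℝ Plane Model4 with hD
    have hDc : ContinuousAt D (extChartAt (𝓡 4) x x) := by
      have h2 : ContinuousAt (fderiv ℝ (τ.chartAct x)) (t, extChartAt (𝓡 4) x x) :=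
        ((τ.contDiffAt_chartAct (mem_chartDomain_of_fixed hfix)).fderiv_right (m := ∞)
          (by simp)).continuousAt
      exact (ContinuousAt.comp (g := fderiv ℝ (τ.chartAct x)) (f := fun z : Model4 => (t, z))
        h2 (by fun_prop)).clm_comp continuousAt_const
    have hev : ∀ᶠ y in 𝓝 x, D (extChartAt (𝓡 4) x y) ≠ 1 :=
      (continuousAt_extChartAt x).eventually (hDc.eventually_ne hne)
    have hfr : ∃ᶠ y in 𝓝 x, y ∈ A := mem_closure_iff_frequently.1 hx
    have hdom : ∀ᶠ y in 𝓝 x, (t, extChartAt (𝓡 4) x y) ∈ τ.chartDomain x :=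
      (continuousAt_extChartAt x).eventually (eventually_mem_chartDomain hfix)
    obtain ⟨y, hyA, hy1, hyd, hys⟩ := (hfr.and_eventually (hev.and (hdom.and
      ((chartAt Model4 x).open_source.mem_nhds (mem_chart_source _ x))))).exists
    refine hy1 ?_
    have hys' : y ∈ (extChartAt (𝓡 4) x).source := by
      rw [extChartAt_source]; exact hys
    have h3 : HasFDerivAt (fun z => τ.chartAct x (t, z)) (D (extChartAt (𝓡 4) x y))
        (extChartAt (𝓡 4) x y) :=
      HasFDerivAt.comp (g := τ.chartAct x) (f := fun z : Model4 => (t, z)) _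
        (τ.hasFDerivAt_chartAct hyd) (hasFDerivAt_prodMk_right t _)
    refine h3.unique ((hasFDerivAt_id _).congr_of_eventuallyEq ?_)
    have h4 : Tendsto (extChartAt (𝓡 4) x).symm (𝓝 (extChartAt (𝓡 4) x y)) (𝓝 y) := by
      have := continuousAt_extChartAt_symm' hys'
      rwa [ContinuousAt, (extChartAt (𝓡 4) x).left_inv hys'] at this
    filter_upwards [h4.eventually hyA, (isOpen_extChartAt_target x).mem_nhds
      ((extChartAt (𝓡 4) x).map_source hys')] with z hz hzt
    simp only [chartAct, hz, (extChartAt (𝓡 4) x).right_inv hzt, id]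
  have huniv : A = Set.univ :=
    IsClopen.eq_univ ⟨hclosed, hopen⟩ ⟨x₀, eventually_act_eq ht h1 hk hper⟩
  have : x ∈ A := huniv ▸ Set.mem_univ x
  exact Filter.Eventually.self_of_nhds (p := fun y => τ.act t y = y) this

/-- The isotropy representation of the circle generated by a primitive lattice vector is
faithful. -/
theorem isoRep_ne_one [T2Space X] [ConnectedSpace X] {m : Fin 2 → ℤ} (hm : IsCoprime (m 0) (m 1))
    {x₀ : X} (hfix : ∀ s : ℝ, τ.act (s • intVec m) x₀ = x₀) (k : ℕ) (hk : 2 ≤ k) :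
    τ.isoRep x₀ ((2 * Real.pi / k) • intVec m) ≠ 1 := by
  intro h1
  have hk0 : (k : ℝ) ≠ 0 := by positivity
  have htriv := act_eq_of_isoRep_eq_one (hfix _) h1 (by omega : 0 < k) (fun x => by
    rw [smul_smul, mul_div_cancel₀ _ hk0]
    exact τ.act_two_pi_smul m x)
  obtain ⟨n, hn⟩ := (τ.effective _).1 htriv
  have hmn : ∀ i, m i = k * n i := by
    intro i
    have h2 := hn i
    simp only [PiLp.smul_apply, intVec_apply, smul_eq_mul] at h2
    have h3 : (m i : ℝ) = k * n i := by
      field_simp at h2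
      linarith
    exact_mod_cast h3
  obtain ⟨a, b, hab⟩ := hm
  rw [hmn 0, hmn 1] at hab
  have hdvd : (k : ℤ) ∣ 1 := ⟨a * n 0 + b * n 1, by linear_combination -hab⟩
  have := Int.le_of_dvd one_pos hdvd
  omega

end EffectiveTorusAction

/-! ### Consequences of the moment map equation -/

section Moment

variable {Ω : SymplecticForm X} {τ : EffectiveTorusAction X} {μ : X → Plane}

/-- The derivative of the moment map at `x`, on the model space. -/
noncomputable def momentDeriv (μ : X → Plane) (x : X) : Model4 →L[ℝ] Plane :=
  mfderiv (𝓡 4) (𝓡 2) μ x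

namespace IsToricMomentMap

variable (hμ : IsToricMomentMap Ω τ μ)
include hμ

theorem inner_momentDeriv (x : X) (v : Model4) (ξ : Plane) :
    ⟪momentDeriv μ x v, ξ⟫ = Ω.modelForm x v (τ.modelGen ξ x) := hμ.hamiltonian x v ξ

theorem hasMFDerivAt (x : X) :
    HasMFDerivAt (𝓡 4) (𝓡 2) μ x (mfderiv (𝓡 4) (𝓡 2) μ x) :=
  ((hμ.smooth.contMDiffAt (x := x)).mdifferentiableAt (by simp)).hasMFDerivAt

/-- Torus orbits are isotropic. -/
theorem modelForm_modelGen (x : X) (ξ η : Plane) :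
    Ω.modelForm x (τ.modelGen ξ x) (τ.modelGen η x) = 0 := by
  rw [← hμ.inner_momentDeriv]
  have h1 := (hμ.hasMFDerivAt (τ.act 0 x)).comp (0 : Plane) (τ.hasMFDerivAt_act_left x)
  have h2 : (μ ∘ fun t : Plane => τ.act t x) = fun _ => μ x :=
    funext fun t => hμ.invariant t x
  rw [h2] at h1
  have h3 := hasMFDerivAt_iff_hasFDerivAt.1 h1
  have h4 := congrArg (fun f : Plane →L[ℝ] Plane => f ξ) (HasFDerivAt.unique
    (f' := (mfderiv (𝓡 4) (𝓡 2) μ (τ.act 0 x) ∘L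
      mfderiv (𝓡 2) (𝓡 4) (fun t : Plane => τ.act t x) 0 : Plane →L[ℝ] Plane)) h3
    (hasFDerivAt_const (μ x) (0 : Plane)))
  have h5 : momentDeriv μ (τ.act 0 x) (τ.modelGen ξ x) = 0 := h4
  rw [τ.act_zero] at h5
  rw [h5, inner_zero_left]

theorem modelForm_isoRep {x₀ : X} {t : Plane} (ht : τ.act t x₀ = x₀) (v w : Model4) :
    Ω.modelForm x₀ (τ.isoRep x₀ t v) (τ.isoRep x₀ t w) = Ω.modelForm x₀ v w := by
  have h : Ω.modelForm (τ.act t x₀) (mfderiv (𝓡 4) (𝓡 4) (τ.act t) x₀ v : Model4)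
      (mfderiv (𝓡 4) (𝓡 4) (τ.act t) x₀ w : Model4) = Ω.modelForm x₀ v w :=
    hμ.symplectic t x₀ v w
  rwa [EffectiveTorusAction.mfderiv_act ht, EffectiveTorusAction.mfderiv_act ht, ht] at h

theorem modelForm_isoGen {x₀ : X} {η : Plane} (hη : ∀ s : ℝ, τ.act (s • η) x₀ = x₀)
    (v w : Model4) :
    Ω.modelForm x₀ (τ.isoGen x₀ η v) w + Ω.modelForm x₀ v (τ.isoGen x₀ η w) = 0 := by
  have h1 := EffectiveTorusAction.hasDerivAt_isoRep_zero (τ := τ) x₀ η v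
  have h2 := EffectiveTorusAction.hasDerivAt_isoRep_zero (τ := τ) x₀ η w
  have h3 := ((Ω.modelForm x₀).hasFDerivAt.comp_hasDerivAt (0 : ℝ) h1).clm_apply h2
  have h4 : τ.isoRep x₀ 0 = 1 := EffectiveTorusAction.isoRep_of_trivial τ.act_zero
  have h5 := h3.unique ((hasDerivAt_const (0 : ℝ) (Ω.modelForm x₀ v w)).congr_of_eventuallyEq
    (Eventually.of_forall fun s => hμ.modelForm_isoRep (hη s) v w))
  simpa [h4] using h5

/-- At a point whose stabilizer contains the circle generated by a primitive lattice vector and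
whose isotropy representation fixes a tangent vector, that circle acts with weights `0` and `±1`. -/
theorem isoGen_cube [T2Space X] [ConnectedSpace X] {m : Fin 2 → ℤ} (hm : IsCoprime (m 0) (m 1))
    {x₀ : X} (hgen : τ.modelGen (intVec m) x₀ = 0) {ζ : Model4} (hζ : ζ ≠ 0)
    (hAζ : τ.isoGen x₀ (intVec m) ζ = 0) :
    (∀ v, τ.isoGen x₀ (intVec m) (τ.isoGen x₀ (intVec m) (τ.isoGen x₀ (intVec m) v))
      = -τ.isoGen x₀ (intVec m) v) ∧
    Module.finrank ℝ (LinearMap.range (τ.isoGen x₀ (intVec m)).toLinearMap) = 2 := by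
  have hfix := τ.act_smul_eq hgen
  exact (EffectiveTorusAction.isCircleRep hfix (τ.act_two_pi_smul m)).cube_eq_neg (by simp)
    (Ω.modelForm x₀) (Ω.modelForm_self x₀) (Ω.modelForm_nondegenerate x₀)
    (hμ.modelForm_isoGen hfix) hζ hAζ (EffectiveTorusAction.isoRep_ne_one hm hfix)

/-- Fixed points of the torus are isolated: a tangent vector killed by the linearizations of all
generating vector fields would be fixed by four circles with weights `0` and `±1`, which is
impossible in dimension four. -/
theorem eventually_exists_modelGen_ne_zero [T2Space X] [ConnectedSpace X] {x₀ : X}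
    (h0 : ∀ ξ, τ.modelGen ξ x₀ = 0) :
    ∀ᶠ x in 𝓝[≠] x₀, ∃ ξ, τ.modelGen ξ x ≠ 0 := by
  set e₁ : Plane := intVec ![1, 0] with he₁
  set e₂ : Plane := intVec ![0, 1] with he₂
  set A := τ.isoGen x₀ e₁ with hA
  set B := τ.isoGen x₀ e₂ with hB
  set z₀ : Model4 := extChartAt (𝓡 4) x₀ x₀ with hz₀
  have hadd : intVec ![1, 1] = e₁ + e₂ := by rw [he₁, he₂, ← map_add]; congr 1; simp
  have hsub : intVec ![1, -1] = e₁ + (-1 : ℝ) • e₂ := by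
    rw [neg_one_smul, ← sub_eq_add_neg, he₁, he₂, ← map_sub]; congr 1; simp
  have hAB : τ.isoGen x₀ (intVec ![1, 1]) = A + B := by
    rw [hadd, EffectiveTorusAction.isoGen_add]
  have hAB' : τ.isoGen x₀ (intVec ![1, -1]) = A - B := by
    rw [hsub, EffectiveTorusAction.isoGen_add, EffectiveTorusAction.isoGen_smul, sub_eq_add_neg]
    exact congrArg (A + ·) (neg_one_smul ℝ B)
  have hfixall : ∀ t, τ.act t x₀ = x₀ := fun t => by
    have := τ.act_smul_eq (h0 t) 1
    rwa [one_smul] at this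
  have hinj : ∀ v, A v = 0 → B v = 0 → v = 0 := by
    intro v hAv hBv
    by_contra hv
    have h1 := hμ.isoGen_cube (m := ![1, 0]) isCoprime_one_left (h0 _) hv hAv
    have h2 := hμ.isoGen_cube (m := ![0, 1]) isCoprime_one_right (h0 _) hv hBv
    have h3 := hμ.isoGen_cube (m := ![1, 1]) isCoprime_one_left (h0 _) hv
      (by rw [hAB]; simp [hAv, hBv])
    have h4 := hμ.isoGen_cube (m := ![1, -1]) isCoprime_one_left (h0 _) hv
      (by rw [hAB']; simp [hAv, hBv])
    rw [hAB] at h3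
    rw [hAB'] at h4
    exact hv (eq_zero_of_commuting_generators (by simp)
      (EffectiveTorusAction.isoGen_commute hfixall e₁ e₂) h1.1 h2.1 h3.1 h4.1 h1.2 h2.2 hAv hBv)
  have htgt := mem_extChartAt_target (I := 𝓡 4) x₀
  have hd : ∀ ξ, HasFDerivAt (τ.chartGen x₀ ξ) (τ.isoGen x₀ ξ) z₀ := fun ξ =>
    ((τ.contDiffAt_chartGen ξ htgt).differentiableAt (by simp)).hasFDerivAt
  have hprod := (hd e₁).prodMk (hd e₂)
  have hker : LinearMap.ker (A.prod B).toLinearMap = ⊥ := by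
    rw [LinearMap.ker_eq_bot']
    intro v hv
    have hv' : (A v, B v) = (0, 0) := hv
    exact hinj v (congrArg Prod.fst hv') (congrArg Prod.snd hv')
  obtain ⟨K, -, hK⟩ := LinearMap.exists_antilipschitzWith (A.prod B).toLinearMap hker
  have hne := hprod.eventually_ne (c := (0, 0)) ⟨K, hK⟩
  have hφ : Tendsto (extChartAt (𝓡 4) x₀) (𝓝[≠] x₀) (𝓝[≠] z₀) := by
    refine tendsto_nhdsWithin_of_tendsto_nhds_of_eventually_within _
      ((continuousAt_extChartAt x₀).mono_left nhdsWithin_le_nhds) ?_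
    have hsrc : ∀ᶠ x in 𝓝[≠] x₀, x ∈ (extChartAt (𝓡 4) x₀).source :=
      nhdsWithin_le_nhds (extChartAt_source_mem_nhds x₀)
    filter_upwards [hsrc, self_mem_nhdsWithin] with x hx hxne heq
    exact hxne ((extChartAt (𝓡 4) x₀).injOn hx (mem_extChartAt_source x₀) heq)
  have hsrc : ∀ᶠ x in 𝓝[≠] x₀, x ∈ (chartAt Model4 x₀).source :=
    nhdsWithin_le_nhds ((chartAt Model4 x₀).open_source.mem_nhds (mem_chart_source _ x₀))
  filter_upwards [hφ.eventually hne, hsrc] with x hx hxs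
  by_contra! hcon
  refine hx ?_
  rw [← τ.toModel_modelGen hxs, ← τ.toModel_modelGen hxs, hcon, hcon, map_zero]

end IsToricMomentMap

end Moment

/-! ### Rationality of stabilizers -/

/-- The stabilizer of a point on a one-dimensional orbit is generated, near the identity, by a
primitive lattice vector: an irrational direction would be dense in the torus. -/
theorem EffectiveTorusAction.exists_primitive_modelGen_eq_zero [T2Space X]
    (τ : EffectiveTorusAction X) {x : X} {ξ η : Plane} (hξ : ξ ≠ 0) (hgξ : τ.modelGen ξ x = 0)
    (hgη : τ.modelGen η x ≠ 0) :
    ∃ m : Fin 2 → ℤ, IsCoprime (m 0) (m 1) ∧ τ.modelGen (intVec m) x = 0 := by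
  set ℓ : Plane →L[ℝ] ℝ := ξ 1 • EuclideanSpace.proj (𝕜 := ℝ) (0 : Fin 2)
    - ξ 0 • EuclideanSpace.proj (𝕜 := ℝ) (1 : Fin 2) with hℓ
  have hℓa : ∀ t : Plane, ℓ t = ξ 1 * t 0 - ξ 0 * t 1 := fun t => by simp [hℓ]
  have hℓ0 : ℓ ≠ 0 := by
    intro h
    refine hξ ?_
    have h0 : ξ 0 = 0 := by
      have := hℓa (intVec ![0, 1]); simp [h] at this; exact this
    have h1 : ξ 1 = 0 := by
      have := hℓa (intVec ![1, 0]); simp [h] at this; exact this.symm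
    ext k; fin_cases k <;> simp [h0, h1]
  have hker : ∀ t, ℓ t = 0 → ∃ s : ℝ, t = s • ξ := by
    intro t ht
    rw [hℓa] at ht
    by_cases h0 : ξ 0 = 0
    · have h1 : ξ 1 ≠ 0 := fun h1 => hξ (by ext k; fin_cases k <;> simp [h0, h1])
      refine ⟨t 1 / ξ 1, ?_⟩
      rw [h0, zero_mul, sub_zero, mul_eq_zero, or_iff_right h1] at ht
      ext k; fin_cases k <;> simp [h0, h1, ht]
    · refine ⟨t 0 / ξ 0, ?_⟩
      ext k; fin_cases k
      · simp [h0]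
      · simp; field_simp; linear_combination -ht
  set T : (Fin 2 → ℤ) →+ ℝ := ℓ.toLinearMap.toAddMonoidHom.comp intVec with hT
  have hTa : ∀ m, T m = ℓ (intVec m) := fun m => rfl
  rcases T.range.dense_or_cyclic with hdense | ⟨a, ha⟩
  · exfalso
    have hdense2 : Dense ((fun t : ℝ => (2 * Real.pi)⁻¹ * t) ⁻¹' (T.range : Set ℝ)) :=
      hdense.preimage (Homeomorph.mulLeft₀ (2 * Real.pi)⁻¹ (by positivity)).isOpenMap
    have hsurj : Function.Surjective ℓ := by
      have := LinearMap.surjective (f := ℓ.toLinearMap)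
        (fun h => hℓ0 (ContinuousLinearMap.coe_injective h))
      exact this
    have hd := hdense2.preimage (ℓ.isOpenMap hsurj)
    have hclosed : IsClosed {t | τ.act t x = x} :=
      isClosed_eq (τ.continuous_act_left x) continuous_const
    have hsub : ℓ ⁻¹' ((fun t : ℝ => (2 * Real.pi)⁻¹ * t) ⁻¹' (T.range : Set ℝ))
        ⊆ {t | τ.act t x = x} := by
      rintro t ⟨m, hm⟩
      have h1 : ℓ (t - (2 * Real.pi) • intVec m) = 0 := by
        rw [map_sub, map_smul, ← hTa, hm, smul_eq_mul, ← mul_assoc,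
          mul_inv_cancel₀ (by positivity), one_mul, sub_self]
      obtain ⟨s, hs⟩ := hker _ h1
      change τ.act t x = x
      rw [← sub_add_cancel t ((2 * Real.pi) • intVec m), τ.act_add, τ.act_two_pi_smul, hs,
        τ.act_smul_eq hgξ]
    have huniv : {t | τ.act t x = x} = Set.univ := by
      rw [← hclosed.closure_eq, (hd.mono hsub).closure_eq]
    exact hgη (τ.modelGen_eq_zero fun s => (huniv ▸ Set.mem_univ _ : s • η ∈ {t | τ.act t x = x}))
  · have hmem : ∀ m, ∃ k : ℤ, T m = k * a := by
      intro m
      have h1 : T m ∈ AddSubgroup.closure {a} := ha ▸ ⟨m, rfl⟩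
      obtain ⟨k, hk⟩ := AddSubgroup.mem_closure_singleton.1 h1
      exact ⟨k, by rw [← hk]; simp⟩
    obtain ⟨p, hp⟩ := hmem ![1, 0]
    obtain ⟨q, hq⟩ := hmem ![0, 1]
    simp only [hTa, hℓa, intVec_apply] at hp hq
    norm_num at hp hq
    have hξeq : ξ = a • intVec ![-q, p] := by
      ext k; fin_cases k
      · simp; linarith
      · simp; linarith
    have ha0 : a ≠ 0 := fun h => hξ (by rw [hξeq, h, zero_smul])
    have hg : τ.modelGen (intVec ![-q, p]) x = 0 := by
      rw [hξeq, τ.modelGen_smul] at hgξ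
      exact (smul_eq_zero.1 hgξ).resolve_left ha0
    have hpos : 0 < Int.gcd (-q) p := by
      rw [Nat.pos_iff_ne_zero]
      intro h
      rw [Int.gcd_eq_zero_iff] at h
      refine hξ ?_
      rw [hξeq, h.1, h.2]
      ext k; fin_cases k <;> simp
    obtain ⟨m₀, m₁, hcop, h0, h1⟩ := Int.exists_gcd_one hpos
    refine ⟨![m₀, m₁], Int.isCoprime_iff_gcd_eq_one.2 hcop, ?_⟩
    have h2 : intVec ![-q, p] = ((Int.gcd (-q) p : ℕ) : ℝ) • intVec ![m₀, m₁] := by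
      have h0' : (-q : ℝ) = m₀ * (Int.gcd (-q) p : ℕ) := by exact_mod_cast h0
      have h1' : (p : ℝ) = m₁ * (Int.gcd (-q) p : ℕ) := by exact_mod_cast h1
      ext k; fin_cases k
      · simp only [Fin.zero_eta, intVec_apply, PiLp.smul_apply, smul_eq_mul]
        simp only [Matrix.cons_val_zero]
        push_cast
        rw [mul_comm]; exact h0'
      · simp only [Fin.mk_one, intVec_apply, PiLp.smul_apply, smul_eq_mul]
        simp only [Matrix.cons_val_one]
        rw [mul_comm]; exact h1'
    rw [h2, τ.modelGen_smul] at hg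
    exact (smul_eq_zero.1 hg).resolve_left (by exact_mod_cast hpos.ne')

end Rigidity

/-! ### Locally constant functions off a set of codimension two -/

section Codimension

open Filter Topology Metric

variable {F : Type*} [NormedAddCommGroup F] [InnerProductSpace ℝ F]

theorem isPreconnected_ball_diff {S : Submodule ℝ F} (hS : 1 < Module.rank ℝ (F ⧸ S)) (c : F)
    {r : ℝ} (hr : 0 < r) : IsPreconnected {z | z ∈ ball c r ∧ z - c ∉ S} := by
  have h1 : Continuous fun x : F => c + r • OpenPartialHomeomorph.univUnitBall x :=
    continuous_const.add ((continuousOn_univ.1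
      (OpenPartialHomeomorph.univUnitBall (E := F)).continuousOn).const_smul r)
  have h2 : {z | z ∈ ball c r ∧ z - c ∉ S}
      = (fun x : F => c + r • OpenPartialHomeomorph.univUnitBall x) '' (S : Set F)ᶜ := by
    ext z
    constructor
    · rintro ⟨hz, hzS⟩
      have hz1 : r⁻¹ • (z - c) ∈ (OpenPartialHomeomorph.univUnitBall (E := F)).target := by
        change _ ∈ ball (0 : F) 1
        rw [mem_ball_zero_iff, norm_smul, norm_inv, Real.norm_of_nonneg hr.le, inv_mul_lt_one₀ hr]
        exact mem_ball_iff_norm.1 hz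
      refine ⟨OpenPartialHomeomorph.univUnitBall.symm (r⁻¹ • (z - c)), fun hmem => hzS ?_, ?_⟩
      · have h3 := (OpenPartialHomeomorph.univUnitBall (E := F)).right_inv hz1
        rw [OpenPartialHomeomorph.univUnitBall_apply] at h3
        have h4 : r⁻¹ • (z - c) ∈ S := h3 ▸ S.smul_mem _ hmem
        have h5 := S.smul_mem r h4
        rwa [smul_smul, mul_inv_cancel₀ hr.ne', one_smul] at h5
      · simp only [(OpenPartialHomeomorph.univUnitBall (E := F)).right_inv hz1]
        rw [smul_smul, mul_inv_cancel₀ hr.ne', one_smul, add_sub_cancel]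
    · rintro ⟨x, hx, rfl⟩
      have hx1 : OpenPartialHomeomorph.univUnitBall x ∈ ball (0 : F) 1 :=
        (OpenPartialHomeomorph.univUnitBall (E := F)).map_source (Set.mem_univ x)
      have hne : (√(1 + ‖x‖ ^ 2))⁻¹ ≠ 0 := inv_ne_zero (Real.sqrt_ne_zero'.2 (by positivity))
      refine ⟨?_, fun hmem => hx ?_⟩
      · rw [mem_ball_iff_norm, add_sub_cancel_left, norm_smul, Real.norm_of_nonneg hr.le]
        have := mem_ball_zero_iff.1 hx1
        nlinarith
      · rw [add_sub_cancel_left, OpenPartialHomeomorph.univUnitBall_apply, smul_smul] at hmem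
        exact (S.smul_mem_iff (mul_ne_zero hr.ne' hne)).1 hmem
  rw [h2]
  exact (isConnected_compl_of_one_lt_codim hS).isPreconnected.image _ h1.continuousOn

theorem dense_compl_of_codim {S : Submodule ℝ F} (hS : 1 < Module.rank ℝ (F ⧸ S)) (c : F) :
    Dense {z | z - c ∉ S} := by
  have h1 : Dense ((S : Set F)ᶜ) := by
    rw [← interior_eq_empty_iff_dense_compl]
    by_contra h
    have := S.eq_top_of_nonempty_interior' (Set.nonempty_iff_ne_empty.2 h)
    subst this
    rw [rank_subsingleton'] at hS
    exact absurd hS (by simp)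
  exact h1.preimage (Homeomorph.subRight c).isOpenMap

variable {X : Type*} [TopologicalSpace X]

/-- In the domain of a chart in which `R` contains the complement of an affine subspace of
codimension at least two, locally constant functions on `R` are constant, and `R` accumulates at the
centre. -/
theorem exists_eventually_eq_of_codim (e : OpenPartialHomeomorph X F) {x₀ : X}
    (hx₀ : x₀ ∈ e.source) {S : Submodule ℝ F} (hS : 1 < Module.rank ℝ (F ⧸ S)) {R : Set X}
    (hR : ∀ x ∈ e.source, e x - e x₀ ∉ S → x ∈ R) {w : X → ℤ}
    (hw : ∀ x ∈ R, ∀ᶠ y in 𝓝 x, y ∈ R → w y = w x) :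
    (∃ c, ∀ᶠ y in 𝓝 x₀, y ∈ R → w y = c) ∧ ∃ᶠ y in 𝓝 x₀, y ∈ R := by
  obtain ⟨r, hr, hball⟩ := Metric.isOpen_iff.1 e.open_target _ (e.map_source hx₀)
  set D : Set F := {z | z ∈ ball (e x₀) r ∧ z - e x₀ ∉ S} with hD
  have hDR : ∀ z ∈ D, e.symm z ∈ R := fun z hz =>
    hR _ (e.map_target (hball hz.1)) (by rw [e.right_inv (hball hz.1)]; exact hz.2)
  have hcont : ContinuousOn (fun z => w (e.symm z)) D := by
    intro z hz
    have h1 : ContinuousAt e.symm z := e.continuousAt_symm (hball hz.1)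
    have h2 := h1.eventually (hw _ (hDR z hz))
    refine tendsto_nhds_of_eventually_eq ?_
    filter_upwards [nhdsWithin_le_nhds h2, self_mem_nhdsWithin] with y hy hyD
    exact hy (hDR y hyD)
  have hpre : IsPreconnected D := isPreconnected_ball_diff hS (e x₀) hr
  have hfreq : ∀ y ∈ e.source, e y ∈ ball (e x₀) r → ∃ᶠ x in 𝓝 y, x ∈ e.symm '' D := by
    intro y hy hyb
    have h1 : ∃ᶠ z in 𝓝 (e y), z ∈ D :=
      ((mem_closure_iff_frequently.1 (dense_compl_of_codim hS (e x₀) (e y))).and_eventually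
        (isOpen_ball.mem_nhds hyb)).mono fun z hz => ⟨hz.2, hz.1⟩
    have h2 : Tendsto e.symm (𝓝 (e y)) (𝓝 y) := by
      have := e.continuousAt_symm (e.map_source hy)
      rwa [ContinuousAt, e.left_inv hy] at this
    exact h2.frequently (h1.mono fun z hz => ⟨z, hz, rfl⟩)
  have hne := hfreq x₀ hx₀ (mem_ball_self hr)
  refine ⟨?_, hne.mono ?_⟩
  · obtain ⟨-, z₁, hz₁, -⟩ := hne.exists
    refine ⟨w (e.symm z₁), ?_⟩
    filter_upwards [e.open_source.mem_nhds hx₀,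
      (e.continuousAt hx₀).eventually (isOpen_ball.mem_nhds (mem_ball_self hr))] with y hy hyb hyR
    obtain ⟨-, ⟨z, hz, rfl⟩, h⟩ := ((hfreq y hy hyb).and_eventually (hw y hyR)).exists
    rw [← h (hDR z hz)]
    exact hpre.constant hcont hz hz₁
  · rintro - ⟨z, hz, rfl⟩
    exact hDR z hz

/-- A locally constant function on `R` extends to a locally constant function on `R'`, if `R` is
dense in `R'` and the function is constant on `R` near each point of `R'`. -/
theorem exists_locallyConstant_extension {R R' : Set X} {w : X → ℤ} (hRR' : R ⊆ R')
    (h : ∀ x ∈ R', (∃ c, ∀ᶠ y in 𝓝 x, y ∈ R → w y = c) ∧ ∃ᶠ y in 𝓝 x, y ∈ R) :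
    ∃ w' : X → ℤ, (∀ x ∈ R', ∀ᶠ y in 𝓝 x, y ∈ R' → w' y = w' x) ∧ ∀ x ∈ R, w' x = w x := by
  classical
  choose c hc using fun x : R' => (h x x.2).1
  refine ⟨fun x => if hx : x ∈ R' then c ⟨x, hx⟩ else 0, fun x hx => ?_, fun x hx => ?_⟩
  · filter_upwards [(hc ⟨x, hx⟩).eventually_nhds] with y hy hyR'
    simp only [dif_pos hx, dif_pos hyR']
    obtain ⟨z, hz, h1, h2⟩ := ((h y hyR').2.and_eventually (hy.and (hc ⟨y, hyR'⟩))).exists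
    rw [← h1 hz, ← h2 hz]
  · simp only [dif_pos (hRR' hx)]
    exact ((hc ⟨x, hRR' hx⟩).self_of_nhds hx).symm

end Codimension

/-! ### Regular points -/

section Regular

open Filter Topology

variable {X : Type u} [TopologicalSpace X] [ChartedSpace Model4 X] [IsManifold (𝓡 4) ∞ X]

theorem exists_eq_smul_of_det_eq_zero {ξ η : Plane} (hη : η ≠ 0)
    (h : η 0 * ξ 1 - η 1 * ξ 0 = 0) : ∃ c : ℝ, ξ = c • η := by
  by_cases h0 : η 0 = 0
  · have h1 : η 1 ≠ 0 := fun h1 => hη (by ext k; fin_cases k <;> simp [h0, h1])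
    refine ⟨ξ 1 / η 1, ?_⟩
    rw [h0, zero_mul, zero_sub, neg_eq_zero, mul_eq_zero, or_iff_right h1] at h
    ext k; fin_cases k <;> simp [h0, h1, h]
  · refine ⟨ξ 0 / η 0, ?_⟩
    ext k; fin_cases k
    · simp [h0]
    · simp; field_simp; linear_combination h

theorem det_smul_add_det_smul (ξ η ζ : Plane) :
    (ξ 0 * η 1 - ξ 1 * η 0) • ζ + (η 0 * ζ 1 - η 1 * ζ 0) • ξ
      + (ζ 0 * ξ 1 - ζ 1 * ξ 0) • η = 0 := by
  ext k; fin_cases k <;> simp <;> ring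

namespace EffectiveTorusAction

/-- The points where the action is locally free. -/
def regularSet (τ : EffectiveTorusAction X) : Set X := {x | ∀ ξ, ξ ≠ 0 → τ.modelGen ξ x ≠ 0}

variable {τ : EffectiveTorusAction X}

theorem act_mem_regularSet {x : X} (hx : x ∈ τ.regularSet) (t : Plane) :
    τ.act t x ∈ τ.regularSet := by
  intro ξ hξ h0
  refine hx ξ hξ (τ.modelGen_eq_zero fun s => ?_)
  have h1 := congrArg (τ.act (-t)) (τ.act_smul_eq h0 s)
  rwa [← τ.act_add, ← τ.act_add, ← τ.act_add, neg_add_cancel, τ.act_zero,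
    show -t + s • ξ + t = s • ξ by abel] at h1

/-- A numerical test for regularity of points `y` near a point `x` on a one-dimensional orbit: the
component of the generator of the stabilizer transverse to the orbit direction does not vanish. The
map `L` reads tangent vectors at `y` in a chart. -/
theorem mem_regularSet_of_smul_sub_ne_zero {x y : X} {ξ η : Plane} (hξ : ξ ≠ 0)
    (hgξ : τ.modelGen ξ x = 0) (hgη : τ.modelGen η x ≠ 0) (ℓ : Model4 →L[ℝ] ℝ)
    (L : Model4 →L[ℝ] Model4)
    (hne : ℓ (L (τ.modelGen η y)) • L (τ.modelGen ξ y)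
      - ℓ (L (τ.modelGen ξ y)) • L (τ.modelGen η y) ≠ 0) :
    y ∈ τ.regularSet := by
  intro ζ hζ h0
  have h1 := congrArg (fun ξ => L (τ.modelGen ξ y)) (det_smul_add_det_smul ξ η ζ)
  have hz : τ.modelGen 0 y = 0 := by
    have := τ.modelGen_smul 0 0 y
    rwa [zero_smul, zero_smul] at this
  simp only [τ.modelGen_add, τ.modelGen_smul, map_add, map_smul, h0, map_zero, smul_zero,
    zero_add, hz] at h1
  set p := η 0 * ζ 1 - η 1 * ζ 0 with hp
  set q := ζ 0 * ξ 1 - ζ 1 * ξ 0 with hq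
  set a := L (τ.modelGen ξ y)
  set b := L (τ.modelGen η y)
  have h2 : p * ℓ a + q * ℓ b = 0 := by simpa using congrArg ℓ h1
  refine hne ?_
  by_cases hq0 : q = 0
  · have hp0 : p ≠ 0 := by
      intro hp0
      obtain ⟨c, hc⟩ := exists_eq_smul_of_det_eq_zero hζ hq0
      obtain ⟨d, hd⟩ := exists_eq_smul_of_det_eq_zero hζ (ξ := η) (by linear_combination -hp0)
      have hc0 : c ≠ 0 := by rintro rfl; exact hξ (by rw [hc, zero_smul])
      rw [hc, τ.modelGen_smul, smul_eq_zero, or_iff_right hc0] at hgξ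
      exact hgη (by rw [hd, τ.modelGen_smul, hgξ, smul_zero])
    rw [hq0, zero_smul, add_zero, smul_eq_zero, or_iff_right hp0] at h1
    rw [h1]; simp
  · have h3 : b = (-(p / q)) • a := by
      have h4 : q • b = (-p) • a := by linear_combination (norm := module) h1
      calc b = q⁻¹ • q • b := by rw [smul_smul, inv_mul_cancel₀ hq0, one_smul]
        _ = _ := by rw [h4, smul_smul]; congr 1; field_simp
    rw [h3, map_smul, smul_smul, ← sub_smul, smul_eq_mul]
    rw [show -(p / q) * ℓ a - ℓ a * -(p / q) = 0 by ring, zero_smul]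

end EffectiveTorusAction

variable {Ω : SymplecticForm X} {τ : EffectiveTorusAction X} {μ : X → Plane}

theorem rank_quotient_of_finrank_ker {S : Submodule ℝ Model4} (hS : Module.finrank ℝ S ≤ 2) :
    1 < Module.rank ℝ (Model4 ⧸ S) := by
  have h1 := S.finrank_quotient_add_finrank
  have h2 : Module.finrank ℝ Model4 = 4 := by simp
  rw [← Module.finrank_eq_rank]
  exact_mod_cast (by omega : 1 < Module.finrank ℝ (Model4 ⧸ S))

/-- Near a point on a one-dimensional orbit, the points that are not regular lie in a submanifold
of codimension two, the fixed point set of the stabilizer circle. -/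
theorem IsToricMomentMap.exists_chart_regularSet [T2Space X] [ConnectedSpace X]
    (hμ : IsToricMomentMap Ω τ μ) {x₀ : X} {m : Fin 2 → ℤ} (hm : IsCoprime (m 0) (m 1))
    (hgen : τ.modelGen (intVec m) x₀ = 0) {ξ : Plane} (hξ : τ.modelGen ξ x₀ ≠ 0) :
    ∃ e : OpenPartialHomeomorph X Model4, x₀ ∈ e.source ∧
      ∀ x ∈ e.source,
        e x - e x₀ ∉ LinearMap.ker (τ.isoGen x₀ (intVec m)).toLinearMap → x ∈ τ.regularSet := by
  have hfix := τ.act_smul_eq hgen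
  set A := τ.isoGen x₀ (intVec m) with hA
  set ζ := τ.modelGen ξ x₀ with hζ
  have hAζ : A ζ = 0 := EffectiveTorusAction.isoGen_modelGen hfix ξ
  have hcube : ∀ v, A (A (A v)) = -A v := (hμ.isoGen_cube hm hgen hξ hAζ).1
  set z₀ : Model4 := extChartAt (𝓡 4) x₀ x₀ with hz₀
  set G : Model4 → Model4 := τ.chartGen x₀ (intVec m) with hG
  set H : Model4 → Model4 := τ.chartGen x₀ ξ with hH
  have htgt := mem_extChartAt_target (I := 𝓡 4) x₀
  have hGd : HasStrictFDerivAt G A z₀ :=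
    (τ.contDiffAt_chartGen (intVec m) htgt).hasStrictFDerivAt (by simp)
  have hHd : HasStrictFDerivAt H (τ.isoGen x₀ ξ) z₀ :=
    (τ.contDiffAt_chartGen ξ htgt).hasStrictFDerivAt (by simp)
  have hG0 : G z₀ = 0 := by rw [hG, ← τ.modelGen_eq, hgen]
  have hH0 : H z₀ = ζ := (τ.modelGen_eq x₀ ξ).symm
  obtain ⟨ℓ, hℓ⟩ : ∃ ℓ : Model4 →L[ℝ] ℝ, ℓ ζ = 1 := by
    refine ⟨(‖ζ‖ ^ 2)⁻¹ • innerSL ℝ ζ, ?_⟩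
    have : ‖ζ‖ ≠ 0 := norm_ne_zero_iff.2 hξ
    simp only [smul_apply, innerSL_apply_apply, real_inner_self_eq_norm_sq, smul_eq_mul]
    field_simp
  -- The components of the generators transverse to the orbit and to the fixed point set.
  set W : Model4 → Model4 := fun z => ℓ (H z) • G z - ℓ (G z) • H z with hW
  have hWd : HasStrictFDerivAt W (A - (ℓ ∘L A).smulRight ζ) z₀ := by
    have h1 := ((ℓ.hasStrictFDerivAt.comp z₀ hHd).fun_smul hGd).fun_sub
      ((ℓ.hasStrictFDerivAt.comp z₀ hGd).fun_smul hHd)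
    have h2 : A - (ℓ ∘L A).smulRight ζ = ℓ (H z₀) • A + (ℓ ∘L τ.isoGen x₀ ξ).smulRight (G z₀)
        - (ℓ (G z₀) • τ.isoGen x₀ ξ + (ℓ ∘L A).smulRight (H z₀)) :=
      ContinuousLinearMap.ext fun v => by simp [hG0, hH0, hℓ]
    rw [h2]
    exact h1
  -- The coordinate change `κ` agrees with `W` transverse to the kernel of `A` and with the chart
  -- along it; its derivative `1 + A + A²` at `x₀` has the inverse `1 - A + A²`.
  set E : Model4 ≃L[ℝ] Model4 := ContinuousLinearEquiv.equivOfInverse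
    (1 + A + A ∘L A) (1 - A + A ∘L A)
    (fun v => by simp [hcube])
    (fun v => by simp [hcube]; abel) with hE
  set κ : Model4 → Model4 := fun z => -A (A (W z)) + (z + A (A z)) with hκ
  have hκd : HasStrictFDerivAt κ (E : Model4 →L[ℝ] Model4) z₀ := by
    have h1 := ((A ∘L A).hasStrictFDerivAt.comp z₀ hWd).fun_neg.fun_add
      ((hasStrictFDerivAt_id z₀).fun_add ((A ∘L A).hasStrictFDerivAt))
    have h2 : (E : Model4 →L[ℝ] Model4) = -((A ∘L A) ∘L (A - (ℓ ∘L A).smulRight ζ))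
        + (ContinuousLinearMap.id ℝ Model4 + A ∘L A) := ContinuousLinearMap.ext fun v => by
      simp [hE, hAζ, hcube]
      abel
    rw [h2]
    exact h1
  refine ⟨(chartAt Model4 x₀).trans (hκd.toOpenPartialHomeomorph κ), ?_, fun x hx hxS => ?_⟩
  · exact ⟨mem_chart_source _ x₀, hκd.mem_toOpenPartialHomeomorph_source⟩
  · have hxs : x ∈ (chartAt Model4 x₀).source := hx.1
    refine EffectiveTorusAction.mem_regularSet_of_smul_sub_ne_zero (ξ := intVec m) ?_ hgen hξ ℓ
      (toModel x₀ x) ?_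
    · intro h0
      have h1 : (m 0 : ℝ) = 0 := congrArg (fun t : Plane => t 0) h0
      have h2 : (m 1 : ℝ) = 0 := congrArg (fun t : Plane => t 1) h0
      norm_cast at h1 h2
      rw [h1, h2] at hm
      exact not_isCoprime_zero_zero hm
    · rw [τ.toModel_modelGen hxs, τ.toModel_modelGen hxs]
      intro h0
      refine hxS ?_
      have hW0 : W (extChartAt (𝓡 4) x₀ x) = 0 := h0
      have hWz : W z₀ = 0 := by simp [hW, hG0]
      have hAκ : ∀ z, W z = 0 → A (κ z - κ z₀) = 0 := fun z hz => by
        simp [hκ, hz, hWz, hcube]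
      exact hAκ _ hW0

end Regular

/-! ### The complex area of the orbits -/

section OrbitArea

open Filter Topology Set

variable {X : Type u} [TopologicalSpace X] [ChartedSpace Model4 X] [IsManifold (𝓡 4) ∞ X]
  {Ω : SymplecticForm X} {j : CompatibleJ Ω}

theorem eq_smul_add_smul (ξ : Plane) :
    ξ = ξ 0 • intVec ![1, 0] + ξ 1 • intVec ![0, 1] := by
  ext k; fin_cases k <;> simp

namespace AreaForm

theorem swap (a : AreaForm j) (x : X) (v w : Model4) : a.form x v w = -a.form x w v := by
  have h := a.alternating x (v + w)
  simp only [map_add, add_apply, a.alternating] at h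
  linear_combination h

/-- The complex area of the standard basis of the Lie algebra, tangent to the orbit through `x`. -/
noncomputable def orbitArea (a : AreaForm j) (τ : EffectiveTorusAction X) (x : X) : ℂ :=
  a.form x (τ.modelGen (intVec ![1, 0]) x) (τ.modelGen (intVec ![0, 1]) x)

variable (a : AreaForm j) {τ : EffectiveTorusAction X}

theorem form_modelGen (ξ η : Plane) (x : X) :
    a.form x (τ.modelGen ξ x) (τ.modelGen η x)
      = ((ξ 0 * η 1 - ξ 1 * η 0 : ℝ) : ℂ) * a.orbitArea τ x := by
  conv_lhs => rw [eq_smul_add_smul ξ, eq_smul_add_smul η]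
  simp only [τ.modelGen_add, τ.modelGen_smul, map_add, map_smul, add_apply, smul_apply,
    a.alternating, Complex.real_smul, orbitArea]
  rw [a.swap x (τ.modelGen (intVec ![0, 1]) x) (τ.modelGen (intVec ![1, 0]) x)]
  push_cast
  ring

theorem continuous_orbitArea : Continuous (a.orbitArea τ) := by
  rw [continuous_iff_continuousAt]
  intro x₀
  set G : (Fin 2 → ℤ) → X → Model4 := fun m x =>
    τ.chartGen x₀ (intVec m) (extChartAt (𝓡 4) x₀ x) with hG
  have hGc : ∀ m, ContinuousAt (G m) x₀ := fun m =>
    ContinuousAt.comp (g := τ.chartGen x₀ (intVec m))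
      (τ.contDiffAt_chartGen _ (mem_extChartAt_target x₀)).continuousAt (continuousAt_extChartAt x₀)
  have h1 := ContinuousAt.comp (f := fun x => (x, G ![1, 0] x, G ![0, 1] x)) (x := x₀)
    (a.continuousAt x₀ (G ![1, 0] x₀) (G ![0, 1] x₀))
    (continuousAt_id.prodMk ((hGc _).prodMk (hGc _)))
  refine h1.congr ?_
  filter_upwards [(chartAt Model4 x₀).open_source.mem_nhds (mem_chart_source _ x₀)] with x hx
  simp only [Function.comp, orbitArea, τ.modelGen_eq_ofModel hx, hG]

/-- The orbits are isotropic, so free orbits are totally real. -/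
theorem orbitArea_ne_zero {μ : X → Plane} (hμ : IsToricMomentMap Ω τ μ) {x : X}
    (hx : x ∈ τ.regularSet) : a.orbitArea τ x ≠ 0 := by
  have h2 : (intVec ![0, 1] : Plane) ≠ 0 := fun h => by
    simpa using congrArg (fun t : Plane => t 1) h
  refine a.ne_zero_of_isotropic (hx _ h2) (fun c hc => ?_) (hμ.modelForm_modelGen x _ _)
  have h3 : (intVec ![1, 0] + (-c) • intVec ![0, 1] : Plane) ≠ 0 := fun h => by
    simpa using congrArg (fun t : Plane => t 0) h
  refine hx _ h3 ?_
  rw [τ.modelGen_add, τ.modelGen_smul, hc]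
  simp

/-- The complex area along the loop in the torus given by a lattice vector. -/
noncomputable def orbitLoop (a : AreaForm j) (τ : EffectiveTorusAction X) (m : Fin 2 → ℤ) (x : X)
    (s : ℝ) : ℂ :=
  a.orbitArea τ (τ.act (s • (2 * Real.pi) • intVec m) x)

theorem continuous_orbitLoop (m : Fin 2 → ℤ) :
    Continuous (Function.uncurry (a.orbitLoop τ m)) := by
  have h1 : Continuous fun p : X × ℝ => (p.2 • (2 * Real.pi) • intVec m, p.1) := by fun_prop
  exact a.continuous_orbitArea.comp (τ.continuous_act.comp h1)

theorem orbitLoop_one (m : Fin 2 → ℤ) (x : X) :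
    a.orbitLoop τ m x 1 = a.orbitLoop τ m x 0 := by
  rw [orbitLoop, orbitLoop, one_smul, τ.act_two_pi_smul, zero_smul, τ.act_zero]

theorem exists_winding {μ : X → Plane} (hμ : IsToricMomentMap Ω τ μ) {x : X}
    (hx : x ∈ τ.regularSet) :
    ∃ w : (Fin 2 → ℤ) →+ ℤ, ∀ m, HasWinding (a.orbitLoop τ m x) (w m) := by
  refine exists_winding_hom ((DistribSMul.toAddMonoidHom Plane (2 * Real.pi)).comp intVec)
    (F := fun t => a.orbitArea τ (τ.act t x))
    (a.continuous_orbitArea.comp (τ.continuous_act_left x))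
    (fun t => a.orbitArea_ne_zero hμ (EffectiveTorusAction.act_mem_regularSet hx t))
    fun t m => ?_
  have : τ.act ((2 * Real.pi) • intVec m) x = x := τ.act_two_pi_smul m x
  simp only [τ.act_add, AddMonoidHom.comp_apply, DistribSMul.toAddMonoidHom_apply, this]

/-- The regular set is the complement of a closed set of codimension two in a connected manifold;
so the winding numbers do not depend on the orbit. -/
theorem exists_winding_uniform [T2Space X] [ConnectedSpace X] {μ : X → Plane}
    (hμ : IsToricMomentMap Ω τ μ) :
    ∃ w : (Fin 2 → ℤ) →+ ℤ, ∀ x ∈ τ.regularSet, ∀ m, HasWinding (a.orbitLoop τ m x) (w m) := by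
  classical
  rcases τ.regularSet.eq_empty_or_nonempty with hemp | ⟨x₁, hx₁⟩
  · exact ⟨0, fun x hx => by simp [hemp] at hx⟩
  choose! w hw using fun x (hx : x ∈ τ.regularSet) => a.exists_winding hμ hx
  refine ⟨w x₁, fun x hx m => ?_⟩
  -- Extend `w` across the one-dimensional orbits and then across the fixed points.
  suffices h : w x₁ m = w x m by rw [h]; exact hw x hx m
  have hloc : ∀ x ∈ τ.regularSet, ∀ᶠ y in 𝓝 x, y ∈ τ.regularSet → w y m = w x m := by
    intro x hx
    have h1 := (hw x hx m).eventually (Φ := a.orbitLoop τ m)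
      (fun s _ => (a.continuous_orbitLoop m).continuousAt) (a.orbitLoop_one m x)
    filter_upwards [h1] with y hy hyR
    refine (hw y hyR m).unique (hy ?_ (a.orbitLoop_one m y))
    exact ((a.continuous_orbitLoop m).comp (Continuous.prodMk_right y)).continuousOn
  set R' : Set X := {x | ∃ ξ, τ.modelGen ξ x ≠ 0} with hR'
  have hsub : τ.regularSet ⊆ R' := fun x hx => by
    refine ⟨intVec ![1, 0], hx _ fun h => ?_⟩
    simpa using congrArg (fun t : Plane => t 0) h
  obtain ⟨w', hw'loc, hw'⟩ := exists_locallyConstant_extension (w := fun x => w x m) hsub (by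
    rintro x ⟨η, hη⟩
    by_cases hx : x ∈ τ.regularSet
    · refine ⟨⟨w x m, hloc x hx⟩, fun hcon => ?_⟩
      -- Regularity of `x` itself witnesses that `x` is in the closure of the regular set.
      exact hcon.self_of_nhds hx
    · obtain ⟨ξ, hξ, hgξ⟩ : ∃ ξ, ξ ≠ 0 ∧ τ.modelGen ξ x = 0 := by
        simpa [EffectiveTorusAction.regularSet] using hx
      obtain ⟨p, hp, hgp⟩ := τ.exists_primitive_modelGen_eq_zero hξ hgξ hη
      obtain ⟨e, he, heR⟩ := hμ.exists_chart_regularSet hp hgp hη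
      have hrk := (hμ.isoGen_cube hp hgp hη
        (EffectiveTorusAction.isoGen_modelGen (τ.act_smul_eq hgp) η)).2
      have hker := LinearMap.finrank_range_add_finrank_ker (τ.isoGen x (intVec p)).toLinearMap
      have h4 : Module.finrank ℝ Model4 = 4 := by simp
      exact exists_eventually_eq_of_codim e he (rank_quotient_of_finrank_ker (by omega)) heR hloc)
  obtain ⟨w'', hw''loc, hw''⟩ := exists_locallyConstant_extension (R' := univ) (w := w')
    (subset_univ R') (by
    intro x _
    by_cases hx : x ∈ R'
    · exact ⟨⟨w' x, hw'loc x hx⟩, fun hcon => hcon.self_of_nhds hx⟩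
    · have h0 : ∀ ξ, τ.modelGen ξ x = 0 := by simpa [hR'] using hx
      obtain ⟨V, hV, hVo, hxV⟩ := _root_.eventually_nhds_iff.1
        (eventually_nhdsWithin_iff.1 (hμ.eventually_exists_modelGen_ne_zero h0))
      refine exists_eventually_eq_of_codim ((chartAt Model4 x).restr V) (S := ⊥) ?_
        (rank_quotient_of_finrank_ker (by simp)) ?_ hw'loc
      · rw [OpenPartialHomeomorph.restr_source, hVo.interior_eq]
        exact ⟨mem_chart_source _ x, hxV⟩
      · intro y hy hne
        rw [OpenPartialHomeomorph.restr_source, hVo.interior_eq] at hy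
        refine hV y hy.2 ?_
        rintro rfl
        simp at hne)
  have hconst : IsLocallyConstant w'' := (IsLocallyConstant.iff_eventually_eq w'').2 fun x =>
    (hw''loc x (mem_univ x)).mono fun y hy => hy (mem_univ y)
  rw [← hw' x₁ hx₁, ← hw' x hx, ← hw'' x₁ (hsub hx₁), ← hw'' x (hsub hx)]
  exact hconst.apply_eq_of_preconnectedSpace x₁ x

end AreaForm

end OrbitArea

/-! ### Minima of Hamiltonians -/

section Minimum

open Filter Topology Set

variable {X : Type u} [TopologicalSpace X] [ChartedSpace Model4 X] [IsManifold (𝓡 4) ∞ X]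
  {Ω : SymplecticForm X} {τ : EffectiveTorusAction X} {μ : X → Plane}

theorem ofModel_self (x₀ : X) (v : Model4) : ofModel x₀ x₀ v = v := by
  conv_lhs => rw [← EffectiveTorusAction.toModel_self x₀ v]
  exact ofModel_toModel (mem_chart_source _ x₀) v

namespace IsToricMomentMap

variable (hμ : IsToricMomentMap Ω τ μ)
include hμ

/-- The differential of a component of the moment map in the preferred chart at `x₀`. -/
theorem hasFDerivAt_inner {x₀ x : X} (hx : x ∈ (chartAt Model4 x₀).source) (ξ : Plane) :
    HasFDerivAt (fun z => ⟪μ ((extChartAt (𝓡 4) x₀).symm z), ξ⟫)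
      ((innerSL ℝ ξ) ∘L momentDeriv μ x ∘L ofModel x₀ x) (extChartAt (𝓡 4) x₀ x) := by
  have hxs : x ∈ (extChartAt (𝓡 4) x₀).source := by rwa [extChartAt_source]
  have hxt := (extChartAt (𝓡 4) x₀).map_source hxs
  have h1 : HasMFDerivAt 𝓘(ℝ, Model4) (𝓡 4) (extChartAt (𝓡 4) x₀).symm (extChartAt (𝓡 4) x₀ x)
      (mfderiv 𝓘(ℝ, Model4) (𝓡 4) (extChartAt (𝓡 4) x₀).symm (extChartAt (𝓡 4) x₀ x)) := by
    refine MDifferentiableAt.hasMFDerivAt (ContMDiffAt.mdifferentiableAt (n := ∞) ?_ (by simp))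
    exact (contMDiffOn_extChartAt_symm x₀).contMDiffAt
      ((isOpen_extChartAt_target x₀).mem_nhds hxt)
  have h2 := hasMFDerivAt_iff_hasFDerivAt.1 ((hμ.hasMFDerivAt _).comp _ h1)
  have h3 : (mfderiv 𝓘(ℝ, Model4) (𝓡 4) (extChartAt (𝓡 4) x₀).symm (extChartAt (𝓡 4) x₀ x) :
      Model4 →L[ℝ] Model4) = ofModel x₀ x := by
    have h4 := TangentBundle.symmL_trivializationAt (I := 𝓡 4) hx
    rw [ModelWithCorners.range_eq_univ, mfderivWithin_univ] at h4
    exact h4.symm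
  have h5 : HasFDerivAt (μ ∘ (extChartAt (𝓡 4) x₀).symm)
      (momentDeriv μ ((extChartAt (𝓡 4) x₀).symm (extChartAt (𝓡 4) x₀ x)) ∘L
        (mfderiv 𝓘(ℝ, Model4) (𝓡 4) (extChartAt (𝓡 4) x₀).symm (extChartAt (𝓡 4) x₀ x) :
      Model4 →L[ℝ] Model4)) (extChartAt (𝓡 4) x₀ x) := h2
  rw [h3, (extChartAt (𝓡 4) x₀).left_inv hxs] at h5
  have h6 := (innerSL ℝ ξ).hasFDerivAt.comp (extChartAt (𝓡 4) x₀ x) h5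
  refine h6.congr_of_eventuallyEq (Eventually.of_forall fun z => ?_)
  simp only [Function.comp, innerSL_apply_apply, real_inner_comm]

theorem modelGen_eq_zero_of_isMin {x₀ : X} {ξ : Plane}
    (hmin : ∀ x, ⟪μ x₀, ξ⟫ ≤ ⟪μ x, ξ⟫) : τ.modelGen ξ x₀ = 0 := by
  have h1 := hμ.hasFDerivAt_inner (mem_chart_source Model4 x₀) ξ
  have h2 : IsLocalMin (fun z => ⟪μ ((extChartAt (𝓡 4) x₀).symm z), ξ⟫)
      (extChartAt (𝓡 4) x₀ x₀) := Eventually.of_forall fun z => by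
    simp only [extChartAt_to_inv]
    exact hmin _
  have h3 := h2.hasFDerivAt_eq_zero h1
  refine Ω.modelForm_nondegenerate x₀ _ fun v => ?_
  have h4 := congrArg (fun f : Model4 →L[ℝ] ℝ => f v) h3
  simp only [ContinuousLinearMap.comp_apply, ofModel_self, innerSL_apply_apply, zero_apply] at h4
  rw [Ω.modelForm_swap, ← hμ.inner_momentDeriv, real_inner_comm, h4, neg_zero]

/-- The Hessian of a Hamiltonian at a minimum is positive semidefinite. -/
theorem modelForm_isoGen_nonneg {x₀ : X} {ξ : Plane}
    (hmin : ∀ x, ⟪μ x₀, ξ⟫ ≤ ⟪μ x, ξ⟫) (v : Model4) :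
    0 ≤ Ω.modelForm x₀ v (τ.isoGen x₀ ξ v) := by
  by_contra! hneg
  set z₀ : Model4 := extChartAt (𝓡 4) x₀ x₀ with hz₀
  set φ := (extChartAt (𝓡 4) x₀).symm with hφ
  set h : ℝ → ℝ := fun s => ⟪μ (φ (z₀ + s • v)), ξ⟫ with hh
  set g : ℝ → Model4 := fun s => τ.chartGen x₀ ξ (z₀ + s • v) with hg
  have htgt := mem_extChartAt_target (I := 𝓡 4) x₀
  have hline : ∀ s, HasDerivAt (fun s : ℝ => z₀ + s • v) v s := fun s => by
    simpa using ((hasDerivAt_id s).smul_const v).const_add z₀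
  have hline0 : Tendsto (fun s : ℝ => z₀ + s • v) (𝓝 0) (𝓝 z₀) := by
    have := (hline 0).continuousAt
    rwa [ContinuousAt, zero_smul, add_zero] at this
  have hφc : Tendsto (fun s : ℝ => φ (z₀ + s • v)) (𝓝 0) (𝓝 x₀) := by
    have := continuousAt_extChartAt_symm (I := 𝓡 4) x₀
    rw [ContinuousAt, extChartAt_to_inv] at this
    exact this.comp hline0
  have hg0 : g 0 = 0 := by
    simp only [hg, zero_smul, add_zero]
    rw [hz₀, ← τ.modelGen_eq]
    exact hμ.modelGen_eq_zero_of_isMin hmin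
  have hgd : HasDerivAt g (τ.isoGen x₀ ξ v) 0 := by
    have h1 : HasFDerivAt (τ.chartGen x₀ ξ) (τ.isoGen x₀ ξ) (z₀ + (0 : ℝ) • v) := by
      rw [zero_smul, add_zero]
      exact ((τ.contDiffAt_chartGen ξ htgt).differentiableAt (by simp)).hasFDerivAt
    exact h1.comp_hasDerivAt (0 : ℝ) (hline 0)
  have hd : ∀ᶠ s in 𝓝 (0 : ℝ), HasDerivAt h (Ω.modelForm (φ (z₀ + s • v))
      (ofModel x₀ (φ (z₀ + s • v)) v) (ofModel x₀ (φ (z₀ + s • v)) (g s))) s := by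
    filter_upwards [hline0.eventually ((isOpen_extChartAt_target x₀).mem_nhds htgt)] with s hs
    set x := φ (z₀ + s • v) with hx
    have hxs : x ∈ (chartAt Model4 x₀).source := by
      rw [← extChartAt_source (𝓡 4)]; exact (extChartAt (𝓡 4) x₀).map_target hs
    have hxz : extChartAt (𝓡 4) x₀ x = z₀ + s • v := (extChartAt (𝓡 4) x₀).right_inv hs
    have h1 := hμ.hasFDerivAt_inner hxs ξ
    rw [hxz] at h1
    have h2 := h1.comp_hasDerivAt s (hline s)
    have h3 : ((innerSL ℝ ξ) ∘L momentDeriv μ x ∘L ofModel x₀ x) v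
        = Ω.modelForm x (ofModel x₀ x v) (ofModel x₀ x (g s)) := by
      have h4 := τ.modelGen_eq_ofModel hxs ξ
      rw [hxz] at h4
      rw [← h4, ← hμ.inner_momentDeriv, real_inner_comm]
      rfl
    rw [← h3]
    exact h2
  have hlim : Tendsto (fun s : ℝ => Ω.modelForm (φ (z₀ + s • v))
      (ofModel x₀ (φ (z₀ + s • v)) v) (ofModel x₀ (φ (z₀ + s • v)) (dslope g 0 s))) (𝓝 0)
      (𝓝 (Ω.modelForm x₀ v (τ.isoGen x₀ ξ v))) := by
    have h1 : Tendsto (dslope g 0) (𝓝 0) (𝓝 (τ.isoGen x₀ ξ v)) := by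
      have := continuousAt_dslope_same.2 hgd.differentiableAt
      rwa [ContinuousAt, dslope_same, hgd.deriv] at this
    have h2 := Ω.continuousAt_ofModel x₀ v (τ.isoGen x₀ ξ v)
    rw [ContinuousAt] at h2
    simp only [ofModel_self] at h2
    have h3 : Tendsto (fun s : ℝ => (φ (z₀ + s • v), v, dslope g 0 s)) (𝓝 0)
        (𝓝 (x₀, v, τ.isoGen x₀ ξ v)) :=
      hφc.prodMk_nhds (tendsto_const_nhds.prodMk_nhds h1)
    exact Tendsto.comp (f := fun s : ℝ => (φ (z₀ + s • v), v, dslope g 0 s)) h2 h3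
  obtain ⟨δ, hδ, hball⟩ := Metric.eventually_nhds_iff_ball.1
    (hd.and (hlim.eventually (gt_mem_nhds hneg)))
  have hmem : ∀ s ∈ Icc (0 : ℝ) (δ / 2), s ∈ Metric.ball (0 : ℝ) δ := fun s hs => by
    rw [mem_ball_zero_iff, Real.norm_of_nonneg hs.1]
    linarith [hs.2]
  have hanti : StrictAntiOn h (Icc 0 (δ / 2)) := by
    refine strictAntiOn_of_deriv_neg (convex_Icc _ _)
      (fun s hs => (hball s (hmem s hs)).1.continuousAt.continuousWithinAt) fun s hs => ?_
    rw [interior_Icc] at hs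
    obtain ⟨h1, h2⟩ := hball s (hmem s ⟨hs.1.le, hs.2.le⟩)
    rw [h1.deriv]
    rw [dslope_of_ne _ hs.1.ne', slope_def_module, hg0, sub_zero, sub_zero, map_smul, map_smul,
      smul_eq_mul] at h2
    exact neg_of_mul_neg_right h2 (inv_nonneg.2 hs.1.le)
  have h1 := hanti (left_mem_Icc.2 (by linarith)) (right_mem_Icc.2 (by linarith))
    (by linarith : (0 : ℝ) < δ / 2)
  have h2 : h 0 = ⟪μ x₀, ξ⟫ := by
    simp only [hh, zero_smul, add_zero]
    rw [hφ, hz₀, extChartAt_to_inv]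
  rw [h2] at h1
  exact absurd (hmin _) (not_le.2 h1)

/-- The Hessian of a Hamiltonian at a minimum is definite off its kernel. -/
theorem modelForm_isoGen_pos {x₀ : X} {ξ : Plane}
    (hmin : ∀ x, ⟪μ x₀, ξ⟫ ≤ ⟪μ x, ξ⟫) {v : Model4} (hv : τ.isoGen x₀ ξ v ≠ 0) :
    0 < Ω.modelForm x₀ v (τ.isoGen x₀ ξ v) := by
  refine lt_of_le_of_ne (hμ.modelForm_isoGen_nonneg hmin v) fun h0 => hv ?_
  have hfix := τ.act_smul_eq (hμ.modelGen_eq_zero_of_isMin hmin)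
  set A := τ.isoGen x₀ ξ
  refine Ω.modelForm_nondegenerate x₀ _ fun w => ?_
  have hsymm : Ω.modelForm x₀ v (A w) = Ω.modelForm x₀ w (A v) := by
    have := hμ.modelForm_isoGen hfix v w
    rw [Ω.modelForm_swap x₀ (A v) w] at this
    linarith
  set b := Ω.modelForm x₀ w (A v)
  set q := Ω.modelForm x₀ w (A w)
  have hq : ∀ t : ℝ, 0 ≤ q + 2 * t * b := fun t => by
    have h1 := hμ.modelForm_isoGen_nonneg hmin (w + t • v)
    simp only [map_add, map_smul, add_apply, smul_apply, smul_eq_mul] at h1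
    change 0 ≤ q + t * Ω.modelForm x₀ v (A w) + t * (b + t * Ω.modelForm x₀ v (A v)) at h1
    rw [hsymm, ← h0] at h1
    linarith
  have hb : b = 0 := by
    by_contra hb
    have h1 := hq (-(q + 1) / (2 * b))
    have h2 : 2 * (-(q + 1) / (2 * b)) * b = -(q + 1) := by field_simp
    rw [h2] at h1
    linarith
  rw [Ω.modelForm_swap]
  change -b = 0
  rw [hb, neg_zero]

end IsToricMomentMap

end Minimum

/-! ### Winding around an edge -/

section Edge

open Filter Topology Set

variable {X : Type u} [TopologicalSpace X] [ChartedSpace Model4 X] [IsManifold (𝓡 4) ∞ X]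
  {Ω : SymplecticForm X} {j : CompatibleJ Ω} {τ : EffectiveTorusAction X} {μ : X → Plane}

theorem AreaForm.mem_regularSet (a : AreaForm j) {x : X} (h : a.orbitArea τ x ≠ 0) :
    x ∈ τ.regularSet := by
  intro ξ hξ h0
  have h1 := fun m => a.form_modelGen (τ := τ) ξ (intVec m) x
  simp only [h0, map_zero, zero_apply, zero_eq_mul, or_iff_left h, Complex.ofReal_eq_zero,
    intVec_apply] at h1
  refine hξ ?_
  have h2 := h1 ![1, 0]
  have h3 := h1 ![0, 1]
  ext k; fin_cases k
  · simpa using h3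
  · simpa using h2

/-- The complex area of two tangent vectors transported by the torus action, in the preferred chart
at `x₀`. -/
noncomputable def AreaForm.transport (a : AreaForm j) (τ : EffectiveTorusAction X) (x₀ : X)
    (p : Plane × Model4 × Model4 × Model4) : ℂ :=
  let D := fderiv ℝ (τ.chartAct x₀) (p.1, p.2.1)
  let x := (extChartAt (𝓡 4) x₀).symm (τ.chartAct x₀ (p.1, p.2.1))
  a.form x (ofModel x₀ x (D (0, p.2.2.1))) (ofModel x₀ x (D (0, p.2.2.2)))

theorem AreaForm.transport_of_fixed (a : AreaForm j) {x₀ : X} {t : Plane}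
    (ht : τ.act t x₀ = x₀) (v w : Model4) :
    a.transport τ x₀ (t, extChartAt (𝓡 4) x₀ x₀, v, w)
      = a.form x₀ (τ.isoRep x₀ t v) (τ.isoRep x₀ t w) := by
  simp only [transport, EffectiveTorusAction.chartAct_of_fixed ht, extChartAt_to_inv, ofModel_self]
  rfl

theorem AreaForm.continuousAt_transport (a : AreaForm j) {x₀ : X} {t : Plane}
    (ht : τ.act t x₀ = x₀) (v w : Model4) :
    ContinuousAt (a.transport τ x₀) (t, extChartAt (𝓡 4) x₀ x₀, v, w) := by
  set z₀ : Model4 := extChartAt (𝓡 4) x₀ x₀ with hz₀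
  have hdom := EffectiveTorusAction.mem_chartDomain_of_fixed ht
  have hD : ContinuousAt (fun p : Plane × Model4 × Model4 × Model4 =>
      fderiv ℝ (τ.chartAct x₀) (p.1, p.2.1)) (t, z₀, v, w) :=
    ContinuousAt.comp (g := fderiv ℝ (τ.chartAct x₀))
      (f := fun p : Plane × Model4 × Model4 × Model4 => (p.1, p.2.1))
      ((τ.contDiffAt_chartAct hdom).fderiv_right (m := ∞) (by simp)).continuousAt (by fun_prop)
  have hx : ContinuousAt (fun p : Plane × Model4 × Model4 × Model4 =>
      (extChartAt (𝓡 4) x₀).symm (τ.chartAct x₀ (p.1, p.2.1))) (t, z₀, v, w) := by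
    refine ContinuousAt.comp (g := (extChartAt (𝓡 4) x₀).symm)
      (f := fun p : Plane × Model4 × Model4 × Model4 => τ.chartAct x₀ (p.1, p.2.1)) ?_ ?_
    · simp only [hz₀, EffectiveTorusAction.chartAct_of_fixed ht]
      exact continuousAt_extChartAt_symm x₀
    · exact ContinuousAt.comp (g := τ.chartAct x₀)
        (f := fun p : Plane × Model4 × Model4 × Model4 => (p.1, p.2.1))
        (τ.contDiffAt_chartAct hdom).continuousAt (by fun_prop)
  have hv : ContinuousAt (fun p : Plane × Model4 × Model4 × Model4 =>
      fderiv ℝ (τ.chartAct x₀) (p.1, p.2.1) (0, p.2.2.1)) (t, z₀, v, w) :=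
    hD.clm_apply (by fun_prop)
  have hw : ContinuousAt (fun p : Plane × Model4 × Model4 × Model4 =>
      fderiv ℝ (τ.chartAct x₀) (p.1, p.2.1) (0, p.2.2.2)) (t, z₀, v, w) :=
    hD.clm_apply (by fun_prop)
  have hx0 : (extChartAt (𝓡 4) x₀).symm (τ.chartAct x₀ (t, z₀)) = x₀ := by
    rw [hz₀, EffectiveTorusAction.chartAct_of_fixed ht, extChartAt_to_inv]
  have ha := a.continuousAt x₀ (fderiv ℝ (τ.chartAct x₀) (t, z₀) (0, v))
    (fderiv ℝ (τ.chartAct x₀) (t, z₀) (0, w))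
  rw [show x₀ = (extChartAt (𝓡 4) x₀).symm (τ.chartAct x₀ (t, z₀)) from hx0.symm] at ha
  rw [hx0] at ha
  refine ContinuousAt.comp_of_eq (g := fun q : X × Model4 × Model4 =>
    a.form q.1 (ofModel x₀ q.1 q.2.1) (ofModel x₀ q.1 q.2.2))
    (f := fun p : Plane × Model4 × Model4 × Model4 =>
      ((extChartAt (𝓡 4) x₀).symm (τ.chartAct x₀ (p.1, p.2.1)),
        fderiv ℝ (τ.chartAct x₀) (p.1, p.2.1) (0, p.2.2.1),
        fderiv ℝ (τ.chartAct x₀) (p.1, p.2.1) (0, p.2.2.2))) ha (hx.prodMk (hv.prodMk hw)) ?_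
  simp only [hx0]

theorem AreaForm.transport_chartGen (a : AreaForm j) {x₀ : X} {t : Plane} {z : Model4}
    (h : (t, z) ∈ τ.chartDomain x₀) (ξ η : Plane) :
    a.transport τ x₀ (t, z, τ.chartGen x₀ ξ z, τ.chartGen x₀ η z)
      = ((ξ 0 * η 1 - ξ 1 * η 0 : ℝ) : ℂ) *
        a.orbitArea τ (τ.act t ((extChartAt (𝓡 4) x₀).symm z)) := by
  have hx := h.2
  rw [← a.form_modelGen, τ.modelGen_eq_ofModel hx, τ.modelGen_eq_ofModel hx]
  simp only [transport, ← τ.chartGen_chartAct h, τ.symm_chartAct h]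
  rfl

/-- Along a loop in the torus that contracts at a minimum of its Hamiltonian, the complex area of
nearby orbits winds once: in the limit it traces out an ellipse, the area of the orbit and a vector
rotated by the isotropy representation. -/
theorem IsToricMomentMap.winding_eq_one [T2Space X] [ConnectedSpace X]
    (hμ : IsToricMomentMap Ω τ μ) (a : AreaForm j) {m : Fin 2 → ℤ}
    (hm : IsCoprime (m 0) (m 1)) {x₀ : X}
    (hmin : ∀ x, ⟪μ x₀, intVec m⟫ ≤ ⟪μ x, intVec m⟫) {ξ : Plane} (hξ : τ.modelGen ξ x₀ ≠ 0) {k : ℤ}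
    (hk : ∀ x ∈ τ.regularSet, HasWinding (a.orbitLoop τ m x) k) : k = 1 := by
  have hgen := hμ.modelGen_eq_zero_of_isMin hmin
  have hfix := τ.act_smul_eq hgen
  set A := τ.isoGen x₀ (intVec m) with hA
  set ζ := τ.modelGen ξ x₀ with hζ
  have hAζ : A ζ = 0 := EffectiveTorusAction.isoGen_modelGen hfix ξ
  obtain ⟨hcube', hrank⟩ := hμ.isoGen_cube hm hgen hξ hAζ
  have hcube : ∀ v, A (A (A v)) = -A v := hcube'
  have hrep := EffectiveTorusAction.isCircleRep hfix (τ.act_two_pi_smul m)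
  obtain ⟨u, hu⟩ : ∃ u, A u ≠ 0 := by
    by_contra! h
    have : LinearMap.range A.toLinearMap = ⊥ := by
      rw [LinearMap.range_eq_bot]
      exact LinearMap.ext h
    rw [this, finrank_bot] at hrank
    omega
  set z₀ : Model4 := extChartAt (𝓡 4) x₀ x₀ with hz₀
  have htgt := mem_extChartAt_target (I := 𝓡 4) x₀
  set δ : ℝ := intVec m 0 * ξ 1 - intVec m 1 * ξ 0 with hδ
  have hδ0 : δ ≠ 0 := by
    intro h
    obtain ⟨c, hc⟩ := exists_eq_smul_of_det_eq_zero (η := intVec m) (ξ := ξ) (fun h0 => by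
      have h1 : (m 0 : ℝ) = 0 := congrArg (fun t : Plane => t 0) h0
      have h2 : (m 1 : ℝ) = 0 := congrArg (fun t : Plane => t 1) h0
      norm_cast at h1 h2
      rw [h1, h2] at hm
      exact not_isCoprime_zero_zero hm) h
    exact hξ (by rw [hζ, hc, τ.modelGen_smul, hgen, smul_zero])
  set T : Plane := (2 * Real.pi) • intVec m with hT
  have hfixT : ∀ s : ℝ, τ.act (s • T) x₀ = x₀ := fun s => by rw [hT, smul_smul]; exact hfix _
  -- The limit loop.
  set E : ℝ → ℂ := fun s => a.form x₀ (τ.isoRep x₀ (s • T) (A u)) (τ.isoRep x₀ (s • T) ζ) with hE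
  have hEw : HasWinding E 1 := by
    have hskew := hμ.modelForm_isoGen hfix
    have horth : ∀ v, Ω.modelForm x₀ (A v) ζ = 0 := fun v => by
      have h1 := hskew v ζ
      rwa [hAζ, map_zero, add_zero] at h1
    have hpos : 0 < Ω.modelForm x₀ (A u) (A (A u)) := by
      refine hμ.modelForm_isoGen_pos hmin fun h0 => hu ?_
      have h1 := hcube u
      rwa [show A (A u) = 0 from h0, map_zero, zero_eq_neg] at h1
    refine (hasWinding_ellipse (a.orientation hξ (horth u) (horth _) hpos)).congr fun s _ => ?_
    have h1 : s • T = (2 * Real.pi * s) • intVec m := by rw [hT, smul_smul, mul_comm]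
    have h2 : τ.isoRep x₀ (s • T) (A u)
        = Real.cos (2 * Real.pi * s) • A u + Real.sin (2 * Real.pi * s) • A (A u) := by
      rw [h1]; exact hrep.apply_of_cube (hcube u) (2 * Real.pi * s)
    have h3 : τ.isoRep x₀ (s • T) ζ = ζ := by
      rw [h1]; exact hrep.apply_of_ker hAζ (2 * Real.pi * s)
    simp only [hE, h2, h3, map_add, map_smul, add_apply, smul_apply, Complex.real_smul]
  have hE1 : E 1 = E 0 := by
    have h1 : τ.isoRep x₀ ((1 : ℝ) • T) = 1 := by
      rw [one_smul]; exact EffectiveTorusAction.isoRep_of_trivial (τ.act_two_pi_smul m)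
    have h2 : τ.isoRep x₀ ((0 : ℝ) • T) = 1 := by
      rw [zero_smul]; exact EffectiveTorusAction.isoRep_of_trivial τ.act_zero
    simp only [hE, h1, h2]
  -- The loops along the orbits through the points `z₀ + ε u`, rescaled.
  set Z : ℝ → Model4 := fun ε => z₀ + ε • u with hZ
  set g : ℝ → Model4 := fun ε => τ.chartGen x₀ (intVec m) (Z ε) with hg
  have hZd : HasDerivAt (fun ε : ℝ => z₀ + ε • u) u 0 := by
    simpa using ((hasDerivAt_id (0 : ℝ)).smul_const u).const_add z₀
  have hZ0 : Z 0 = z₀ := by simp only [hZ, zero_smul, add_zero]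
  have hgd : HasDerivAt g (A u) 0 := by
    have h1 : HasFDerivAt (τ.chartGen x₀ (intVec m)) A (Z 0) := by
      rw [hZ0]
      exact ((τ.contDiffAt_chartGen _ htgt).differentiableAt (by simp)).hasFDerivAt
    exact h1.comp_hasDerivAt (0 : ℝ) hZd
  have hg0 : g 0 = 0 := by
    simp only [hg, hZ0]
    rw [hz₀, ← τ.modelGen_eq, hgen]
  set x : ℝ → X := fun ε => (extChartAt (𝓡 4) x₀).symm (Z ε) with hx
  set Φ : ℝ → ℝ → ℂ := fun ε s =>
    if ε = 0 then E s else ((ε⁻¹ * δ : ℝ) : ℂ) * a.orbitLoop τ m (x ε) s with hΦ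
  have hΦ0 : Φ 0 = E := by funext s; simp only [hΦ, if_true]
  have hcont : ∀ s : ℝ, ContinuousAt (Function.uncurry Φ) (0, s) := by
    intro s
    set C : ℝ × ℝ → Plane × Model4 × Model4 × Model4 := fun p =>
      (p.2 • T, Z p.1, dslope g 0 p.1, τ.chartGen x₀ ξ (Z p.1)) with hC
    have hC0 : ∀ s, C (0, s) = (s • T, z₀, A u, ζ) := fun s => by
      simp only [hC, hZ0, dslope_same, hgd.deriv]
      rw [hz₀, ← τ.modelGen_eq]
    have hfst : ∀ {Y : Type} [TopologicalSpace Y] {f : ℝ → Y}, ContinuousAt f 0 →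
        ContinuousAt (fun p : ℝ × ℝ => f p.1) (0, s) := fun hf =>
      ContinuousAt.comp_of_eq hf continuousAt_fst rfl
    have hZc : ContinuousAt Z 0 := hZd.continuousAt
    have hGc : ContinuousAt (fun ε => τ.chartGen x₀ ξ (Z ε)) 0 :=
      ContinuousAt.comp_of_eq (τ.contDiffAt_chartGen ξ htgt).continuousAt hZc hZ0
    have hCc : ContinuousAt C (0, s) :=
      (by fun_prop : ContinuousAt (fun p : ℝ × ℝ => p.2 • T) (0, s)).prodMk
        ((hfst hZc).prodMk ((hfst (continuousAt_dslope_same.2 hgd.differentiableAt)).prodMk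
          (hfst hGc)))
    have h1 : ContinuousAt (fun p => a.transport τ x₀ (C p)) (0, s) :=
      ContinuousAt.comp_of_eq (a.continuousAt_transport (hfixT s) (A u) ζ) hCc (hC0 s)
    refine h1.congr ?_
    have hdom : ∀ᶠ p : ℝ × ℝ in 𝓝 (0, s), (p.2 • T, Z p.1) ∈ τ.chartDomain x₀ := by
      have h2 : ContinuousAt (fun p : ℝ × ℝ => (p.2 • T, Z p.1)) (0, s) :=
        (by fun_prop : ContinuousAt (fun p : ℝ × ℝ => p.2 • T) (0, s)).prodMk (hfst hZc)
      refine h2.eventually ((τ.isOpen_chartDomain x₀).mem_nhds ?_)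
      simp only [hZ0]
      exact EffectiveTorusAction.mem_chartDomain_of_fixed (hfixT s)
    filter_upwards [hdom] with p hp
    obtain ⟨ε, r⟩ := p
    by_cases hε : ε = 0
    · subst hε
      simp only [Function.uncurry, hΦ0, hC0]
      exact a.transport_of_fixed (hfixT r) (A u) ζ
    · have h3 : dslope g 0 ε = τ.chartGen x₀ (ε⁻¹ • intVec m) (Z ε) := by
        rw [dslope_of_ne _ hε, slope_def_module, hg0, sub_zero, sub_zero, τ.chartGen_smul]
      simp only [Function.uncurry, hΦ, if_neg hε, hC, h3]
      rw [a.transport_chartGen hp, AreaForm.orbitLoop]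
      congr 2
      simp only [PiLp.smul_apply, smul_eq_mul, hδ]
      ring
  have hev := HasWinding.eventually (Φ := Φ) (y₀ := (0 : ℝ)) (n := 1) (by rw [hΦ0]; exact hEw)
    (fun s _ => hcont s) (by rw [hΦ0]; exact hE1)
  obtain ⟨ε, hε, hε0⟩ := ((hev.filter_mono nhdsWithin_le_nhds).and
    (self_mem_nhdsWithin : {(0 : ℝ)}ᶜ ∈ 𝓝[≠] (0 : ℝ))).exists
  have hε0' : ε ≠ 0 := hε0
  have hΦε : Φ ε = fun s => ((ε⁻¹ * δ : ℝ) : ℂ) * a.orbitLoop τ m (x ε) s := by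
    funext s; simp only [hΦ, if_neg hε0']
  have hne : ((ε⁻¹ * δ : ℝ) : ℂ) ≠ 0 := by
    exact_mod_cast mul_ne_zero (inv_ne_zero hε0') hδ0
  rw [hΦε] at hε
  have hw := hε (continuousOn_const.mul
    ((a.continuous_orbitLoop m).comp (Continuous.prodMk_right (x ε))).continuousOn)
    (by simp only [a.orbitLoop_one])
  have hw' : HasWinding (a.orbitLoop τ m (x ε)) 1 :=
    (hw.const_mul (inv_ne_zero hne)).congr fun s _ => by
      rw [← mul_assoc, inv_mul_cancel₀ hne, one_mul]
  refine (hk (x ε) (a.mem_regularSet ?_)).unique hw'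
  obtain ⟨L, -, hL, -⟩ := hw'
  have h0 := hL 0 (by simp)
  rw [AreaForm.orbitLoop, zero_smul, τ.act_zero] at h0
  rw [← h0]
  exact Complex.exp_ne_zero _

/-- A nontrivial convex subset of the moment image, such as an edge, is uncountable, so its preimage
does not consist of fixed points of the torus only, which are isolated. -/
theorem IsToricMomentMap.exists_modelGen_ne_zero [T2Space X] [SecondCountableTopology X]
    [ConnectedSpace X] (hμ : IsToricMomentMap Ω τ μ) {S : Set Plane} (hS : Convex ℝ S)
    (hS' : S.Nontrivial) (hSμ : S ⊆ range μ) : ∃ x, μ x ∈ S ∧ ∃ ξ, τ.modelGen ξ x ≠ 0 := by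
  -- Otherwise `S` is contained in the image of the fixed point set, which is countable.
  by_contra! hcon
  set D : Set X := {x | ∀ ξ, τ.modelGen ξ x = 0} with hD
  have hdisc : DiscreteTopology D := by
    rw [discreteTopology_subtype_iff]
    intro x hx
    have h1 := hμ.eventually_exists_modelGen_ne_zero hx
    rw [← disjoint_iff, Filter.disjoint_principal_right]
    filter_upwards [h1] with y ⟨ξ, hξ⟩ hy
    exact hξ (hy ξ)
  have hcount : D.Countable := TopologicalSpace.separableSpace_iff_countable.1 inferInstance
  have hScount : S.Countable := (hcount.image μ).mono fun p hp => by
    obtain ⟨x, rfl⟩ := hSμ hp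
    exact ⟨x, hcon x hp, rfl⟩
  obtain ⟨p, hp, q, hq, hpq⟩ := hS'
  have h1 : (Icc (0 : ℝ) 1).Countable :=
    (hScount.preimage_of_injOn (f := AffineMap.lineMap p q)
      (AffineMap.lineMap_injective ℝ hpq).injOn).mono fun t ht =>
        hS.segment_subset hp hq (segment_eq_image_lineMap ℝ p q ▸ mem_image_of_mem _ ht)
  have h2 := h1.measure_zero MeasureTheory.volume
  simp at h2

end Edge

/-! ### Normals of an edge path on a line -/

/-- Consecutive lattice bases on an affine line at height one. -/
theorem exists_specialLinearGroup_mulVec_eq {n : ℕ} {ν : Fin (n + 1) → Fin 2 → ℤ}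
    (hdet : ∀ i : Fin n, planeDet (ν i.castSucc) (ν i.succ) = -1) {p q : ℤ}
    (hη : ∀ i, p * ν i 0 + q * ν i 1 = 1) :
    ∃ A : Matrix.SpecialLinearGroup (Fin 2) ℤ, ∀ i : Fin (n + 1),
      (A : Matrix (Fin 2) (Fin 2) ℤ).mulVec (ν i) = ![(i : ℤ), 1 - (i : ℤ)] := by
  -- The first row vanishes on `ν 0`, and the two rows add up to the height `(p, q)`.
  refine ⟨⟨!![ν 0 1, -ν 0 0; p - ν 0 1, q + ν 0 0], ?_⟩, ?_⟩
  · rw [Matrix.det_fin_two_of]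
    linear_combination hη 0
  · have key : ∀ i : Fin (n + 1), ν 0 1 * ν i 0 - ν 0 0 * ν i 1 = i := by
      intro i
      induction i using Fin.induction with
      | zero => simp; ring
      | succ i ih =>
        have h1 := hdet i
        have h2 := hη i.castSucc
        have h3 := hη i.succ
        have h0 := hη 0
        simp only [planeDet] at h1
        simp only [Fin.val_succ, Fin.val_castSucc] at ih ⊢
        push_cast
        -- The two rows have determinant one, so `det (ν i, ν (i+1))` is the difference of the
        -- first coordinates of the images.
        linear_combination ih + (ν 0 1 * ν i.castSucc 0 - ν 0 0 * ν i.castSucc 1) * h3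
          - (ν 0 1 * ν i.succ 0 - ν 0 0 * ν i.succ 1) * h2
          - (ν i.castSucc 0 * ν i.succ 1 - ν i.castSucc 1 * ν i.succ 0) * h0 - h1
    intro i
    have h1 := key i
    have h2 := hη i
    ext k
    fin_cases k
    · simp [Matrix.mulVec, dotProduct, Fin.sum_univ_two]
      linear_combination h1
    · simp [Matrix.mulVec, dotProduct, Fin.sum_univ_two]
      linear_combination h2 - h1

end Toric

theorem lemma6p3 {X : Type u} [TopologicalSpace X] [T2Space X] [SecondCountableTopology X]
    [ConnectedSpace X] [ChartedSpace Toric.Model4 X] [IsManifold (𝓡 4) ∞ X]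
    (Ω : Toric.SymplecticForm X) (τ : Toric.EffectiveTorusAction X) (μ : X → Toric.Plane)
    (hμ : Toric.IsToricMomentMap Ω τ μ)
    {n : ℕ} (ν : Fin (n + 1) → Fin 2 → ℤ) (c : Fin (n + 1) → ℝ)
    (hP : Toric.IsOrderedMomentPolygon (Set.range μ) ν c)
    (hc₁ : Ω.FirstChernClassEqZero) :
    (∃ A : Matrix.SpecialLinearGroup (Fin 2) ℤ, ∀ j : Fin (n + 1),
      (A : Matrix (Fin 2) (Fin 2) ℤ).mulVec (ν j) = ![(j : ℤ), 1 - (j : ℤ)]) ∧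
    ∃ α β : ℝ, (![-β, α] : Fin 2 → ℝ) ≠ 0 ∧
      (∀ j : Fin (n + 1), ![-β, α] ⬝ᵥ (fun k => (ν j k : ℝ)) = 1) ∧
      0 < Toric.planeDet ![α, β] (fun k => (ν 0 k : ℝ)) ∧
      0 < Toric.planeDet ![α, β] (fun k => (ν (Fin.last n) k : ℝ)) := by
  obtain ⟨j, hj⟩ := hc₁
  obtain ⟨a⟩ := hj.exists_areaForm
  obtain ⟨w, hw⟩ := a.exists_winding_uniform hμ
  have hform : ∀ i x, Toric.affineForm (ν i) (c i) x = ⟪x, Toric.intVec (ν i)⟫ + c i := by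
    intro i x
    simp only [Toric.affineForm, PiLp.inner_apply, Fin.sum_univ_two, Toric.intVec_apply,
      RCLike.inner_apply, conj_trivial]
    ring
  have hw1 : ∀ i, w (ν i) = 1 := by
    intro i
    have hconv : Convex ℝ (Toric.edge (Set.range μ) (ν i) (c i)) := by
      have h1 : Toric.edge (Set.range μ) (ν i) (c i)
          = Set.range μ ∩ {x | (innerSL ℝ (Toric.intVec (ν i))) x = -c i} := by
        ext x
        simp only [Toric.edge, Set.mem_ofPred_eq, Set.mem_inter_iff, hform, innerSL_apply_apply,
          real_inner_comm, add_eq_zero_iff_eq_neg]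
      rw [h1]
      exact hμ.convex_range.inter (convex_hyperplane
        (innerSL ℝ (Toric.intVec (ν i))).toLinearMap.isLinear _)
    obtain ⟨x₀, hx₀, ξ, hξ⟩ := hμ.exists_modelGen_ne_zero hconv (hP.edge_nontrivial i)
      (fun x hx => hx.1)
    refine hμ.winding_eq_one a (hP.primitive i) (x₀ := x₀) (fun x => ?_) hξ
      fun x hx => hw x hx (ν i)
    have h0 : ⟪μ x₀, Toric.intVec (ν i)⟫ + c i = 0 := by rw [← hform]; exact hx₀.2
    have h1 : μ x ∈ Set.range μ := ⟨x, rfl⟩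
    rw [hP.eq_halfPlanes] at h1
    have h2 := h1 i
    rw [hform] at h2
    linarith
  have hlin : ∀ i, w ![1, 0] * ν i 0 + w ![0, 1] * ν i 1 = 1 := by
    intro i
    have h1 : ν i = ν i 0 • ![1, 0] + ν i 1 • ![0, 1] := by
      ext k; fin_cases k <;> simp
    have h2 := hw1 i
    rw [h1, map_add, map_zsmul, map_zsmul, smul_eq_mul, smul_eq_mul] at h2
    linarith
  have hlinR : ∀ i, (w ![1, 0] : ℝ) * ν i 0 + (w ![0, 1] : ℝ) * ν i 1 = 1 := fun i => by
    exact_mod_cast hlin i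
  refine ⟨Toric.exists_specialLinearGroup_mulVec_eq hP.det_consecutive hlin,
    w ![0, 1], -w ![1, 0], ?_, ?_, ?_, ?_⟩
  · intro h
    have h0 := congrFun h 0
    have h1 := congrFun h 1
    simp at h0 h1
    have h2 := hlin 0
    simp [h0, h1] at h2
  · intro i
    simp [dotProduct, Fin.sum_univ_two]
    exact hlinR i
  · have := hlinR 0
    simp only [Toric.planeDet, Matrix.cons_val_zero, Matrix.cons_val_one]
    linarith
  · have := hlinR (Fin.last n)
    simp only [Toric.planeDet, Matrix.cons_val_zero, Matrix.cons_val_one]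
    linarith
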